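/- **Conventions.** Let $\mathcal S$ be a monoid written additively, with neutral element $0$ (for example a subsemigroup of $\mathbb R_+^k$ containing $0$), and let $\mathcal N$ be a W$^*$-algebra. A W$^*$-correspondence over $\mathcal N$ is a self-dual Hilbert C$^*$-module over $\mathcal N$ (inner product linear in the second variable) with a normal left action of $\mathcal N$ by adjointable operators; $\otimes$ denotes the self-dual tensor product over $\mathcal N$. An adjointable bimodule map $U$ is coisometric if $UU^*=I$. A *subproduct system* $X=\{X(s)\}_{s\in\mathcal S}$ of $\mathcal N$-correspondences consists of W$^*$-correspondences $X(s)$ over $\mathcal N$ with $X(0)=\mathcal N$ and coisometric bimodule maps $U_{s,t}:X(s)\otimes X(t)\to X(s+t)$, written $U_{s,t}(x\otimes y)=xy$, such that the product is associative and $U_{0,s}$, $U_{s,0}$ are given by the left and the right action of $\mathcal N$. It is a *product system* if all $U_{s,t}$ are unitary. A *morphism* $V:X\to Y$ of subproduct systems (over W$^*$-algebras $\mathcal N$ and $\mathcal P$) consists of a unital $*$-isomorphism $V_0:\mathcal N\to\mathcal P$ and, for $s\ne 0$, coisometric bimodule maps $V_s:X(s)\to Y(s)$ (adjoints and bimodule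 structures being understood after identifying $\mathcal N$ and $\mathcal P$ by $V_0$) with $V_{s+t}(xy)=V_s(x)V_t(y)$; it is an *isomorphism* if $V_s$ is unitary for all $s\neq 0$. A *representation* $R$ of $X$ on a Hilbert space $H$ consists of completely contractive linear maps $R_s:X(s)\to B(H)$, where $\sigma:=R_0$ is a normal unital $*$-homomorphism, with $R_s(axb)=\sigma(a)R_s(x)\sigma(b)$ and $R_{s+t}(xy)=R_s(x)R_t(y)$. It is *isometric* if $R_s(x)^*R_s(y)=\sigma(\langle x,y\rangle)$ for all $s$ and $x,y\in X(s)$. Let $\widetilde R_s:X(s)\otimes_\sigma H\to H$ be the contraction $x\otimes h\mapsto R_s(x)h$, and on $\mathcal M:=\sigma(\mathcal N)'\subseteq B(H)$ put $$\Theta_s(a)=\widetilde R_s\,(I_{X(s)}\otimes a)\,\widetilde R_s^{\,*}\qquad(s\in\mathcal S,\ a\in\mathcal M).$$ For a cp-semigroup $\Theta=\{\Theta_s\}_{s\in\mathcal S}$ on $\mathcal M\subseteq B(H)$ (normal contractive completely positive maps with $\Theta_{s+t}=\Theta_s\circ\Theta_t$, $\Theta_0=\mathrm{id}$), let $\mathcal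 M\otimes_{\Theta_s}H$ be the Hilbert space spanned by the $a\otimes h$ with $\langle a\otimes h,b\otimes g\rangle=\langle h,\Theta_s(a^*b)g\rangle$. The *Arveson–Stinespring subproduct system* $E$ of $\Theta$ consists of the $\mathcal M'$-correspondences $$E(s)=\{x\in B(H,\mathcal M\otimes_{\Theta_s}H): xa=(a\otimes I)x\ \text{ for all } a\in\mathcal M\},\quad \langle x,y\rangle=x^*y,\quad b\cdot x\cdot c=(I\otimes b)\,x\,c ,$$ with product $xy=\Gamma_{s,t}^*(I\otimes x)y$ for $x\in E(s)$, $y\in E(t)$, where $\Gamma_{s,t}:\mathcal M\otimes_{\Theta_{s+t}}H\to \mathcal M\otimes_{\Theta_t}\mathcal M\otimes_{\Theta_s}H$ is the isometry $a\otimes h\mapsto a\otimes I\otimes h$, and with $E(0)$ identified with $\mathcal M'$ by $b\mapsto(h\mapsto I\otimes bh)$. The *identity representation* $T$ of $E$ on $H$ is $T_s(x)=w_s^*x$, where $w_sh=I\otimes h$. **Theorem.** Let $X$ be a subproduct system of $\mathcal N$-correspondences and let $R$ be a representation of $X$ on $H$ such that $\sigma=R_0$ is faithful (and unital). Then the maps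 $\Theta_s$ above form a cp-semigroup on $\mathcal M=\sigma(\mathcal N)'$, the family $E$ associated with it is a subproduct system of $\mathcal M'$-correspondences and $T$ is a representation of $E$, and there is a morphism of subproduct systems $W:X\to E$ such that, for all $s\in\mathcal S$, $$R_s=T_s\circ W_s,\qquad W_s^*W_s=I_{X(s)}-q_s,$$ where $q_s$ is the orthogonal projection of $X(s)$ onto $\operatorname{Ker}R_s$. In particular, $W$ is an isomorphism if and only if $R_s$ is injective for all $s\in\mathcal S$. Moreover, if $R$ is isometric, then $X$ is a product system. -/

import Mathlib

noncomputable section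

namespace Subproduct

universe u w

open scoped InnerProductSpace CStarAlgebra

/-! ### Von Neumann algebras as C⋆-algebras -/

section VonNeumann

variable {H : Type*} [NormedAddCommGroup H] [InnerProductSpace ℂ H] [CompleteSpace H]

instance smulMemClass : SMulMemClass (VonNeumannAlgebra H) ℂ (H →L[ℂ] H) where
  smul_mem {s} c x hx := s.toStarSubalgebra.smul_mem (x := x) hx c

theorem isClosed_coe (M : VonNeumannAlgebra H) : IsClosed (M : Set (H →L[ℂ] H)) := by
  have h : (M : Set (H →L[ℂ] H)) =
      ⋂ y ∈ Set.centralizer (M : Set (H →L[ℂ] H)), {x | y * x = x * y} := by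
    conv_lhs => rw [← M.centralizer_centralizer]
    ext x
    rw [Set.mem_centralizer_iff]
    simp only [Set.mem_iInter, Set.mem_ofPred_eq]
  rw [h]
  refine isClosed_biInter fun y _ => ?_
  exact isClosed_eq (by fun_prop) (by fun_prop)

instance isClosedFact (M : VonNeumannAlgebra H) : IsClosed (M : Set (H →L[ℂ] H)) := isClosed_coe M

/-- A von Neumann algebra is a C⋆-algebra with the operations and norm of `B(H)`. -/
instance cstarAlgebra (M : VonNeumannAlgebra H) : CStarAlgebra M :=
  StarSubalgebra.cstarAlgebra M

/-- A von Neumann algebra carries the order of positive operators on `H`. -/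
instance starOrderedRing (M : VonNeumannAlgebra H) : StarOrderedRing M := by
  refine StarOrderedRing.of_nonneg_iff' (fun {x y} h z => ?_) (fun x => ⟨fun h => ?_, ?_⟩)
  · have h' : (x : H →L[ℂ] H) ≤ y := h
    exact add_le_add_right h' (z : H →L[ℂ] H)
  · have h' : (0 : H →L[ℂ] H) ≤ x := h
    have hmem : CFC.sqrt (x : H →L[ℂ] H) ∈ M := by
      rw [← SetLike.mem_coe, ← M.centralizer_centralizer]
      intro y hy
      have hxy : Commute (x : H →L[ℂ] H) y := (Set.mem_centralizer_iff.mp hy) x x.2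
      exact (hxy.cfcₙ_nnreal _).symm
    have hs : IsSelfAdjoint (CFC.sqrt (x : H →L[ℂ] H)) := .of_nonneg (CFC.sqrt_nonneg _)
    refine ⟨⟨_, hmem⟩, Subtype.ext ?_⟩
    change (x : H →L[ℂ] H) = star (CFC.sqrt (x : H →L[ℂ] H)) * CFC.sqrt (x : H →L[ℂ] H)
    rw [hs.star_eq, CFC.sqrt_mul_sqrt_self _ h']
  · rintro ⟨s, rfl⟩
    have : (0 : H →L[ℂ] H) ≤ star (s : H →L[ℂ] H) * s := star_mul_self_nonneg _
    exact this

/-- The inclusion `M ⊆ B(H)` as a representation. -/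
def incl (M : VonNeumannAlgebra H) : M →⋆ₐ[ℂ] (H →L[ℂ] H) where
  toFun x := x
  map_one' := rfl
  map_mul' _ _ := rfl
  map_zero' := rfl
  map_add' _ _ := rfl
  commutes' _ := rfl
  map_star' _ := rfl

end VonNeumann

/-! ### Auxiliary facts about positive elements -/

theorem exists_star_mul_self {C : Type*} [CStarAlgebra C] [PartialOrder C] [StarOrderedRing C]
    (a : C) (h : 0 ≤ a) : ∃ s, a = star s * s :=
  CStarAlgebra.nonneg_iff_eq_star_mul_self.mp h

theorem exists_negPart {C : Type*} [CStarAlgebra C] [PartialOrder C] [StarOrderedRing C]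
    (a : C) (ha : IsSelfAdjoint a) :
    ∃ c d : C, star c * a * c = -(star d * d) ∧ (d = 0 → 0 ≤ a) := by
  have hn : 0 ≤ a⁻ := CFC.negPart_nonneg a
  have hns : star a⁻ = a⁻ := (IsSelfAdjoint.of_nonneg hn).star_eq
  have hq : star (CFC.sqrt a⁻) = CFC.sqrt a⁻ := (IsSelfAdjoint.of_nonneg (CFC.sqrt_nonneg _)).star_eq
  have hd : star (CFC.sqrt a⁻ * a⁻) * (CFC.sqrt a⁻ * a⁻) = a⁻ * a⁻ * a⁻ := by
    rw [star_mul, hns, hq, mul_assoc, ← mul_assoc (CFC.sqrt a⁻) (CFC.sqrt a⁻),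
      CFC.sqrt_mul_sqrt_self a⁻ hn, mul_assoc]
  refine ⟨a⁻, CFC.sqrt a⁻ * a⁻, ?_, fun h0 => ?_⟩
  · rw [hd, hns]
    have : a⁻ * a = -(a⁻ * a⁻) := by
      calc a⁻ * a = a⁻ * (a⁺ - a⁻) := by rw [CFC.posPart_sub_negPart a ha]
        _ = _ := by rw [mul_sub, CFC.negPart_mul_posPart, zero_sub]
    rw [this, neg_mul]
  · rw [h0] at hd
    have h3 : a⁻ * a⁻ * a⁻ = 0 := by rw [← hd]; simp
    have h4 : star (a⁻ * a⁻) * (a⁻ * a⁻) = 0 := by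
      rw [star_mul, hns, ← mul_assoc, h3, zero_mul]
    have h5 : star a⁻ * a⁻ = 0 := by rw [hns]; exact CStarRing.star_mul_self_eq_zero_iff _ |>.mp h4
    have h6 : a⁻ = 0 := CStarRing.star_mul_self_eq_zero_iff _ |>.mp h5
    rw [← CFC.posPart_sub_negPart a ha, h6, sub_zero]
    exact CFC.posPart_nonneg a

theorem exists_inv_sqrt {C : Type*} [CStarAlgebra C] [PartialOrder C] [StarOrderedRing C]
    (a : C) (ha : 0 ≤ a) {ε : ℝ} (hε : 0 < ε) :
    ∃ b e : C, b * e = 1 ∧ star e * e = a + algebraMap ℝ C ε ∧ ‖star b * a * b‖ ≤ 1 := by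
  have hε' : 0 ≤ algebraMap ℝ C ε := by
    rw [Algebra.algebraMap_eq_smul_one]; exact smul_nonneg hε.le zero_le_one
  have h0 : 0 ≤ a + algebraMap ℝ C ε := add_nonneg ha hε'
  set e := CFC.sqrt (a + algebraMap ℝ C ε) with he
  have hes : star e = e := (IsSelfAdjoint.of_nonneg (CFC.sqrt_nonneg _)).star_eq
  have hee : e * e = a + algebraMap ℝ C ε := CFC.sqrt_mul_sqrt_self _ h0
  have hu : IsStrictlyPositive (a + algebraMap ℝ C ε) :=
    IsStrictlyPositive.nonneg_add ha (isStrictlyPositive_algebraMap hε)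
  obtain ⟨u, hue⟩ : IsUnit e := hu.sqrt.isUnit
  have hus : star (↑u⁻¹ : C) = ↑u⁻¹ := by
    have h1 : star u = u := Units.ext (by rw [Units.coe_star, hue, hes])
    rw [← Units.coe_star, star_inv, h1]
  have hbe : (↑u⁻¹ : C) * e = 1 := by rw [← hue, Units.inv_mul]
  have heb : e * (↑u⁻¹ : C) = 1 := by rw [← hue, Units.mul_inv]
  refine ⟨↑u⁻¹, e, hbe, by rw [hes, hee], ?_⟩
  have hpos : 0 ≤ star (↑u⁻¹ : C) * a * ↑u⁻¹ := star_left_conjugate_nonneg ha _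
  rw [CStarAlgebra.norm_le_one_iff_of_nonneg _ hpos]
  have hle : star (↑u⁻¹ : C) * a * ↑u⁻¹ ≤ star (↑u⁻¹ : C) * (a + algebraMap ℝ C ε) * ↑u⁻¹ :=
    star_left_conjugate_le_conjugate (le_add_of_nonneg_right hε') _
  refine hle.trans (le_of_eq ?_)
  rw [← hee, hus, ← mul_assoc, hbe, one_mul, heb]

/-! ### Hilbert spaces `I ⊗ K` -/

/-- A *completely positive form*: a set `I` with a left action of a C⋆-algebra `A` and a
`B`-valued completely positive definite form for which the action is adjointable. The two
examples used below are a C⋆-correspondence with its inner product, and a von Neumann algebra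
`M` with `⟨a, b⟩ = Θ(a⋆ b)` for a completely positive map `Θ`. -/
structure CPForm (A B : Type*) [CStarAlgebra A] [CStarAlgebra B] [PartialOrder B]
    [StarOrderedRing B] (I : Type*) where
  form : I → I → B
  act : A → I → I
  pos : ∀ (n : ℕ) (x : Fin n → I), 0 ≤ (CStarMatrix.ofMatrix fun i j => form (x i) (x j))
  form_act_left : ∀ a x y, form (act a x) y = form x (act (star a) y)
  form_act_add : ∀ a b x y, form x (act (a + b) y) = form x (act a y) + form x (act b y)
  form_act_smul : ∀ (c : ℂ) a x y, form x (act (c • a) y) = c • form x (act a y)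
  form_act_mul : ∀ a b x y, form x (act (a * b) y) = form x (act a (act b y))
  form_act_one : ∀ x y, form x (act 1 y) = form x y

namespace CPForm

theorem inner_star_mul {B K : Type*} [CStarAlgebra B] [NormedAddCommGroup K]
    [InnerProductSpace ℂ K] [CompleteSpace K] (π : B →⋆ₐ[ℂ] (K →L[ℂ] K)) (b c : B) (v w : K) :
    ⟪v, π (star b * c) w⟫_ℂ = ⟪π b v, π c w⟫_ℂ := by
  rw [map_mul, map_star, ContinuousLinearMap.star_eq_adjoint]
  exact ContinuousLinearMap.adjoint_inner_right (π b) v (π c w)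

variable {A B I : Type*} [CStarAlgebra A] [CStarAlgebra B] [PartialOrder B]
  [StarOrderedRing B] (k : CPForm A B I)
variable {K : Type*} [NormedAddCommGroup K] [InnerProductSpace ℂ K] [CompleteSpace K]
variable {L : Type*} [NormedAddCommGroup L] [InnerProductSpace ℂ L] [CompleteSpace L]

theorem exists_factor {n : ℕ} (x : Fin n → I) :
    ∃ c : Fin n → Fin n → B, ∀ i j, k.form (x i) (x j) = ∑ l, star (c l i) * c l j := by
  obtain ⟨c, hc⟩ := exists_star_mul_self _ (k.pos n x)
  refine ⟨fun i j => c i j, fun i j => ?_⟩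
  have := congrFun (congrFun hc i) j
  rw [CStarMatrix.mul_apply] at this
  exact this

theorem form_star (x y : I) : star (k.form x y) = k.form y x := by
  obtain ⟨c, hc⟩ := k.exists_factor ![x, y]
  have h1 : k.form x y = _ := hc 0 1
  have h2 : k.form y x = _ := hc 1 0
  rw [h1, h2]
  simp

/-- The operator-valued kernel `(x, y) ↦ π ⟨x, y⟩` on `I`. -/
def kmat (π : B →⋆ₐ[ℂ] (K →L[ℂ] K)) : Matrix I I (K →L[ℂ] K) :=
  Matrix.of fun x y => π (k.form x y)

theorem sum_form_eq (π : B →⋆ₐ[ℂ] (K →L[ℂ] K)) {n : ℕ} (x : Fin n → I) (c : Fin n → Fin n → B)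
    (hc : ∀ i j, k.form (x i) (x j) = ∑ l, star (c l i) * c l j) (v : Fin n → K) :
    ∑ i, ∑ j, ⟪v i, π (k.form (x i) (x j)) (v j)⟫_ℂ =
      ((∑ l, ‖∑ i, π (c l i) (v i)‖ ^ 2 : ℝ) : ℂ) := by
  have h : ∀ i j, ⟪v i, π (k.form (x i) (x j)) (v j)⟫_ℂ =
      ∑ l, ⟪π (c l i) (v i), π (c l j) (v j)⟫_ℂ := by
    intro i j
    rw [hc, map_sum, sum_apply, inner_sum]
    exact Finset.sum_congr rfl fun l _ => inner_star_mul π _ _ _ _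
  have e : ∀ l, ((‖∑ i, π (c l i) (v i)‖ : ℂ)) ^ 2 =
      ∑ i, ∑ j, ⟪π (c l i) (v i), π (c l j) (v j)⟫_ℂ := by
    intro l
    have := inner_self_eq_norm_sq_to_K (𝕜 := ℂ) (∑ i, π (c l i) (v i))
    rw [sum_inner] at this
    simp only [inner_sum] at this
    exact this.symm
  push_cast
  simp only [h, e]
  rw [Finset.sum_comm' (t' := Finset.univ) (s' := fun _ => Finset.univ) (by simp)]
  refine Eq.trans (Finset.sum_congr rfl fun i _ => Finset.sum_comm) ?_
  rw [Finset.sum_comm]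
  refine Finset.sum_congr rfl fun l _ => Finset.sum_comm

theorem kmat_posSemidef (π : B →⋆ₐ[ℂ] (K →L[ℂ] K)) : (k.kmat π).PosSemidef := by
  have T : (k.kmat π).PosSemidef ↔ ((k.kmat π).IsHermitian ∧ ∀ vv : I →₀ K,
      0 ≤ RCLike.re (vv.sum fun x w => vv.sum fun x' w' => ⟪k.kmat π x' x w, w'⟫_ℂ)) :=
    (RKHS.posSemidef_tfae (K := k.kmat π)).out 0 2
  refine T.mpr ⟨?_, fun vv => ?_⟩
  · ext x y : 2
    simp [kmat, ← map_star, k.form_star]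
  · let e := vv.support.equivFin.symm
    obtain ⟨c, hc⟩ := k.exists_factor (fun i => (e i : I))
    have h := k.sum_form_eq π (fun i => (e i : I)) c hc (fun i => vv (e i))
    have h2 : (vv.sum fun x w => vv.sum fun x' w' => ⟪k.kmat π x' x w, w'⟫_ℂ) =
        ∑ i, ∑ j, ⟪k.kmat π (e j) (e i) (vv (e i)), vv (e j)⟫_ℂ := by
      simp only [Finsupp.sum]
      rw [← Finset.sum_coe_sort, ← e.sum_comp]
      refine Finset.sum_congr rfl fun i _ => ?_
      rw [← Finset.sum_coe_sort, ← e.sum_comp]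
    have h3 : ∀ x y v w, ⟪k.kmat π x y v, w⟫_ℂ = ⟪v, π (k.form y x) w⟫_ℂ := by
      intro x y v w
      rw [← k.form_star x y, map_star, ContinuousLinearMap.star_eq_adjoint,
        ContinuousLinearMap.adjoint_inner_right]
      rfl
    rw [h2]
    simp only [h3, h]
    rw [RCLike.re_eq_complex_re, Complex.ofReal_re]
    positivity

instance (π : B →⋆ₐ[ℂ] (K →L[ℂ] K)) : Fact (k.kmat π).PosSemidef := ⟨k.kmat_posSemidef π⟩

/-- The Hilbert space `I ⊗_π K`: the Hausdorff completion of the span of the symbols `x ⊗ v`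
with respect to `⟨x ⊗ v, y ⊗ w⟩ = ⟨v, π⟨x, y⟩ w⟩`. -/
def Tensor (π : B →⋆ₐ[ℂ] (K →L[ℂ] K)) : Type _ := RKHS.OfKernel (k.kmat π)

variable (π : B →⋆ₐ[ℂ] (K →L[ℂ] K)) (π' : B →⋆ₐ[ℂ] (L →L[ℂ] L))

instance : NormedAddCommGroup (k.Tensor π) :=
  inferInstanceAs (NormedAddCommGroup (RKHS.OfKernel (k.kmat π)))
instance : InnerProductSpace ℂ (k.Tensor π) :=
  inferInstanceAs (InnerProductSpace ℂ (RKHS.OfKernel (k.kmat π)))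
instance : CompleteSpace (k.Tensor π) :=
  inferInstanceAs (CompleteSpace (RKHS.OfKernel (k.kmat π)))

/-- `v ↦ x ⊗ v` -/
def tmul (x : I) : K →L[ℂ] k.Tensor π := RKHS.kerFun (RKHS.OfKernel (k.kmat π)) x

theorem inner_tmul (x y : I) (v w : K) :
    ⟪k.tmul π x v, k.tmul π y w⟫_ℂ = ⟪v, π (k.form x y) w⟫_ℂ := by
  have h := RKHS.kernel_inner (H := RKHS.OfKernel (k.kmat π)) y x v w
  rw [RKHS.OfKernel.kernel_ofKernel] at h
  refine Eq.trans h.symm ?_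
  rw [← k.form_star y x, map_star, ContinuousLinearMap.star_eq_adjoint,
    ContinuousLinearMap.adjoint_inner_right]
  rfl

theorem span_tmul_dense :
    (Submodule.span ℂ {t | ∃ x v, k.tmul π x v = t}).topologicalClosure = ⊤ :=
  RKHS.kerFun_dense (H := RKHS.OfKernel (k.kmat π))

theorem ext_tmul {W : Type*} [NormedAddCommGroup W] [NormedSpace ℂ W]
    {T T' : k.Tensor π →L[ℂ] W} (h : ∀ x v, T (k.tmul π x v) = T' (k.tmul π x v)) : T = T' := by
  refine ContinuousLinearMap.ext_on (s := {t | ∃ x v, k.tmul π x v = t}) ?_ ?_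
  · have h := k.span_tmul_dense π
    rw [Submodule.dense_iff_topologicalClosure_eq_top]
    exact h
  · rintro _ ⟨x, v, rfl⟩
    exact h x v

theorem eq_of_inner_tmul {a b : k.Tensor π} (h : ∀ x v, ⟪k.tmul π x v, a⟫_ℂ = ⟪k.tmul π x v, b⟫_ℂ) :
    a = b := by
  have : (innerSL ℂ a : k.Tensor π →L[ℂ] ℂ) = innerSL ℂ b := by
    refine k.ext_tmul π fun x v => ?_
    have := congrArg (starRingEnd ℂ) (h x v)
    simpa using this
  refine ext_inner_right ℂ fun v => ?_
  exact DFunLike.congr_fun this v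

theorem norm_sum_tmul {n : ℕ} (x : Fin n → I) (v : Fin n → K) :
    ((‖∑ i, k.tmul π (x i) (v i)‖ ^ 2 : ℝ) : ℂ) =
      ∑ i, ∑ j, ⟪v i, π (k.form (x i) (x j)) (v j)⟫_ℂ := by
  have := inner_self_eq_norm_sq_to_K (𝕜 := ℂ) (∑ i, k.tmul π (x i) (v i))
  rw [sum_inner] at this
  simp only [inner_sum, inner_tmul] at this
  rw [this]
  push_cast
  rfl

theorem norm_sum_tmul_factor {n : ℕ} (x : Fin n → I) (v : Fin n → K) (c : Fin n → Fin n → B)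
    (hc : ∀ i j, k.form (x i) (x j) = ∑ l, star (c l i) * c l j) :
    ‖∑ i, k.tmul π (x i) (v i)‖ ^ 2 = ∑ l, ‖∑ i, π (c l i) (v i)‖ ^ 2 := by
  have := (k.norm_sum_tmul π x v).trans (k.sum_form_eq π x c hc v)
  exact_mod_cast this

theorem exists_lift {W : Type*} [NormedAddCommGroup W] [NormedSpace ℂ W] [CompleteSpace W]
    (f : I → K →ₗ[ℂ] W) (C : ℝ)
    (h : ∀ (n : ℕ) (x : Fin n → I) (v : Fin n → K),
      ‖∑ i, f (x i) (v i)‖ ≤ C * ‖∑ i, k.tmul π (x i) (v i)‖) :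
    ∃ T : k.Tensor π →L[ℂ] W, ∀ x v, T (k.tmul π x v) = f x v := by
  let e : (I × K →₀ ℂ) →ₗ[ℂ] k.Tensor π :=
    Finsupp.linearCombination ℂ fun p : I × K => k.tmul π p.1 p.2
  let g : (I × K →₀ ℂ) →ₗ[ℂ] W := Finsupp.linearCombination ℂ fun p : I × K => f p.1 p.2
  have hd : DenseRange e := by
    have h1 : Set.range e = (Submodule.span ℂ {t | ∃ x v, k.tmul π x v = t} : Set (k.Tensor π)) := by
      rw [← LinearMap.coe_range, Finsupp.range_linearCombination]
      congr 2
      ext t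
      simp
    have h2 := k.span_tmul_dense π
    rw [DenseRange, h1]
    exact (Submodule.dense_iff_topologicalClosure_eq_top).mpr h2
  have hb : ∀ φ, ‖g φ‖ ≤ C * ‖e φ‖ := by
    intro φ
    let q := φ.support.equivFin.symm
    have := h _ (fun i => (q i : I × K).1) (fun i => φ (q i) • (q i : I × K).2)
    have hg : g φ = ∑ i, f (q i : I × K).1 (φ (q i) • (q i : I × K).2) := by
      simp only [g, Finsupp.linearCombination_apply, Finsupp.sum]
      rw [← Finset.sum_coe_sort, ← q.sum_comp]
      simp
    have he : e φ = ∑ i, k.tmul π (q i : I × K).1 (φ (q i) • (q i : I × K).2) := by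
      simp only [e, Finsupp.linearCombination_apply, Finsupp.sum]
      rw [← Finset.sum_coe_sort, ← q.sum_comp]
      simp
    rw [hg, he]
    exact this
  refine ⟨g.extendOfNorm e, fun x v => ?_⟩
  have := LinearMap.extendOfNorm_eq hd ⟨C, hb⟩ (Finsupp.single (x, v) 1)
  simpa [e, g] using this

/-- The operator on `I ⊗_π K` determined by its values on elementary tensors. -/
def lift {W : Type*} [NormedAddCommGroup W] [NormedSpace ℂ W] [CompleteSpace W]
    (f : I → K →ₗ[ℂ] W) (C : ℝ)
    (h : ∀ (n : ℕ) (x : Fin n → I) (v : Fin n → K),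
      ‖∑ i, f (x i) (v i)‖ ≤ C * ‖∑ i, k.tmul π (x i) (v i)‖) : k.Tensor π →L[ℂ] W :=
  (k.exists_lift π f C h).choose

theorem lift_tmul {W : Type*} [NormedAddCommGroup W] [NormedSpace ℂ W] [CompleteSpace W]
    (f : I → K →ₗ[ℂ] W) (C : ℝ)
    (h : ∀ (n : ℕ) (x : Fin n → I) (v : Fin n → K),
      ‖∑ i, f (x i) (v i)‖ ≤ C * ‖∑ i, k.tmul π (x i) (v i)‖) (x : I) (v : K) :
    k.lift π f C h (k.tmul π x v) = f x v :=
  (k.exists_lift π f C h).choose_spec x v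

theorem isom_bound {W : Type*} [NormedAddCommGroup W] [InnerProductSpace ℂ W]
    (f : I → K →ₗ[ℂ] W)
    (h : ∀ x y v w, ⟪f x v, f y w⟫_ℂ = ⟪v, π (k.form x y) w⟫_ℂ)
    (n : ℕ) (x : Fin n → I) (v : Fin n → K) :
    ‖∑ i, f (x i) (v i)‖ ≤ 1 * ‖∑ i, k.tmul π (x i) (v i)‖ := by
  have h1 : ((‖∑ i, f (x i) (v i)‖ ^ 2 : ℝ) : ℂ) =
      ∑ i, ∑ j, ⟪v i, π (k.form (x i) (x j)) (v j)⟫_ℂ := by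
    have := inner_self_eq_norm_sq_to_K (𝕜 := ℂ) (∑ i, f (x i) (v i))
    rw [sum_inner] at this
    simp only [inner_sum, h] at this
    rw [this]
    push_cast
    rfl
  rw [← k.norm_sum_tmul π x v] at h1
  have h2 : ‖∑ i, f (x i) (v i)‖ ^ 2 = ‖∑ i, k.tmul π (x i) (v i)‖ ^ 2 := by exact_mod_cast h1
  rw [one_mul]
  exact (pow_left_inj₀ (norm_nonneg _) (norm_nonneg _) two_ne_zero).mp h2 |>.le

theorem act_bound (a : A) (n : ℕ) (x : Fin n → I) (v : Fin n → K) :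
    ‖∑ i, k.tmul π (k.act a (x i)) (v i)‖ ≤ ‖a‖ * ‖∑ i, k.tmul π (x i) (v i)‖ := by
  let _ := CStarAlgebra.spectralOrder A
  let _ := CStarAlgebra.spectralOrderedRing A
  have hpos : 0 ≤ algebraMap ℝ A (‖a‖ ^ 2) - star a * a := by
    rw [sub_nonneg, pow_two, ← CStarRing.norm_star_mul_self]
    exact (IsSelfAdjoint.star_mul_self a).le_algebraMap_norm_self
  obtain ⟨d, hd⟩ := exists_star_mul_self _ hpos
  have hsum : ((‖a‖ ^ 2 : ℝ) : ℂ) • (1 : A) = star a * a + star d * d := by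
    rw [← hd, Algebra.algebraMap_eq_smul_one, Complex.coe_smul]
    abel
  have key : ∀ i j, (((‖a‖ ^ 2 : ℝ) : ℂ)) * ⟪v i, π (k.form (x i) (x j)) (v j)⟫_ℂ =
      ⟪v i, π (k.form (k.act a (x i)) (k.act a (x j))) (v j)⟫_ℂ +
      ⟪v i, π (k.form (k.act d (x i)) (k.act d (x j))) (v j)⟫_ℂ := by
    intro i j
    have := k.form_act_smul ((‖a‖ ^ 2 : ℝ) : ℂ) 1 (x i) (x j)
    rw [hsum, k.form_act_one, k.form_act_add, k.form_act_mul, k.form_act_mul] at this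
    rw [k.form_act_left a, k.form_act_left d, ← inner_add_right, ← inner_smul_right,
      ← add_apply, ← map_add, this]
    simp
  have h2 : ‖a‖ ^ 2 * ‖∑ i, k.tmul π (x i) (v i)‖ ^ 2 =
      ‖∑ i, k.tmul π (k.act a (x i)) (v i)‖ ^ 2 + ‖∑ i, k.tmul π (k.act d (x i)) (v i)‖ ^ 2 := by
    have e0 := k.norm_sum_tmul π x v
    have e1 := k.norm_sum_tmul π (fun i => k.act a (x i)) v
    have e2 := k.norm_sum_tmul π (fun i => k.act d (x i)) v
    have : ((‖a‖ ^ 2 * ‖∑ i, k.tmul π (x i) (v i)‖ ^ 2 : ℝ) : ℂ) =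
      ((‖∑ i, k.tmul π (k.act a (x i)) (v i)‖ ^ 2 +
        ‖∑ i, k.tmul π (k.act d (x i)) (v i)‖ ^ 2 : ℝ) : ℂ) := by
      rw [Complex.ofReal_mul, Complex.ofReal_add, e0, e1, e2, Finset.mul_sum]
      simp only [Finset.mul_sum, key, Finset.sum_add_distrib]
    exact_mod_cast this
  refine (sq_le_sq₀ (norm_nonneg _) (by positivity)).mp ?_
  rw [mul_pow, h2]
  exact le_add_of_nonneg_right (sq_nonneg _)

/-- The left action of `A` on `I ⊗_π K`, `a (x ⊗ v) = (a x) ⊗ v`. -/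
def leftOp (a : A) : k.Tensor π →L[ℂ] k.Tensor π :=
  k.lift π (fun x => (k.tmul π (k.act a x)).toLinearMap) ‖a‖ (k.act_bound π a)

theorem leftOp_tmul (a : A) (x : I) (v : K) :
    k.leftOp π a (k.tmul π x v) = k.tmul π (k.act a x) v :=
  k.lift_tmul π _ _ _ x v

/-- The left action as a `⋆`-homomorphism. -/
def leftRep : A →⋆ₐ[ℂ] (k.Tensor π →L[ℂ] k.Tensor π) :=
  have hmul : ∀ a b, k.leftOp π (a * b) = k.leftOp π a * k.leftOp π b := fun a b => by
    refine k.ext_tmul π fun x v => k.eq_of_inner_tmul π fun y w => ?_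
    simp [leftOp_tmul, inner_tmul, k.form_act_mul]
  have hone : k.leftOp π 1 = 1 := by
    refine k.ext_tmul π fun x v => k.eq_of_inner_tmul π fun y w => ?_
    simp [leftOp_tmul, inner_tmul, k.form_act_one]
  have hadd : ∀ a b, k.leftOp π (a + b) = k.leftOp π a + k.leftOp π b := fun a b => by
    refine k.ext_tmul π fun x v => k.eq_of_inner_tmul π fun y w => ?_
    simp [leftOp_tmul, inner_tmul, k.form_act_add]
  have hsmul : ∀ (c : ℂ) a, k.leftOp π (c • a) = c • k.leftOp π a := fun c a => by
    refine k.ext_tmul π fun x v => k.eq_of_inner_tmul π fun y w => ?_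
    simp [leftOp_tmul, inner_tmul, k.form_act_smul]
  have hstar : ∀ a, k.leftOp π (star a) = star (k.leftOp π a) := fun a => by
    refine k.ext_tmul π fun x v => k.eq_of_inner_tmul π fun y w => ?_
    rw [ContinuousLinearMap.star_eq_adjoint, ContinuousLinearMap.adjoint_inner_right]
    simp [leftOp_tmul, inner_tmul, k.form_act_left]
  { toFun := k.leftOp π
    map_one' := hone
    map_mul' := hmul
    map_zero' := by simpa using hsmul 0 0
    map_add' := hadd
    commutes' := fun c => by
      rw [Algebra.algebraMap_eq_smul_one, hsmul, hone, Algebra.algebraMap_eq_smul_one]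
    map_star' := hstar }

theorem leftRep_tmul (a : A) (x : I) (v : K) :
    k.leftRep π a (k.tmul π x v) = k.tmul π (k.act a x) v :=
  k.leftOp_tmul π a x v

theorem map_bound (T : K →L[ℂ] L) (hT : ∀ b v, T (π b v) = π' b (T v))
    (n : ℕ) (x : Fin n → I) (v : Fin n → K) :
    ‖∑ i, k.tmul π' (x i) (T (v i))‖ ≤ ‖T‖ * ‖∑ i, k.tmul π (x i) (v i)‖ := by
  obtain ⟨c, hc⟩ := k.exists_factor x
  refine (sq_le_sq₀ (norm_nonneg _) (by positivity)).mp ?_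
  rw [mul_pow, k.norm_sum_tmul_factor π' x _ c hc, k.norm_sum_tmul_factor π x _ c hc,
    Finset.mul_sum]
  refine Finset.sum_le_sum fun l _ => ?_
  have : ∑ i, π' (c l i) (T (v i)) = T (∑ i, π (c l i) (v i)) := by
    rw [map_sum]; exact Finset.sum_congr rfl fun i _ => (hT _ _).symm
  rw [this, ← mul_pow]
  gcongr
  exact T.le_opNorm _

/-- The operator `I ⊗ T`, `x ⊗ v ↦ x ⊗ T v`, for an intertwiner `T`. -/
def map (T : K →L[ℂ] L) (hT : ∀ b v, T (π b v) = π' b (T v)) : k.Tensor π →L[ℂ] k.Tensor π' :=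
  k.lift π (fun x => (k.tmul π' x ∘L T).toLinearMap) ‖T‖ (k.map_bound π π' T hT)

theorem map_tmul (T : K →L[ℂ] L) (hT : ∀ b v, T (π b v) = π' b (T v)) (x : I) (v : K) :
    k.map π π' T hT (k.tmul π x v) = k.tmul π' x (T v) :=
  k.lift_tmul π _ _ _ x v

/-- The action `c (x ⊗ v) = x ⊗ ρ(c) v` of an algebra that acts on `K` and commutes with `π`. -/
def rightRep {C : Type*} [CStarAlgebra C] (ρ : C →⋆ₐ[ℂ] (K →L[ℂ] K))
    (h : ∀ c b v, ρ c (π b v) = π b (ρ c v)) : C →⋆ₐ[ℂ] (k.Tensor π →L[ℂ] k.Tensor π) where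
  toFun c := k.map π π (ρ c) (h c)
  map_one' := k.ext_tmul π fun x v => by simp [map_tmul]
  map_mul' a b := k.ext_tmul π fun x v => by simp [map_tmul]
  map_zero' := k.ext_tmul π fun x v => by simp [map_tmul]
  map_add' a b := k.ext_tmul π fun x v => by simp [map_tmul]
  commutes' c := k.ext_tmul π fun x v => by simp [map_tmul, Algebra.algebraMap_eq_smul_one]
  map_star' c := by
    refine k.ext_tmul π fun x v => k.eq_of_inner_tmul π fun y w => ?_
    rw [ContinuousLinearMap.star_eq_adjoint, ContinuousLinearMap.adjoint_inner_right, map_tmul,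
      map_tmul, inner_tmul, inner_tmul, ← h, map_star, ContinuousLinearMap.star_eq_adjoint,
      ContinuousLinearMap.adjoint_inner_right]

theorem rightRep_tmul {C : Type*} [CStarAlgebra C] (ρ : C →⋆ₐ[ℂ] (K →L[ℂ] K))
    (h : ∀ c b v, ρ c (π b v) = π b (ρ c v)) (c : C) (x : I) (v : K) :
    k.rightRep π ρ h c (k.tmul π x v) = k.tmul π x (ρ c v) :=
  k.map_tmul π π (ρ c) (h c) x v

theorem leftRep_rightRep {C : Type*} [CStarAlgebra C] (ρ : C →⋆ₐ[ℂ] (K →L[ℂ] K))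
    (h : ∀ c b v, ρ c (π b v) = π b (ρ c v)) (a : A) (c : C) (t : k.Tensor π) :
    k.leftRep π a (k.rightRep π ρ h c t) = k.rightRep π ρ h c (k.leftRep π a t) := by
  have : k.leftRep π a ∘L k.rightRep π ρ h c = k.rightRep π ρ h c ∘L k.leftRep π a :=
    k.ext_tmul π fun x v => by simp [leftRep_tmul, rightRep_tmul]
  exact DFunLike.congr_fun this t

end CPForm

/-! ### Correspondences -/

/-- A C⋆-correspondence over a unital C⋆-algebra `A`: a Hilbert C⋆-module over `A`, complete in
the norm `‖x‖² = ‖⟨x, x⟩‖`, with inner product linear in the second variable and right action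
`right x a = x a`, and a unital left action `left a x = a x` by adjointable operators. (The module
laws of the right action follow from `inner_right` because the inner product is definite.) -/
structure CStarCorrespondence (A : Type u) [CStarAlgebra A] [PartialOrder A]
    [StarOrderedRing A] where
  carrier : Type w
  [normedAddCommGroup : NormedAddCommGroup carrier]
  [normedSpace : NormedSpace ℂ carrier]
  [completeSpace : CompleteSpace carrier]
  inner : carrier → carrier → A
  right : carrier → A → carrier
  left : A →ₐ[ℂ] Module.End ℂ carrier
  inner_add : ∀ x y z, inner x (y + z) = inner x y + inner x z
  inner_smul : ∀ (c : ℂ) x y, inner x (c • y) = c • inner x y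
  inner_right : ∀ x y a, inner x (right y a) = inner x y * a
  star_inner : ∀ x y, star (inner x y) = inner y x
  inner_self_nonneg : ∀ x, 0 ≤ inner x x
  norm_sq : ∀ x, ‖x‖ ^ 2 = ‖inner x x‖
  inner_left : ∀ a x y, inner (left a x) y = inner x (left (star a) y)

instance {A : Type*} [CStarAlgebra A] [PartialOrder A] [StarOrderedRing A] :
    CoeSort (CStarCorrespondence A) (Type _) := ⟨CStarCorrespondence.carrier⟩

attribute [instance] CStarCorrespondence.normedAddCommGroup CStarCorrespondence.normedSpace
  CStarCorrespondence.completeSpace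

namespace CStarCorrespondence

variable {A : Type*} [CStarAlgebra A] [PartialOrder A] [StarOrderedRing A]
  (E : CStarCorrespondence A)

theorem inner_zero (x : E) : E.inner x 0 = 0 := by
  simpa using E.inner_smul 0 x 0

theorem inner_sum {ι : Type*} (s : Finset ι) (x : E) (y : ι → E) :
    E.inner x (∑ i ∈ s, y i) = ∑ i ∈ s, E.inner x (y i) :=
  map_sum (AddMonoidHom.mk' (E.inner x) (E.inner_add x)) y s

theorem sum_inner {ι : Type*} (s : Finset ι) (y : ι → E) (x : E) :
    E.inner (∑ i ∈ s, y i) x = ∑ i ∈ s, E.inner (y i) x := by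
  rw [← E.star_inner, inner_sum, star_sum]
  simp only [E.star_inner]

theorem inner_right_left (x y : E) (a : A) : E.inner (E.right x a) y = star a * E.inner x y := by
  rw [← E.star_inner, E.inner_right, star_mul, E.star_inner]

theorem inner_combination {n : ℕ} (x : Fin n → E) (c d : Fin n → A) :
    E.inner (∑ i, E.right (x i) (c i)) (∑ j, E.right (x j) (d j)) =
      ∑ i, ∑ j, star (c i) * E.inner (x i) (x j) * d j := by
  simp only [inner_sum, sum_inner, inner_right_left, E.inner_right]
  simp only [Finset.sum_mul]
  rw [Finset.sum_comm]

theorem conj_apply {A : Type*} [CStarAlgebra A] {n : ℕ} (c G : CStarMatrix (Fin n) (Fin n) A) (k l : Fin n) :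
    (star c * G * c) k l = ∑ i, ∑ j, star (c i k) * G i j * c j l := by
  simp only [CStarMatrix.mul_apply, Finset.sum_mul]
  rw [Finset.sum_comm]
  rfl

theorem gram_nonneg {n : ℕ} (x : Fin n → E) :
    0 ≤ CStarMatrix.ofMatrix (fun i j => E.inner (x i) (x j)) := by
  set G : CStarMatrix (Fin n) (Fin n) A := CStarMatrix.ofMatrix (fun i j => E.inner (x i) (x j))
  have hG : IsSelfAdjoint G := by
    ext i j
    exact E.star_inner (x j) (x i)
  obtain ⟨c, d, hcd, hd⟩ := exists_negPart G hG
  refine hd ?_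
  ext i k
  have h1 : (star c * G * c) k k = -(∑ l, star (d l k) * d l k) := by
    rw [hcd]
    change -((star d * d) k k) = _
    rw [CStarMatrix.mul_apply]
    rfl
  have h2 : 0 ≤ (star c * G * c) k k := by
    rw [conj_apply]
    have := E.inner_self_nonneg (∑ i, E.right (x i) (c i k))
    rw [inner_combination] at this
    exact this
  have h3 : ∀ l ∈ Finset.univ, 0 ≤ star (d l k) * d l k := fun l _ => star_mul_self_nonneg _
  have h4 : ∑ l, star (d l k) * d l k = 0 := by
    rw [h1] at h2
    exact le_antisymm (neg_nonneg.mp h2) (Finset.sum_nonneg h3)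
  have h5 := (Finset.sum_eq_zero_iff_of_nonneg h3).mp h4 i (Finset.mem_univ i)
  exact CStarRing.star_mul_self_eq_zero_iff _ |>.mp h5

/-- The form `⟨x, y⟩` with the left action of `A`. -/
def cpForm : CPForm A A E where
  form := E.inner
  act a x := E.left a x
  pos _ x := E.gram_nonneg x
  form_act_left := E.inner_left
  form_act_add a b x y := by rw [map_add]; exact E.inner_add _ _ _
  form_act_smul c a x y := by rw [map_smul]; exact E.inner_smul _ _ _
  form_act_mul a b x y := by rw [map_mul]; rfl
  form_act_one x y := by rw [map_one]; rfl

/-- Self-duality: every bounded `A`-linear functional is an inner product with a vector. -/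
def IsSelfDual : Prop :=
  ∀ f : E →L[ℂ] A, (∀ x a, f (E.right x a) = f x * a) → ∃ u, ∀ x, f x = E.inner u x

end CStarCorrespondence

section Normal

variable {G : Type*} [NormedAddCommGroup G] [InnerProductSpace ℂ G] [CompleteSpace G]

/-- A linear functional on a von Neumann algebra is normal (σ-weakly continuous) if and only if its
restriction to every ball is continuous in the weak operator topology, that is, in the coarsest
topology for which the functions `a ↦ ⟨g, a g'⟩` are continuous. -/
def IsNormalFunctional (N : VonNeumannAlgebra G) (f : N → ℂ) : Prop :=
  ∀ r : ℝ, @ContinuousOn N ℂ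
    (TopologicalSpace.induced (fun (a : N) (p : G × G) => ⟪p.1, (a : G →L[ℂ] G) p.2⟫_ℂ)
      inferInstance) inferInstance f {a | ‖a‖ ≤ r}

/-- A linear map from a von Neumann algebra into the operators on a Hilbert space is normal. -/
def IsNormalMap (N : VonNeumannAlgebra G) {K : Type*} [NormedAddCommGroup K]
    [InnerProductSpace ℂ K] (φ : N → K →L[ℂ] K) : Prop :=
  ∀ h k, IsNormalFunctional N fun a => ⟪h, φ a k⟫_ℂ

/-- A W⋆-correspondence over the von Neumann algebra `N`: a self-dual Hilbert module whose left
action is normal. -/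
def CStarCorrespondence.IsWStar {N : VonNeumannAlgebra G} (E : CStarCorrespondence N) : Prop :=
  E.IsSelfDual ∧ ∀ (x y : E) (g g' : G),
    IsNormalFunctional N fun a => ⟪g, (E.inner x (E.left a y) : G →L[ℂ] G) g'⟫_ℂ

end Normal

/-! ### The correspondence of intertwiners -/

section Intertwiner

variable {H : Type*} [NormedAddCommGroup H] [InnerProductSpace ℂ H] [CompleteSpace H]
variable {K : Type*} [NormedAddCommGroup K] [InnerProductSpace ℂ K] [CompleteSpace K]

/-- The operators `x : H → K` with `x a = π(a) x` for `a ∈ M`. -/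
def intertwiners (M : VonNeumannAlgebra H) (π : M →⋆ₐ[ℂ] (K →L[ℂ] K)) :
    Submodule ℂ (H →L[ℂ] K) where
  carrier := {x | ∀ (a : M) (h : H), x ((a : H →L[ℂ] H) h) = π a (x h)}
  add_mem' hx hy a h := by simp [hx a h, hy a h]
  zero_mem' a h := by simp
  smul_mem' c x hx a h := by simp [hx a h]

theorem isClosed_intertwiners (M : VonNeumannAlgebra H) (π : M →⋆ₐ[ℂ] (K →L[ℂ] K)) :
    IsClosed (intertwiners M π : Set (H →L[ℂ] K)) := by
  have : (intertwiners M π : Set (H →L[ℂ] K)) =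
      ⋂ (a : M) (h : H), {x | x ((a : H →L[ℂ] H) h) = π a (x h)} := by
    ext x
    simp only [Set.mem_iInter]
    rfl
  rw [this]
  refine isClosed_iInter fun a => isClosed_iInter fun h => ?_
  exact isClosed_eq (by fun_prop) (by fun_prop)

theorem mem_commutant_iff (M : VonNeumannAlgebra H) (z : H →L[ℂ] H) :
    z ∈ M.commutant ↔ ∀ a ∈ M, a * z = z * a :=
  VonNeumannAlgebra.mem_commutant_iff

theorem adjoint_comp_mem (M : VonNeumannAlgebra H) (π : M →⋆ₐ[ℂ] (K →L[ℂ] K))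
    {x y : H →L[ℂ] K} (hx : x ∈ intertwiners M π) (hy : y ∈ intertwiners M π) :
    ContinuousLinearMap.adjoint x ∘L y ∈ M.commutant := by
  rw [mem_commutant_iff]
  intro a ha
  ext h
  refine ext_inner_left ℂ fun g => ?_
  have h1 := hx (star ⟨a, ha⟩) g
  have h2 := hy ⟨a, ha⟩ h
  have h3 : ((star (⟨a, ha⟩ : M) : M) : H →L[ℂ] H) = ContinuousLinearMap.adjoint a := rfl
  have h4 : a = ContinuousLinearMap.adjoint (ContinuousLinearMap.adjoint a) := by simp
  calc ⟪g, a (ContinuousLinearMap.adjoint x (y h))⟫_ℂ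
      = ⟪ContinuousLinearMap.adjoint a g, ContinuousLinearMap.adjoint x (y h)⟫_ℂ :=
        (ContinuousLinearMap.adjoint_inner_left a _ _).symm
    _ = ⟪x (ContinuousLinearMap.adjoint a g), y h⟫_ℂ :=
        ContinuousLinearMap.adjoint_inner_right x _ _
    _ = ⟪π (star ⟨a, ha⟩) (x g), y h⟫_ℂ := by rw [← h3, h1]
    _ = ⟪x g, π ⟨a, ha⟩ (y h)⟫_ℂ := by
        rw [map_star, ContinuousLinearMap.star_eq_adjoint, ContinuousLinearMap.adjoint_inner_left]
    _ = ⟪x g, y (a h)⟫_ℂ := by rw [← h2]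
    _ = ⟪g, ContinuousLinearMap.adjoint x (y (a h))⟫_ℂ :=
        (ContinuousLinearMap.adjoint_inner_right x _ _).symm

/-- For `N` the commutant of `M`, the intertwiners `x : H → K` of the `M`-actions form a
correspondence over `N` with `⟨x, y⟩ = x⋆ y`, `x b = x ∘ b` and `b x = ρ(b) ∘ x`, where `ρ` is an
action of `N` on `K` that commutes with that of `M`. -/
def intertwinerCorrespondence (M N : VonNeumannAlgebra H) (hN : M.commutant = N)
    (π : M →⋆ₐ[ℂ] (K →L[ℂ] K)) (ρ : N →⋆ₐ[ℂ] (K →L[ℂ] K))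
    (hc : ∀ a b v, ρ b (π a v) = π a (ρ b v)) : CStarCorrespondence N where
  carrier := intertwiners M π
  completeSpace := (isClosed_intertwiners M π).completeSpace_coe
  inner x y := ⟨ContinuousLinearMap.adjoint (x : H →L[ℂ] K) ∘L y,
    hN ▸ adjoint_comp_mem M π x.2 y.2⟩
  right x b := ⟨(x : H →L[ℂ] K) ∘L (b : H →L[ℂ] H), fun a h => by
    have hb : (b : H →L[ℂ] H) ∈ M.commutant := hN.symm ▸ b.2
    have := DFunLike.congr_fun ((mem_commutant_iff M _).mp hb a a.2) h
    have h2 := x.2 a ((b : H →L[ℂ] H) h)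
    simp only [ContinuousLinearMap.comp_apply]
    rw [← h2]
    exact congrArg _ this.symm⟩
  left := AlgHom.ofLinearMap
    { toFun := fun b =>
        { toFun := fun x => ⟨ρ b ∘L (x : H →L[ℂ] K), fun a h => by
            have := x.2 a h
            simp only [ContinuousLinearMap.comp_apply]
            rw [this, hc]⟩
          map_add' := fun x y => Subtype.ext (by simp)
          map_smul' := fun c x => Subtype.ext (by simp) }
      map_add' := fun b b' => by ext x : 2; simp
      map_smul' := fun c b => by ext x : 2; simp }
    (by ext x : 2; simp; rfl)
    (fun b b' => by ext x : 2; simp; rfl)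
  inner_add x y z := Subtype.ext (by simp)
  inner_smul c x y := Subtype.ext (by simp)
  inner_right x y b := Subtype.ext rfl
  star_inner x y := Subtype.ext (by
    change ContinuousLinearMap.adjoint _ = _
    rw [ContinuousLinearMap.adjoint_comp, ContinuousLinearMap.adjoint_adjoint])
  inner_self_nonneg x := by
    change (0 : H →L[ℂ] H) ≤ ContinuousLinearMap.adjoint (x : H →L[ℂ] K) ∘L (x : H →L[ℂ] K)
    rw [ContinuousLinearMap.nonneg_iff_isPositive]
    exact ContinuousLinearMap.isPositive_adjoint_comp_self _
  norm_sq x := by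
    change ‖(x : H →L[ℂ] K)‖ ^ 2 = ‖ContinuousLinearMap.adjoint (x : H →L[ℂ] K) ∘L (x : H →L[ℂ] K)‖
    rw [ContinuousLinearMap.norm_adjoint_comp_self, sq]
  inner_left b x y := Subtype.ext (by
    change ContinuousLinearMap.adjoint (ρ b ∘L (x : H →L[ℂ] K)) ∘L (y : H →L[ℂ] K) =
      ContinuousLinearMap.adjoint (x : H →L[ℂ] K) ∘L (ρ (star b) ∘L (y : H →L[ℂ] K))
    rw [ContinuousLinearMap.adjoint_comp, map_star, ContinuousLinearMap.star_eq_adjoint]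
    rfl)

end Intertwiner

/-! ### Tensor products and correspondence maps -/

section TensorProduct

variable {G : Type*} [NormedAddCommGroup G] [InnerProductSpace ℂ G] [CompleteSpace G]
  {N : VonNeumannAlgebra G}

theorem commutant_comm (n' : N.commutant) (n : N) (g : G) :
    incl N.commutant n' (incl N n g) = incl N n (incl N.commutant n' g) :=
  (DFunLike.congr_fun ((mem_commutant_iff N _).mp n'.2 n n.2) g).symm

variable (X Y : CStarCorrespondence N)

/-- The Hilbert space `Y ⊗_N G`. -/
abbrev space : Type _ := Y.cpForm.Tensor (incl N)

/-- The action `n' (y ⊗ g) = y ⊗ n' g` of the commutant on `Y ⊗_N G`. -/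
def commutantAction : N.commutant →⋆ₐ[ℂ] (space Y →L[ℂ] space Y) :=
  Y.cpForm.rightRep (incl N) (incl N.commutant) commutant_comm

/-- The Hilbert space `X ⊗_N Y ⊗_N G`. -/
abbrev space₂ : Type _ := X.cpForm.Tensor (Y.cpForm.leftRep (incl N))

/-- The action `n' (x ⊗ y ⊗ g) = x ⊗ y ⊗ n' g` of the commutant on `X ⊗_N Y ⊗_N G`. -/
def commutantAction₂ : N.commutant →⋆ₐ[ℂ] (space₂ X Y →L[ℂ] space₂ X Y) :=
  X.cpForm.rightRep (Y.cpForm.leftRep (incl N)) (commutantAction Y) fun c b v =>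
    (Y.cpForm.leftRep_rightRep (incl N) (incl N.commutant) commutant_comm b c v).symm

/-- The tensor product `X ⊗_N Y` of W⋆-correspondences over `N ⊆ B(G)`, i.e. the self-dual extension
of the balanced tensor product. It is realized by the operators `G → X ⊗_N Y ⊗_N G` that intertwine
the actions of the commutant of `N`. -/
def tensor : CStarCorrespondence N :=
  intertwinerCorrespondence N.commutant N N.commutant_commutant (commutantAction₂ X Y)
    (X.cpForm.leftRep (Y.cpForm.leftRep (incl N)))
    fun a b v => X.cpForm.leftRep_rightRep _ _ _ b a v

/-- The elementary tensor `x ⊗ y`, as the operator `g ↦ x ⊗ y ⊗ g`. -/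
def elem {X Y : CStarCorrespondence N} (x : X) (y : Y) : tensor X Y :=
  (⟨X.cpForm.tmul _ x ∘L Y.cpForm.tmul _ y, fun n' g => by
    have h1 : commutantAction Y n' (Y.cpForm.tmul _ y g) = Y.cpForm.tmul _ y (n'.1 g) :=
      Y.cpForm.rightRep_tmul (incl N) (incl N.commutant) commutant_comm n' y g
    have h2 : commutantAction₂ X Y n' (X.cpForm.tmul _ x (Y.cpForm.tmul _ y g)) =
        X.cpForm.tmul _ x (commutantAction Y n' (Y.cpForm.tmul _ y g)) :=
      X.cpForm.rightRep_tmul _ _ _ n' x _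
    simp only [ContinuousLinearMap.comp_apply]
    rw [h2, h1]⟩ : intertwiners N.commutant (commutantAction₂ X Y))

end TensorProduct

section Maps

variable {A B : Type*} [CStarAlgebra A] [PartialOrder A] [StarOrderedRing A]
  [CStarAlgebra B] [PartialOrder B] [StarOrderedRing B]
  {X : CStarCorrespondence A} {Y : CStarCorrespondence B}

/-- A correspondence map over `α`: a bimodule map when `A` and `B` are identified by `α`. -/
structure IsCorrespondenceMap (α : A ≃⋆ₐ[ℂ] B) (T : X →ₗ[ℂ] Y) : Prop where
  map_left : ∀ a x, T (X.left a x) = Y.left (α a) (T x)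
  map_right : ∀ x a, T (X.right x a) = Y.right (T x) (α a)

/-- `S` is the adjoint of `T`, when `A` and `B` are identified by `α`. -/
def IsAdjoint (α : A ≃⋆ₐ[ℂ] B) (T : X →ₗ[ℂ] Y) (S : Y →ₗ[ℂ] X) : Prop :=
  ∀ x y, Y.inner (T x) y = α (X.inner x (S y))

/-- Coisometric correspondence maps: adjointable with `T T⋆ = 1`. -/
def IsCoisometric (α : A ≃⋆ₐ[ℂ] B) (T : X →ₗ[ℂ] Y) : Prop :=
  IsCorrespondenceMap α T ∧ ∃ S : Y →ₗ[ℂ] X, IsAdjoint α T S ∧ ∀ y, T (S y) = y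

/-- Unitary correspondence maps: adjointable with `T T⋆ = 1` and `T⋆ T = 1`. -/
def IsUnitary (α : A ≃⋆ₐ[ℂ] B) (T : X →ₗ[ℂ] Y) : Prop :=
  IsCorrespondenceMap α T ∧
    ∃ S : Y →ₗ[ℂ] X, IsAdjoint α T S ∧ (∀ y, T (S y) = y) ∧ ∀ x, S (T x) = x

/-- Orthogonal projections of a Hilbert module: adjointable idempotent self-adjoint maps. -/
def IsProjection (q : X →ₗ[ℂ] X) : Prop :=
  (∀ x y, X.inner (q x) y = X.inner x (q y)) ∧ ∀ x, q (q x) = q x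

end Maps

/-! ### Subproduct systems -/

/-- A family of correspondences with a multiplication `X(s) × X(t) → X(s + t)` and an embedding
`a ↦ unit a` of the coefficients in `X(0)`. -/
structure CorrespondenceSystem (S : Type*) [AddMonoid S] (A : Type u) [CStarAlgebra A]
    [PartialOrder A] [StarOrderedRing A] where
  fiber : S → CStarCorrespondence.{u, w} A
  unit : A → fiber 0
  mul : ∀ {s t : S}, fiber s → fiber t → fiber (s + t)

namespace CorrespondenceSystem

variable {S : Type*} [AddMonoid S]

section Basic

variable {A : Type*} [CStarAlgebra A] [PartialOrder A] [StarOrderedRing A]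
  (X : CorrespondenceSystem S A)

/-- The identification of `X(s)` and `X(t)` for `s = t`. -/
def transport {s t : S} (h : s = t) (x : X.fiber s) : X.fiber t := h ▸ x

end Basic

section System

variable {G : Type*} [NormedAddCommGroup G] [InnerProductSpace ℂ G] [CompleteSpace G]
  {N : VonNeumannAlgebra G} (X : CorrespondenceSystem S N)

/-- A subproduct system over `N`: a family of W⋆-correspondences with `X(0) = N` (through `unit`) and
coisometric correspondence maps `U_{s,t} : X(s) ⊗ X(t) → X(s + t)`, `U_{s,t}(x ⊗ y) = x y`, such that
`U_{0,s}` and `U_{s,0}` are the left and the right action of `N` and the product is associative. -/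
structure IsSubproductSystem : Prop where
  isWStar : ∀ s, (X.fiber s).IsWStar
  unit_bijective : Function.Bijective X.unit
  unit_add : ∀ a b, X.unit (a + b) = X.unit a + X.unit b
  unit_smul : ∀ (c : ℂ) a, X.unit (c • a) = c • X.unit a
  unit_inner : ∀ a b, (X.fiber 0).inner (X.unit a) (X.unit b) = star a * b
  unit_left : ∀ a b, (X.fiber 0).left a (X.unit b) = X.unit (a * b)
  unit_right : ∀ a b, (X.fiber 0).right (X.unit a) b = X.unit (a * b)
  coisometric : ∀ s t, ∃ U : tensor (X.fiber s) (X.fiber t) →ₗ[ℂ] X.fiber (s + t),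
    IsCoisometric (.refl ℂ N) U ∧ ∀ x y, U (elem x y) = X.mul x y
  unit_mul : ∀ {s} a (x : X.fiber s),
    X.transport (zero_add s) (X.mul (X.unit a) x) = (X.fiber s).left a x
  mul_unit : ∀ {s} (x : X.fiber s) a,
    X.transport (add_zero s) (X.mul x (X.unit a)) = (X.fiber s).right x a
  mul_assoc : ∀ {r s t} (x : X.fiber r) (y : X.fiber s) (z : X.fiber t),
    X.transport (add_assoc r s t) (X.mul (X.mul x y) z) = X.mul x (X.mul y z)

/-- A (full) product system: a subproduct system in which the maps `U_{s,t}` are unitary. -/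
def IsProductSystem : Prop :=
  X.IsSubproductSystem ∧ ∀ s t, ∃ U : tensor (X.fiber s) (X.fiber t) →ₗ[ℂ] X.fiber (s + t),
    IsUnitary (.refl ℂ N) U ∧ ∀ x y, U (elem x y) = X.mul x y

end System

section Morphism

variable {A B : Type*} [CStarAlgebra A] [PartialOrder A] [StarOrderedRing A]
  [CStarAlgebra B] [PartialOrder B] [StarOrderedRing B]
  {X : CorrespondenceSystem S A} {Y : CorrespondenceSystem S B}

/-- Morphisms of subproduct systems: a unital `⋆`-isomorphism `α = V_0` of the coefficient algebras
and coisometric correspondence maps `V_s : X(s) → Y(s)` that respect the multiplications. -/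
structure IsMorphism (α : A ≃⋆ₐ[ℂ] B) (V : ∀ s, X.fiber s →ₗ[ℂ] Y.fiber s) : Prop where
  map_unit : ∀ a, V 0 (X.unit a) = Y.unit (α a)
  coisometric : ∀ s ≠ 0, IsCoisometric α (V s)
  map_mul : ∀ {s t} (x : X.fiber s) (y : X.fiber t), V (s + t) (X.mul x y) = Y.mul (V s x) (V t y)

/-- Isomorphisms of subproduct systems: morphisms with unitary `V_s`. -/
structure IsIsomorphism (α : A ≃⋆ₐ[ℂ] B) (V : ∀ s, X.fiber s →ₗ[ℂ] Y.fiber s) : Prop extends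
    IsMorphism α V where
  unitary : ∀ s ≠ 0, IsUnitary α (V s)

end Morphism

end CorrespondenceSystem

/-! ### Representations -/

section Representation

variable {A : Type*} [CStarAlgebra A] [PartialOrder A] [StarOrderedRing A]
  {E : CStarCorrespondence A}
variable {H : Type*} [NormedAddCommGroup H] [InnerProductSpace ℂ H] [CompleteSpace H]

/-- Complete contractivity of a linear map from a Hilbert module to `B(H)`, for the matrix norms
`‖(x_ij)‖² = ‖(∑ k, ⟨x_ki, x_kj⟩)_ij‖`. -/
def IsCompletelyContractive (T : E →ₗ[ℂ] (H →L[ℂ] H)) : Prop :=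
  ∀ (n : ℕ) (x : Fin n → Fin n → E),
    ‖(CStarMatrix.ofMatrix fun i j => T (x i j) : CStarMatrix (Fin n) (Fin n) (H →L[ℂ] H))‖ ^ 2 ≤
      ‖(CStarMatrix.ofMatrix fun i j => ∑ k, E.inner (x k i) (x k j) :
        CStarMatrix (Fin n) (Fin n) A)‖

/-- Completely contractive covariant representations `(σ, T)` of a correspondence on `H`. -/
structure IsCovariant (σ : A →⋆ₐ[ℂ] (H →L[ℂ] H)) (T : E →ₗ[ℂ] (H →L[ℂ] H)) : Prop where
  completelyContractive : IsCompletelyContractive T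
  map_right : ∀ x a, T (E.right x a) = T x * σ a
  map_left : ∀ a x, T (E.left a x) = σ a * T x

/-- A covariant representation is isometric if `T(x)⋆ T(y) = σ(⟨x, y⟩)`. -/
def IsIsometric (σ : A →⋆ₐ[ℂ] (H →L[ℂ] H)) (T : E →ₗ[ℂ] (H →L[ℂ] H)) : Prop :=
  ∀ x y, star (T x) * T y = σ (E.inner x y)

theorem norm_row_apply_le {n : ℕ} (r : Fin n → H →L[ℂ] H) (z : Fin n → H)
    (hr : ‖∑ j, r j * star (r j)‖ ≤ 1) : ‖∑ j, r j (z j)‖ ^ 2 ≤ ∑ j, ‖z j‖ ^ 2 := by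
  set u := ∑ j, r j (z j) with hu
  have h1 : ∑ j, ‖star (r j) u‖ ^ 2 ≤ ‖u‖ ^ 2 := by
    have e : ((∑ j, ‖star (r j) u‖ ^ 2 : ℝ) : ℂ) = ⟪u, (∑ j, r j * star (r j)) u⟫_ℂ := by
      rw [sum_apply, inner_sum, Complex.ofReal_sum]
      refine Finset.sum_congr rfl fun j _ => ?_
      have : ⟪u, (r j * star (r j)) u⟫_ℂ = ⟪star (r j) u, star (r j) u⟫_ℂ := by
        rw [ContinuousLinearMap.star_eq_adjoint, ContinuousLinearMap.adjoint_inner_left]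
        rfl
      rw [this, inner_self_eq_norm_sq_to_K]
      push_cast
      rfl
    have e2 : ‖((∑ j, ‖star (r j) u‖ ^ 2 : ℝ) : ℂ)‖ ≤ ‖u‖ ^ 2 := by
      rw [e]
      calc _ ≤ ‖u‖ * ‖(∑ j, r j * star (r j)) u‖ := norm_inner_le_norm _ _
        _ ≤ ‖u‖ * (1 * ‖u‖) := by
            gcongr
            exact (ContinuousLinearMap.le_opNorm _ _).trans (by gcongr)
        _ = ‖u‖ ^ 2 := by ring
    rw [Complex.norm_real] at e2
    exact (le_abs_self _).trans e2
  have h2 : ‖u‖ ^ 2 ≤ ∑ j, ‖star (r j) u‖ * ‖z j‖ := by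
    have e : ((‖u‖ ^ 2 : ℝ) : ℂ) = ∑ j, ⟪star (r j) u, z j⟫_ℂ := by
      have := inner_self_eq_norm_sq_to_K (𝕜 := ℂ) u
      push_cast
      refine this.symm.trans ?_
      conv_lhs => rw [hu, ← hu, hu]
      rw [← hu]
      conv_lhs => arg 2; rw [hu]
      rw [inner_sum]
      refine Finset.sum_congr rfl fun j _ => ?_
      rw [ContinuousLinearMap.star_eq_adjoint, ContinuousLinearMap.adjoint_inner_left]
    have e2 : ‖((‖u‖ ^ 2 : ℝ) : ℂ)‖ ≤ ∑ j, ‖star (r j) u‖ * ‖z j‖ := by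
      rw [e]
      exact (norm_sum_le _ _).trans (Finset.sum_le_sum fun j _ => norm_inner_le_norm _ _)
    rw [Complex.norm_real] at e2
    exact (le_abs_self _).trans e2
  have h3 := Finset.sum_mul_sq_le_sq_mul_sq Finset.univ (fun j => ‖star (r j) u‖) fun j => ‖z j‖
  have h4 : (‖u‖ ^ 2) ^ 2 ≤ ‖u‖ ^ 2 * ∑ j, ‖z j‖ ^ 2 := by
    calc (‖u‖ ^ 2) ^ 2 ≤ (∑ j, ‖star (r j) u‖ * ‖z j‖) ^ 2 := by gcongr
      _ ≤ _ := h3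
      _ ≤ _ := by gcongr
  rcases eq_or_lt_of_le (sq_nonneg ‖u‖) with h0 | h0
  · rw [← h0]; positivity
  · rw [sq] at h4
    exact le_of_mul_le_mul_left h4 h0

theorem IsCompletelyContractive.row {T : E →ₗ[ℂ] (H →L[ℂ] H)} (hT : IsCompletelyContractive T)
    {n : ℕ} (y : Fin n → E)
    (hy : ‖(CStarMatrix.ofMatrix fun i j => E.inner (y i) (y j) :
        CStarMatrix (Fin n) (Fin n) A)‖ ≤ 1) :
    ‖∑ j, T (y j) * star (T (y j))‖ ≤ 1 := by
  rcases n with _ | n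
  · simp
  have h := hT (n + 1) fun i j => if i = 0 then y j else 0
  have e : (fun i j => ∑ k : Fin (n + 1), E.inner (if k = 0 then y i else 0)
      (if k = 0 then y j else 0)) = fun i j => E.inner (y i) (y j) := by
    ext i j
    rw [Finset.sum_eq_single 0] <;> simp +contextual [E.inner_zero]
  rw [e] at h
  set Q : CStarMatrix (Fin (n + 1)) (Fin (n + 1)) (H →L[ℂ] H) :=
    CStarMatrix.ofMatrix fun i j => T (if i = 0 then y j else 0) with hQ
  have h1 : ‖Q * star Q‖ ≤ 1 := by
    rw [CStarRing.norm_self_mul_star (x := Q), ← sq]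
    exact h.trans hy
  have h2 : (Q * star Q) 0 0 = ∑ j, T (y j) * star (T (y j)) := by
    rw [CStarMatrix.mul_apply]
    refine Finset.sum_congr rfl fun j _ => ?_
    have e1 : Q 0 j = T (y j) := congrArg T (if_pos rfl)
    have e2 : (star Q) j 0 = star (Q 0 j) := rfl
    rw [e2, e1]
  rw [← h2]
  exact CStarMatrix.norm_entry_le_norm.trans h1

theorem IsCovariant.bound {σ : A →⋆ₐ[ℂ] (H →L[ℂ] H)} {T : E →ₗ[ℂ] (H →L[ℂ] H)}
    (hT : IsCovariant σ T) (n : ℕ) (x : Fin n → E) (v : Fin n → H) :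
    ‖∑ i, T (x i) (v i)‖ ≤ 1 * ‖∑ i, E.cpForm.tmul σ (x i) (v i)‖ := by
  set G : CStarMatrix (Fin n) (Fin n) A := CStarMatrix.ofMatrix fun i j => E.inner (x i) (x j)
    with hG
  have key : ∀ ε : ℝ, 0 < ε → ‖∑ i, T (x i) (v i)‖ ^ 2 ≤
      ‖∑ i, E.cpForm.tmul σ (x i) (v i)‖ ^ 2 + ε * ∑ i, ‖v i‖ ^ 2 := by
    intro ε hε
    obtain ⟨b, e, hbe, hee, hb⟩ := exists_inv_sqrt G (E.gram_nonneg x) hε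
    have hbe' : ∀ i l, ∑ j, b i j * e j l = if i = l then 1 else 0 := by
      intro i l
      rw [← CStarMatrix.mul_apply, hbe]
      exact CStarMatrix.one_apply
    have hee' : ∀ i l, ∑ j, star (e j i) * e j l =
        E.inner (x i) (x l) + (if i = l then (ε : ℂ) • (1 : A) else 0) := by
      intro i l
      have := congrFun (congrFun hee i) l
      rw [CStarMatrix.mul_apply] at this
      refine this.trans ?_
      rw [Algebra.algebraMap_eq_smul_one]
      change E.inner (x i) (x l) + ε • ((1 : CStarMatrix (Fin n) (Fin n) A) i l) = _
      rw [CStarMatrix.one_apply]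
      split_ifs <;> simp
    set y : Fin n → E := fun j => ∑ i, E.right (x i) (b i j) with hy
    have hyG : (CStarMatrix.ofMatrix fun i j => E.inner (y i) (y j) :
        CStarMatrix (Fin n) (Fin n) A) = star b * G * b := by
      ext i j
      rw [CStarCorrespondence.conj_apply]
      exact E.inner_combination x _ _
    have hrow := norm_row_apply_le (fun j => T (y j)) (fun j => ∑ l, σ (e j l) (v l))
      (hT.completelyContractive.row y (by rw [hyG]; exact hb))
    have h1 : ∑ j, T (y j) (∑ l, σ (e j l) (v l)) = ∑ i, T (x i) (v i) := by
      have e1 : ∀ j, T (y j) (∑ l, σ (e j l) (v l)) =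
          ∑ i, ∑ l, T (x i) (σ (b i j * e j l) (v l)) := by
        intro j
        simp only [hy, map_sum, sum_apply, hT.map_right, map_mul]
        rw [Finset.sum_comm]
        rfl
      simp only [e1]
      rw [Finset.sum_comm]
      refine Finset.sum_congr rfl fun i _ => ?_
      rw [Finset.sum_comm]
      have e2 : ∀ l, ∑ j, T (x i) (σ (b i j * e j l) (v l)) =
          if i = l then T (x i) (v l) else 0 := by
        intro l
        rw [← map_sum, ← sum_apply, ← map_sum, hbe']
        split_ifs <;> simp
      simp only [e2]
      simp
    rw [h1] at hrow
    refine hrow.trans (le_of_eq ?_)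
    have h2 : ∀ j, ((‖∑ l, σ (e j l) (v l)‖ : ℂ)) ^ 2 =
        ∑ i, ∑ l, ⟪v i, σ (star (e j i) * e j l) (v l)⟫_ℂ := by
      intro j
      have := inner_self_eq_norm_sq_to_K (𝕜 := ℂ) (∑ l, σ (e j l) (v l))
      rw [sum_inner] at this
      simp only [inner_sum, ← CPForm.inner_star_mul] at this
      exact this.symm
    have h3 : ((∑ j, ‖∑ l, σ (e j l) (v l)‖ ^ 2 : ℝ) : ℂ) =
        ((‖∑ i, E.cpForm.tmul σ (x i) (v i)‖ ^ 2 + ε * ∑ i, ‖v i‖ ^ 2 : ℝ) : ℂ) := by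
      rw [Complex.ofReal_add, E.cpForm.norm_sum_tmul σ x v]
      push_cast
      simp only [h2]
      rw [Finset.sum_comm]
      have e3 : ∀ i, ∑ j, ∑ l, ⟪v i, σ (star (e j i) * e j l) (v l)⟫_ℂ =
          ∑ l, ⟪v i, σ (E.inner (x i) (x l)) (v l)⟫_ℂ + ε * (‖v i‖ : ℂ) ^ 2 := by
        intro i
        rw [Finset.sum_comm]
        have e4 : ∀ l, ∑ j, ⟪v i, σ (star (e j i) * e j l) (v l)⟫_ℂ =
            ⟪v i, σ (E.inner (x i) (x l)) (v l)⟫_ℂ +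
              if i = l then (ε : ℂ) * ⟪v i, v l⟫_ℂ else 0 := by
          intro l
          rw [← inner_sum, ← sum_apply, ← map_sum, hee', map_add, add_apply, inner_add_right]
          split_ifs
          · rw [map_smul, map_one, smul_apply, inner_smul_right]
            rfl
          · simp
        simp only [e4, Finset.sum_add_distrib]
        simp [inner_self_eq_norm_sq_to_K]
      simp only [e3, Finset.sum_add_distrib, Finset.mul_sum]
      rfl
    exact_mod_cast h3
  rw [one_mul]
  refine (sq_le_sq₀ (norm_nonneg _) (norm_nonneg _)).mp ?_
  refine le_of_forall_pos_le_add fun δ hδ => ?_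
  have hS : 0 ≤ ∑ i, ‖v i‖ ^ 2 := by positivity
  refine (key (δ / (1 + ∑ i, ‖v i‖ ^ 2)) (by positivity)).trans ?_
  gcongr
  rw [div_mul_eq_mul_div, div_le_iff₀ (by positivity)]
  gcongr
  linarith

/-- The operator `T̃ : E ⊗_σ H → H`, `T̃ (x ⊗ h) = T(x) h`. -/
def IsCovariant.tilde {σ : A →⋆ₐ[ℂ] (H →L[ℂ] H)} {T : E →ₗ[ℂ] (H →L[ℂ] H)}
    (hT : IsCovariant σ T) : E.cpForm.Tensor σ →L[ℂ] H :=
  E.cpForm.lift σ (fun x => (T x).toLinearMap) 1 hT.bound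

theorem IsCovariant.tilde_tmul {σ : A →⋆ₐ[ℂ] (H →L[ℂ] H)} {T : E →ₗ[ℂ] (H →L[ℂ] H)}
    (hT : IsCovariant σ T) (x : E) (h : H) : hT.tilde (E.cpForm.tmul σ x h) = T x h :=
  E.cpForm.lift_tmul σ _ _ _ x h

/-- The commutant `σ(A)'`, as a von Neumann algebra. -/
def commutantOf {A : Type*} [CStarAlgebra A] (σ : A →⋆ₐ[ℂ] (H →L[ℂ] H)) : VonNeumannAlgebra H where
  toStarSubalgebra := StarSubalgebra.centralizer ℂ (Set.range σ)
  centralizer_centralizer' := by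
    change Set.centralizer (Set.centralizer (StarSubalgebra.centralizer ℂ (Set.range σ) : Set _)) =
      (StarSubalgebra.centralizer ℂ (Set.range σ) : Set (H →L[ℂ] H))
    rw [StarSubalgebra.coe_centralizer, Set.centralizer_centralizer_centralizer]

theorem mem_commutantOf {A : Type*} [CStarAlgebra A] {σ : A →⋆ₐ[ℂ] (H →L[ℂ] H)} {z : H →L[ℂ] H} :
    z ∈ commutantOf σ ↔ ∀ a, σ a * z = z * σ a := by
  have h : z ∈ commutantOf σ ↔ z ∈ StarSubalgebra.centralizer ℂ (Set.range σ) := Iff.rfl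
  rw [h, StarSubalgebra.mem_centralizer_iff]
  refine ⟨fun h a => (h _ ⟨a, rfl⟩).1, ?_⟩
  rintro h _ ⟨a, rfl⟩
  exact ⟨h a, by rw [← map_star]; exact h _⟩

/-- The operator `I ⊗ b` on `E ⊗_σ H` for `b ∈ σ(A)'`. -/
def idTensor (E : CStarCorrespondence A) {σ : A →⋆ₐ[ℂ] (H →L[ℂ] H)} (b : commutantOf σ) :
    E.cpForm.Tensor σ →L[ℂ] E.cpForm.Tensor σ :=
  E.cpForm.map σ σ b fun a v => (DFunLike.congr_fun (mem_commutantOf.mp b.2 a) v).symm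

end Representation

namespace CorrespondenceSystem

variable {S : Type*} [AddMonoid S]
variable {G : Type*} [NormedAddCommGroup G] [InnerProductSpace ℂ G] [CompleteSpace G]
  {N : VonNeumannAlgebra G}
variable {H : Type*} [NormedAddCommGroup H] [InnerProductSpace ℂ H] [CompleteSpace H]

/-- A (completely contractive covariant) representation `R` of a subproduct system `X` on `H`, with
`R_0` the nondegenerate normal representation `σ` of `N`. -/
structure IsRepresentation (X : CorrespondenceSystem S N) (σ : N →⋆ₐ[ℂ] (H →L[ℂ] H))
    (R : ∀ s, X.fiber s →ₗ[ℂ] (H →L[ℂ] H)) : Prop where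
  normal : IsNormalMap N σ
  map_unit : ∀ a, R 0 (X.unit a) = σ a
  covariant : ∀ s, IsCovariant σ (R s)
  map_mul : ∀ {s t} (x : X.fiber s) (y : X.fiber t), R (s + t) (X.mul x y) = R s x * R t y

end CorrespondenceSystem

/-! ### Semigroups of completely positive maps -/

section Stinespring

variable {H : Type*} [NormedAddCommGroup H] [InnerProductSpace ℂ H] [CompleteSpace H]
  {M : VonNeumannAlgebra H}

/-- A cp-semigroup over `S` on `M`: a semigroup of contractive normal completely positive maps. -/
structure CPSemigroup (S : Type*) [AddMonoid S] (M : VonNeumannAlgebra H) where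
  map : S → M →CP M
  norm_map_le : ∀ s a, ‖map s a‖ ≤ ‖a‖
  normal : ∀ s, IsNormalMap M fun a => (map s a : H →L[ℂ] H)
  map_zero : ∀ a, map 0 a = a
  map_add : ∀ s t a, map (s + t) a = map s (map t a)

/-- The form `⟨a, b⟩ = Θ(a⋆ b)` on `M`. -/
def stinespringForm (Θ : M →CP M) : CPForm M M M where
  form a b := Θ (star a * b)
  act a b := a * b
  pos n x := by
    rcases n with _ | n
    · refine le_of_eq ?_
      ext i
      exact i.elim0
    have h : (0 : CStarMatrix (Fin (n + 1)) (Fin (n + 1)) M) ≤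
        CStarMatrix.ofMatrix fun i j => star (x i) * x j := by
      let c : CStarMatrix (Fin (n + 1)) (Fin (n + 1)) M :=
        CStarMatrix.ofMatrix fun i j => if i = 0 then x j else 0
      have hc : (CStarMatrix.ofMatrix fun i j => star (x i) * x j) = star c * c := by
        ext i j : 1
        rw [CStarMatrix.mul_apply, Finset.sum_eq_single 0]
        · change star (x i) * x j = star (if (0 : Fin (n + 1)) = 0 then x i else 0) *
            (if (0 : Fin (n + 1)) = 0 then x j else 0)
          simp
        · intro l _ hl
          change _ * (if l = 0 then x j else 0) = 0
          simp [hl]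
        · simp
      rw [hc]
      exact star_mul_self_nonneg c
    exact Θ.map_cstarMatrix_nonneg _ h
  form_act_left a x y := by rw [star_mul, mul_assoc]
  form_act_add a b x y := by rw [add_mul, mul_add, map_add]
  form_act_smul c a x y := by rw [smul_mul_assoc, mul_smul_comm, map_smul]
  form_act_mul a b x y := by rw [mul_assoc]
  form_act_one x y := by rw [one_mul]

/-- The Hilbert space `M ⊗_Θ H` with `⟨a ⊗ h, b ⊗ g⟩ = ⟨h, Θ(a⋆ b) g⟩`. -/
abbrev StinespringSpace (Θ : M →CP M) : Type _ := (stinespringForm Θ).Tensor (incl M)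

/-- The action `a (b ⊗ h) = a b ⊗ h` of `M` on `M ⊗_Θ H`. -/
abbrev stinespringRep (Θ : M →CP M) :
    M →⋆ₐ[ℂ] (StinespringSpace Θ →L[ℂ] StinespringSpace Θ) :=
  (stinespringForm Θ).leftRep (incl M)

/-- The action `b (a ⊗ h) = a ⊗ b h` of the commutant of `M` on `M ⊗_Θ H`. -/
abbrev stinespringCommutantRep (Θ : M →CP M) :
    M.commutant →⋆ₐ[ℂ] (StinespringSpace Θ →L[ℂ] StinespringSpace Θ) :=
  (stinespringForm Θ).rightRep (incl M) (incl M.commutant) commutant_comm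

/-- The Arveson–Stinespring correspondence of `Θ`: the intertwiners `H → M ⊗_Θ H`, with the left
action `(b x)(h) = (I ⊗ b) x(h)`, the right action `x b = x ∘ b` and `⟨x, y⟩ = x⋆ y`. -/
def arvesonStinespringCorrespondence (Θ : M →CP M) : CStarCorrespondence M.commutant :=
  intertwinerCorrespondence M M.commutant rfl (stinespringRep Θ) (stinespringCommutantRep Θ)
    fun a b v => ((stinespringForm Θ).leftRep_rightRep (incl M) (incl M.commutant)
      commutant_comm a b v).symm

/-- The operator `h ↦ I ⊗ h` from `H` to `M ⊗_Θ H`. -/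
def stinespringVector (Θ : M →CP M) : H →L[ℂ] StinespringSpace Θ :=
  (stinespringForm Θ).tmul (incl M) 1

/-- The space `M ⊗_{Θ₂} M ⊗_{Θ₁} H`. -/
abbrev StinespringSpace₂ (Θ₁ Θ₂ : M →CP M) : Type _ :=
  (stinespringForm Θ₂).Tensor (stinespringRep Θ₁)

theorem inner_stinespring₂ (Θ₁ Θ₂ Θ : M →CP M) (h : ∀ a, Θ a = Θ₁ (Θ₂ a)) (a b : M) (v w : H) :
    ⟪(stinespringForm Θ₂).tmul (stinespringRep Θ₁) a (stinespringVector Θ₁ v),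
      (stinespringForm Θ₂).tmul (stinespringRep Θ₁) b (stinespringVector Θ₁ w)⟫_ℂ =
      ⟪v, incl M ((stinespringForm Θ).form a b) w⟫_ℂ := by
  rw [CPForm.inner_tmul]
  unfold stinespringVector
  rw [CPForm.leftRep_tmul, CPForm.inner_tmul]
  change ⟪v, incl M (Θ₁ (star 1 * (Θ₂ (star a * b) * 1))) w⟫_ℂ = ⟪v, incl M (Θ (star a * b)) w⟫_ℂ
  rw [h, star_one, one_mul, mul_one]

/-- The isometry `Γ : M ⊗_Θ H → M ⊗_{Θ₂} M ⊗_{Θ₁} H`, `a ⊗ h ↦ a ⊗ I ⊗ h`, for `Θ = Θ₁ ∘ Θ₂`. -/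
def gammaMap (Θ₁ Θ₂ Θ : M →CP M) (h : ∀ a, Θ a = Θ₁ (Θ₂ a)) :
    StinespringSpace Θ →L[ℂ] StinespringSpace₂ Θ₁ Θ₂ :=
  (stinespringForm Θ).lift (incl M)
    (fun a => ((stinespringForm Θ₂).tmul (stinespringRep Θ₁) a ∘L stinespringVector Θ₁).toLinearMap)
    1 ((stinespringForm Θ).isom_bound (incl M)
      (fun a => ((stinespringForm Θ₂).tmul (stinespringRep Θ₁) a ∘L stinespringVector Θ₁).toLinearMap)
      (inner_stinespring₂ Θ₁ Θ₂ Θ h))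

theorem gammaMap_tmul (Θ₁ Θ₂ Θ : M →CP M) (h : ∀ a, Θ a = Θ₁ (Θ₂ a)) (a : M) (v : H) :
    gammaMap Θ₁ Θ₂ Θ h ((stinespringForm Θ).tmul (incl M) a v) =
      (stinespringForm Θ₂).tmul (stinespringRep Θ₁) a (stinespringVector Θ₁ v) :=
  (stinespringForm Θ).lift_tmul (incl M)
    (fun a => ((stinespringForm Θ₂).tmul (stinespringRep Θ₁) a ∘L stinespringVector Θ₁).toLinearMap)
    1 _ a v

theorem gammaMap_leftRep (Θ₁ Θ₂ Θ : M →CP M) (h : ∀ a, Θ a = Θ₁ (Θ₂ a)) (a : M)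
    (t : StinespringSpace Θ) :
    gammaMap Θ₁ Θ₂ Θ h (stinespringRep Θ a t) =
      (stinespringForm Θ₂).leftRep (stinespringRep Θ₁) a (gammaMap Θ₁ Θ₂ Θ h t) := by
  have : gammaMap Θ₁ Θ₂ Θ h ∘L stinespringRep Θ a =
      (stinespringForm Θ₂).leftRep (stinespringRep Θ₁) a ∘L gammaMap Θ₁ Θ₂ Θ h := by
    refine (stinespringForm Θ).ext_tmul (incl M) fun b v => ?_
    simp only [ContinuousLinearMap.comp_apply, CPForm.leftRep_tmul, gammaMap_tmul]
    rfl
  exact DFunLike.congr_fun this t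

theorem adjoint_intertwines {K L : Type*} [NormedAddCommGroup K] [InnerProductSpace ℂ K]
    [CompleteSpace K] [NormedAddCommGroup L] [InnerProductSpace ℂ L] [CompleteSpace L]
    (π : M →⋆ₐ[ℂ] (K →L[ℂ] K)) (π' : M →⋆ₐ[ℂ] (L →L[ℂ] L)) (T : K →L[ℂ] L)
    (hT : ∀ a v, T (π a v) = π' a (T v)) (a : M) (w : L) :
    ContinuousLinearMap.adjoint T (π' a w) = π a (ContinuousLinearMap.adjoint T w) := by
  refine ext_inner_left ℂ fun v => ?_
  have h1 : π' a = ContinuousLinearMap.adjoint (π' (star a)) := by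
    rw [← ContinuousLinearMap.star_eq_adjoint, ← map_star, star_star]
  have h2 : π a = ContinuousLinearMap.adjoint (π (star a)) := by
    rw [← ContinuousLinearMap.star_eq_adjoint, ← map_star, star_star]
  rw [ContinuousLinearMap.adjoint_inner_right, h1, ContinuousLinearMap.adjoint_inner_right, h2,
    ContinuousLinearMap.adjoint_inner_right, ContinuousLinearMap.adjoint_inner_right, hT]

/-- The product `x y = Γ⋆ (I ⊗ x) y` of intertwiners `x : H → M ⊗_{Θ₁} H` and
`y : H → M ⊗_{Θ₂} H`, an intertwiner `H → M ⊗_Θ H` for `Θ = Θ₁ ∘ Θ₂`. -/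
def arvesonStinespringMul {Θ₁ Θ₂ Θ : M →CP M} (h : ∀ a, Θ a = Θ₁ (Θ₂ a))
    (x : intertwiners M (stinespringRep Θ₁)) (y : intertwiners M (stinespringRep Θ₂)) :
    intertwiners M (stinespringRep Θ) :=
  ⟨ContinuousLinearMap.adjoint (gammaMap Θ₁ Θ₂ Θ h) ∘L
      (stinespringForm Θ₂).map (incl M) (stinespringRep Θ₁) x (fun a v => x.2 a v) ∘L
      (y : H →L[ℂ] StinespringSpace Θ₂), fun a v => by
    have h1 : ∀ t, (stinespringForm Θ₂).map (incl M) (stinespringRep Θ₁) x (fun a v => x.2 a v)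
        (stinespringRep Θ₂ a t) = (stinespringForm Θ₂).leftRep (stinespringRep Θ₁) a
        ((stinespringForm Θ₂).map (incl M) (stinespringRep Θ₁) x (fun a v => x.2 a v) t) := by
      intro t
      have : (stinespringForm Θ₂).map (incl M) (stinespringRep Θ₁) x (fun a v => x.2 a v) ∘L
          stinespringRep Θ₂ a = (stinespringForm Θ₂).leftRep (stinespringRep Θ₁) a ∘L
          (stinespringForm Θ₂).map (incl M) (stinespringRep Θ₁) x (fun a v => x.2 a v) := by
        refine (stinespringForm Θ₂).ext_tmul (incl M) fun b v => ?_
        have e := (stinespringForm Θ₂).map_tmul (incl M) (stinespringRep Θ₁) x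
          fun a v => x.2 a v
        simp only [ContinuousLinearMap.comp_apply]
        rw [CPForm.leftRep_tmul, e, e, CPForm.leftRep_tmul]
      exact DFunLike.congr_fun this t
    simp only [ContinuousLinearMap.comp_apply]
    rw [y.2 a v, h1]
    exact adjoint_intertwines _ _ _ (gammaMap_leftRep Θ₁ Θ₂ Θ h) a _⟩

variable {S : Type*} [AddMonoid S]

/-- The Arveson–Stinespring subproduct system of a cp-semigroup `Θ` on `M`. It is a system over the
commutant of `M`; an element `b` of the commutant is identified with `h ↦ I ⊗ b h` in `E(0)`. -/
def CPSemigroup.arvesonStinespring (Θ : CPSemigroup S M) : CorrespondenceSystem S M.commutant where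
  fiber s := arvesonStinespringCorrespondence (Θ.map s)
  unit b := (⟨stinespringVector (Θ.map 0) ∘L (b : H →L[ℂ] H), fun a v => by
    have hb := commutant_comm b a v
    have h0 : (a : H →L[ℂ] H) ((b : H →L[ℂ] H) v) = (b : H →L[ℂ] H) ((a : H →L[ℂ] H) v) := hb.symm
    refine (stinespringForm (Θ.map 0)).eq_of_inner_tmul (incl M) fun c w => ?_
    simp only [ContinuousLinearMap.comp_apply]
    unfold stinespringVector
    rw [CPForm.leftRep_tmul, CPForm.inner_tmul, CPForm.inner_tmul, ← h0]
    change ⟪w, ((Θ.map 0 (star c * 1) : M) : H →L[ℂ] H) ((a : H →L[ℂ] H) ((b : H →L[ℂ] H) v))⟫_ℂ =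
      ⟪w, ((Θ.map 0 (star c * (a * 1)) : M) : H →L[ℂ] H) ((b : H →L[ℂ] H) v)⟫_ℂ
    rw [Θ.map_zero, Θ.map_zero, mul_one, mul_one]
    rfl⟩ : intertwiners M (stinespringRep (Θ.map 0)))
  mul {s t} x y := arvesonStinespringMul (Θ.map_add s t) x y

/-- The identity representation `T_s(x) = W⋆ x` of the Arveson–Stinespring subproduct system, where
`W h = I ⊗ h`. -/
def CPSemigroup.identityRep (Θ : CPSemigroup S M) (s : S) :
    Θ.arvesonStinespring.fiber s →ₗ[ℂ] (H →L[ℂ] H) where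
  toFun (x : intertwiners M (stinespringRep (Θ.map s))) :=
    ContinuousLinearMap.adjoint (stinespringVector (Θ.map s)) ∘L x.1
  map_add' (x y : intertwiners M (stinespringRep (Θ.map s))) :=
    ContinuousLinearMap.comp_add (ContinuousLinearMap.adjoint (stinespringVector (Θ.map s))) x.1 y.1
  map_smul' c (x : intertwiners M (stinespringRep (Θ.map s))) :=
    ContinuousLinearMap.comp_smul (ContinuousLinearMap.adjoint (stinespringVector (Θ.map s))) c x.1

end Stinespring

end Subproduct

end

/-!
# Representations of subproduct systems and the Arveson–Stinespring system

Write `M = σ(N)'`, `T̃_s : X(s) ⊗_σ H → H` for the contraction of `R_s` and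
`Θ_s(a) = T̃_s (I ⊗ a) T̃_s⋆`. The argument rests on the isometry
`v_s : M ⊗_{Θ_s} H → X(s) ⊗_σ H`, `a ⊗ h ↦ (I ⊗ a) T̃_s⋆ h`. Its adjoint turns `x ∈ X(s)` into the
intertwiner `W_s x = v_s⋆ (x ⊗ ·) : H → M ⊗_{Θ_s} H`, and `w_s⋆ W_s x = T̃_s (x ⊗ ·) = R_s x`.

* *The coefficient algebras.* A faithful normal `σ` maps `N` onto `σ(N)'' = M'`
  (`exists_eq_of_mem_bicommutant`). A self-adjoint element of the bicommutant is approximated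
  strongly by self-adjoint elements of `σ(N)`; their resolvents at `i` are bounded by `1`, so they
  have a weak limit in the image of the weakly compact unit ball of `N`. Hence `σ(N)` contains the
  resolvent of the given element, and then the element itself.
* *The semigroup property.* `Θ_s Θ_t` is computed on `X(s) ⊗ X(t) ⊗ H` and `Θ_{s+t}` on
  `X(s + t) ⊗ H`, which embeds into `(X(s) ⊗ X(t)) ⊗_σ H` through the adjoint of the multiplication.
  The tensor product `X(s) ⊗ X(t)` is a self-dual completion, so one has to know that the vectors
  `(x ⊗ y) ⊗ h` are total (`isTotal_elem_tmul`). They are by construction if `σ` is the identity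
  representation; in general one passes to the sum of `σ` and the identity representation and uses
  that compressions by elements of a correspondence stay in the von Neumann algebra
  (`isTotal_tmul_of_intertwining`).
* *The system `E`.* The compression `x ↦ w_s⋆ x` is injective on `E(s)`, multiplicative and a bimodule
  map (`stinespringCompression_injective`, `stinespringCompression_mul`). Hence associativity and the
  unit laws of `E`, and the multiplicativity of `W`, can be checked in `B(H)`. The multiplication of
  `E` is coisometric because the vectors `x h`, `x ∈ E(s)`, are total, so that
  `x ⊗ y ⊗ h ↦ (I ⊗ x) y h` is unitary, and `Γ` is an isometry.
* *The morphism.* Self-duality of `X(s)` provides the adjoint `V_s` of `W_s`; then `V_s y ⊗ g = v_s y g`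
  and `W_s V_s = 1` (`IsCovariant.exists_coisometry_stinespring`). This also transfers self-duality to
  `E(s)`. Since `w_s⋆ W_s x = R_s x` and compression is injective, `W_s` and `R_s` have the same
  kernel, whose projection is `1 - V_s W_s`.
* *Isometric representations.* `σ` is faithful and `R_s(x)⋆ R_s(y) = σ⟨x, y⟩`, so the multiplication of
  `X` preserves inner products of elementary tensors, and these determine the elements of
  `X(s) ⊗ X(t)` (`tensor_ext`).
-/

noncomputable section

namespace Subproduct

open scoped InnerProductSpace CStarAlgebra

open Filter Topology

/-! ### Total families in Hilbert spaces -/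

section Total

variable {ι κ : Type*}
variable {K : Type*} [NormedAddCommGroup K] [InnerProductSpace ℂ K] [CompleteSpace K]
variable {L : Type*} [NormedAddCommGroup L] [InnerProductSpace ℂ L] [CompleteSpace L]

/-- A family of vectors in a Hilbert space is total if only `0` is orthogonal to it. -/
def IsTotal (φ : ι → K) : Prop := ∀ x, (∀ i, ⟪φ i, x⟫_ℂ = 0) → x = 0

theorem IsTotal.dense {φ : ι → K} (hφ : IsTotal φ) :
    Dense (Submodule.span ℂ (Set.range φ) : Set K) := by
  rw [Submodule.dense_iff_topologicalClosure_eq_top,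
    Submodule.topologicalClosure_eq_top_iff, Submodule.eq_bot_iff]
  exact fun x hx => hφ x fun i =>
    (Submodule.mem_orthogonal _ x).mp hx _ (Submodule.subset_span ⟨i, rfl⟩)

theorem IsTotal.ext {W : Type*} [NormedAddCommGroup W] [NormedSpace ℂ W] {φ : ι → K}
    (hφ : IsTotal φ) {T T' : K →L[ℂ] W} (h : ∀ i, T (φ i) = T' (φ i)) : T = T' := by
  refine ContinuousLinearMap.ext_on hφ.dense ?_
  rintro _ ⟨i, rfl⟩
  exact h i

omit [CompleteSpace K] in
theorem IsTotal.eq_of_inner {φ : ι → K} (hφ : IsTotal φ) {x y : K}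
    (h : ∀ i, ⟪φ i, x⟫_ℂ = ⟪φ i, y⟫_ℂ) : x = y :=
  sub_eq_zero.mp <| hφ _ fun i => by rw [inner_sub_right, h, sub_self]

theorem IsTotal.mem_of_isClosed {φ : ι → K} (hφ : IsTotal φ) {V : Submodule ℂ K}
    (hV : IsClosed (V : Set K)) (h : ∀ i, φ i ∈ V) (x : K) : x ∈ V := by
  have h1 : Submodule.span ℂ (Set.range φ) ≤ V := by
    rw [Submodule.span_le]
    rintro _ ⟨i, rfl⟩
    exact h i
  exact closure_minimal h1 hV (hφ.dense x)

/-- A family with the same Gram matrix as a total family is its image under an isometry. -/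
theorem exists_isometry_of_gram {φ : ι → K} (hφ : IsTotal φ) (ψ : ι → L)
    (h : ∀ i j, ⟪ψ i, ψ j⟫_ℂ = ⟪φ i, φ j⟫_ℂ) :
    ∃ T : K →L[ℂ] L, (∀ i, T (φ i) = ψ i) ∧ ContinuousLinearMap.adjoint T ∘L T = 1 := by
  let e : (ι →₀ ℂ) →ₗ[ℂ] K := Finsupp.linearCombination ℂ φ
  let g : (ι →₀ ℂ) →ₗ[ℂ] L := Finsupp.linearCombination ℂ ψ
  have hd : DenseRange e := by
    have h1 : Set.range e = (Submodule.span ℂ (Set.range φ) : Set K) := by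
      rw [← LinearMap.coe_range, Finsupp.range_linearCombination]
    rw [DenseRange, h1]
    exact hφ.dense
  have hb : ∀ f, ‖g f‖ ≤ 1 * ‖e f‖ := by
    intro f
    have h1 : ⟪g f, g f⟫_ℂ = ⟪e f, e f⟫_ℂ := by
      simp only [e, g, Finsupp.linearCombination_apply, Finsupp.sum, sum_inner, inner_sum,
        inner_smul_left, inner_smul_right, h]
    rw [inner_self_eq_norm_sq_to_K, inner_self_eq_norm_sq_to_K] at h1
    have h2 : ‖g f‖ ^ 2 = ‖e f‖ ^ 2 := by exact_mod_cast h1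
    rw [one_mul]
    exact ((pow_left_inj₀ (norm_nonneg _) (norm_nonneg _) two_ne_zero).mp h2).le
  have hT : ∀ i, g.extendOfNorm e (φ i) = ψ i := fun i => by
    have := LinearMap.extendOfNorm_eq hd ⟨1, hb⟩ (Finsupp.single i 1)
    simpa [e, g] using this
  refine ⟨g.extendOfNorm e, hT, hφ.ext fun i => hφ.eq_of_inner fun j => ?_⟩
  rw [ContinuousLinearMap.comp_apply, ContinuousLinearMap.adjoint_inner_right, hT, hT, h]
  rfl

/-- An isometry that maps some family onto a total one is unitary. -/
theorem comp_adjoint_eq_one {T : K →L[ℂ] L} (hT : ContinuousLinearMap.adjoint T ∘L T = 1)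
    {φ : ι → K} {ψ : ι → L} (hψ : IsTotal ψ) (h : ∀ i, T (φ i) = ψ i) :
    T ∘L ContinuousLinearMap.adjoint T = 1 := by
  refine hψ.ext fun i => ?_
  have := DFunLike.congr_fun hT (φ i)
  simp only [ContinuousLinearMap.comp_apply, ← h] at this ⊢
  rw [this]
  rfl

theorem tendsto_apply_of_total {α : Type*} {l : Filter α} {φ : ι → K} (hφ : IsTotal φ)
    (F : α → K →L[ℂ] ℂ) (F₀ : K →L[ℂ] ℂ) {C : ℝ} (hF : ∀ᶠ a in l, ‖F a‖ ≤ C)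
    (h : ∀ i, Tendsto (fun a => F a (φ i)) l (𝓝 (F₀ (φ i)))) (x : K) :
    Tendsto (fun a => F a x) l (𝓝 (F₀ x)) := by
  let V : Submodule ℂ K :=
    { carrier := {x | Tendsto (fun a => F a x) l (𝓝 (F₀ x))}
      add_mem' := fun {x y} hx hy => by
        change Tendsto _ _ _
        simpa using Tendsto.add hx hy
      zero_mem' := by
        change Tendsto _ _ _
        simp [tendsto_const_nhds]
      smul_mem' := fun c x hx => by
        change Tendsto _ _ _
        simpa using Tendsto.const_mul c hx }
  refine hφ.mem_of_isClosed (V := V) (isClosed_of_closure_subset fun y hy => ?_) h x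
  change Tendsto _ _ _
  rw [Metric.tendsto_nhds]
  intro ε hε
  set D := C + ‖F₀‖ with hD
  have hδ : 0 < ε / (2 * (|D| + 1)) := by positivity
  obtain ⟨z, hz, hyz⟩ := Metric.mem_closure_iff.mp hy _ hδ
  filter_upwards [hF, Metric.tendsto_nhds.mp hz (ε / 2) (by positivity)] with a ha hza
  rw [dist_eq_norm] at hza hyz ⊢
  have e : F a y - F₀ y = (F a - F₀) (y - z) + (F a z - F₀ z) := by
    simp only [sub_apply, map_sub]; ring
  have h1 : ‖(F a - F₀) (y - z)‖ ≤ |D| * (ε / (2 * (|D| + 1))) := by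
    refine ((F a - F₀).le_opNorm _).trans ?_
    gcongr
    exact (norm_sub_le _ _).trans (by rw [hD]; exact (add_le_add_left ha _).trans (le_abs_self _))
  have h2 : |D| * (ε / (2 * (|D| + 1))) ≤ ε / 2 := by
    rw [mul_div_assoc', div_le_div_iff₀ (by positivity) two_pos]
    nlinarith [abs_nonneg D]
  rw [e]
  exact (norm_add_le _ _).trans_lt (by linarith)

/-- On bounded sets of operators, weak convergence may be tested on total families. -/
theorem tendsto_inner_of_total {α : Type*} {l : Filter α} {φ : ι → L} {ψ : κ → K}
    (hφ : IsTotal φ) (hψ : IsTotal ψ) (Φ : α → K →L[ℂ] L) (Φ₀ : K →L[ℂ] L) {C : ℝ}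
    (hΦ : ∀ᶠ a in l, ‖Φ a‖ ≤ C)
    (h : ∀ i j, Tendsto (fun a => ⟪φ i, Φ a (ψ j)⟫_ℂ) l (𝓝 ⟪φ i, Φ₀ (ψ j)⟫_ℂ)) (x : L) (y : K) :
    Tendsto (fun a => ⟪x, Φ a y⟫_ℂ) l (𝓝 ⟪x, Φ₀ y⟫_ℂ) := by
  have h1 : ∀ i y, Tendsto (fun a => ⟪φ i, Φ a y⟫_ℂ) l (𝓝 ⟪φ i, Φ₀ y⟫_ℂ) := fun i y => by
    refine tendsto_apply_of_total (C := ‖φ i‖ * C) hψ (fun a => innerSL ℂ (φ i) ∘L Φ a)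
      (innerSL ℂ (φ i) ∘L Φ₀) ?_ (h i) y
    filter_upwards [hΦ] with a ha
    refine (ContinuousLinearMap.opNorm_comp_le _ _).trans ?_
    rw [innerSL_apply_norm]
    gcongr
  have h2 : Tendsto (fun a => ⟪Φ a y, x⟫_ℂ) l (𝓝 ⟪Φ₀ y, x⟫_ℂ) := by
    refine tendsto_apply_of_total (C := C * ‖y‖) hφ (fun a => innerSL ℂ (Φ a y))
      (innerSL ℂ (Φ₀ y)) ?_ (fun i => ?_) x
    · filter_upwards [hΦ] with a ha
      rw [innerSL_apply_norm]
      exact (ContinuousLinearMap.le_opNorm _ _).trans (by gcongr)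
    · have := (Complex.continuous_conj.tendsto _).comp (h1 i y)
      simpa [Function.comp_def] using this
  have := (Complex.continuous_conj.tendsto _).comp h2
  simpa [Function.comp_def] using this

end Total

/-! ### Normal functionals -/

section Normal

variable {G : Type*} [NormedAddCommGroup G] [InnerProductSpace ℂ G] [CompleteSpace G]
  {N : VonNeumannAlgebra G}

theorem isNormalFunctional_iff_tendsto {f : N → ℂ} :
    IsNormalFunctional N f ↔ ∀ (l : Filter N) (r : ℝ) (a₀ : N), (∀ᶠ a in l, ‖a‖ ≤ r) →
      (∀ g g', Tendsto (fun a : N => ⟪g, (a : G →L[ℂ] G) g'⟫_ℂ) l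
        (𝓝 ⟪g, (a₀ : G →L[ℂ] G) g'⟫_ℂ)) → Tendsto f l (𝓝 (f a₀)) := by
  let τ : TopologicalSpace N :=
    TopologicalSpace.induced (fun (a : N) (p : G × G) => ⟪p.1, (a : G →L[ℂ] G) p.2⟫_ℂ) inferInstance
  have hτ : ∀ a₀, @nhds N τ a₀ = comap (fun (a : N) (p : G × G) => ⟪p.1, (a : G →L[ℂ] G) p.2⟫_ℂ)
      (𝓝 fun p : G × G => ⟪p.1, (a₀ : G →L[ℂ] G) p.2⟫_ℂ) := fun a₀ => nhds_induced _ a₀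
  constructor
  · intro hf l r a₀ hl h
    have h1 : Tendsto f (@nhdsWithin N τ a₀ {a | ‖a‖ ≤ max r ‖a₀‖}) (𝓝 (f a₀)) :=
      hf (max r ‖a₀‖) a₀ (by simp)
    refine h1.mono_left (le_inf ?_ ?_)
    · rw [hτ, ← tendsto_iff_comap, tendsto_pi_nhds]
      exact fun p => h p.1 p.2
    · rw [le_principal_iff]
      filter_upwards [hl] with a ha using ha.trans (le_max_left _ _)
  · intro h r a₀ _
    refine h (@nhdsWithin N τ a₀ {a | ‖a‖ ≤ r}) r a₀ ?_ fun g g' => ?_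
    · exact mem_inf_of_right (mem_principal_self _)
    · have h1 : Tendsto (fun (a : N) (p : G × G) => ⟪p.1, (a : G →L[ℂ] G) p.2⟫_ℂ) (@nhds N τ a₀)
          (𝓝 fun p : G × G => ⟪p.1, (a₀ : G →L[ℂ] G) p.2⟫_ℂ) := by
        rw [hτ]; exact tendsto_comap
      exact ((tendsto_pi_nhds.mp h1) (g, g')).mono_left inf_le_left

end Normal

/-! ### Tensor products with a Hilbert space -/

namespace CPForm

variable {A B I : Type*} [CStarAlgebra A] [CStarAlgebra B] [PartialOrder B]
  [StarOrderedRing B] (k : CPForm A B I)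
variable {K : Type*} [NormedAddCommGroup K] [InnerProductSpace ℂ K] [CompleteSpace K]
variable {L : Type*} [NormedAddCommGroup L] [InnerProductSpace ℂ L] [CompleteSpace L]
variable (π : B →⋆ₐ[ℂ] (K →L[ℂ] K)) (π' : B →⋆ₐ[ℂ] (L →L[ℂ] L))

theorem isTotal_tmul : IsTotal fun p : I × K => k.tmul π p.1 p.2 := fun ξ h =>
  k.eq_of_inner_tmul π fun x v => by rw [inner_zero_right]; exact h (x, v)

theorem isTotal_tmul_of_isTotal {ι : Type*} {φ : ι → K} (hφ : IsTotal φ) :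
    IsTotal fun p : I × ι => k.tmul π p.1 (φ p.2) := by
  intro ξ h
  refine k.isTotal_tmul π ξ fun p => ?_
  have h1 : ContinuousLinearMap.adjoint (k.tmul π p.1) ξ = 0 := hφ _ fun i => by
    rw [ContinuousLinearMap.adjoint_inner_right]
    exact h (p.1, i)
  rw [← ContinuousLinearMap.adjoint_inner_right, h1, inner_zero_right]

theorem norm_lift_apply_le {W : Type*} [NormedAddCommGroup W] [NormedSpace ℂ W] [CompleteSpace W]
    (f : I → K →ₗ[ℂ] W) (C : ℝ)
    (h : ∀ (n : ℕ) (x : Fin n → I) (v : Fin n → K),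
      ‖∑ i, f (x i) (v i)‖ ≤ C * ‖∑ i, k.tmul π (x i) (v i)‖) (t : k.Tensor π) :
    ‖k.lift π f C h t‖ ≤ C * ‖t‖ := by
  have hc : IsClosed {t | ‖k.lift π f C h t‖ ≤ C * ‖t‖} :=
    isClosed_le (by fun_prop) (by fun_prop)
  refine closure_minimal (fun s hs => ?_) hc ((k.isTotal_tmul π).dense t)
  obtain ⟨n, c, g, rfl⟩ := (Submodule.mem_span_set' (R := ℂ)).mp hs
  choose p hp using fun i => (g i).2
  have e : ∀ i, c i • (g i : k.Tensor π) = k.tmul π (p i).1 (c i • (p i).2) := fun i => by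
    rw [map_smul, ← hp i]
  simp only [e]
  change ‖k.lift π f C h _‖ ≤ _
  rw [map_sum]
  simp only [lift_tmul]
  exact h n _ _

theorem inner_map_map (T T' : K →L[ℂ] L) (hT : ∀ b v, T (π b v) = π' b (T v))
    (hT' : ∀ b v, T' (π b v) = π' b (T' v)) (C : K →L[ℂ] K) (hC : ∀ b v, C (π b v) = π b (C v))
    (h : ContinuousLinearMap.adjoint T ∘L T' = C) (s t : k.Tensor π) :
    ⟪k.map π π' T hT s, k.map π π' T' hT' t⟫_ℂ = ⟪s, k.map π π C hC t⟫_ℂ := by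
  have : ContinuousLinearMap.adjoint (k.map π π' T hT) ∘L k.map π π' T' hT' = k.map π π C hC := by
    refine k.ext_tmul π fun x v => k.eq_of_inner_tmul π fun y w => ?_
    rw [ContinuousLinearMap.comp_apply, ContinuousLinearMap.adjoint_inner_right, map_tmul, map_tmul,
      map_tmul, inner_tmul, inner_tmul, ← hT', ← hC, ← h, ContinuousLinearMap.comp_apply,
      ContinuousLinearMap.adjoint_inner_right]
  rw [← this, ContinuousLinearMap.comp_apply, ContinuousLinearMap.adjoint_inner_right]

end CPForm

/-! ### The range of a faithful normal representation -/

section Range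

variable {G : Type*} [NormedAddCommGroup G] [InnerProductSpace ℂ G] [CompleteSpace G]
  {N : VonNeumannAlgebra G}
variable {H : Type*} [NormedAddCommGroup H] [InnerProductSpace ℂ H] [CompleteSpace H]

/-- The balls of a von Neumann algebra are compact for the weak operator topology. -/
theorem exists_weak_limit (l : Ultrafilter N) {r : ℝ} (hl : ∀ᶠ a in (l : Filter N), ‖a‖ ≤ r) :
    ∃ a₀ : N, ∀ g g', Tendsto (fun a : N => ⟪g, (a : G →L[ℂ] G) g'⟫_ℂ) l
      (𝓝 ⟪g, (a₀ : G →L[ℂ] G) g'⟫_ℂ) := by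
  have hb : ∀ g g', ∀ᶠ a : N in (l : Filter N), ‖⟪(a : G →L[ℂ] G) g, g'⟫_ℂ‖ ≤ r * ‖g‖ * ‖g'‖ := by
    intro g g'
    filter_upwards [hl] with a ha
    refine (norm_inner_le_norm _ _).trans ?_
    gcongr
    exact ((a : G →L[ℂ] G).le_opNorm g).trans (by gcongr; exact ha)
  have hlim : ∀ g g', ∃ c : ℂ, Tendsto (fun a : N => ⟪(a : G →L[ℂ] G) g, g'⟫_ℂ) l (𝓝 c) := by
    intro g g'
    obtain ⟨c, -, hc⟩ := (isCompact_closedBall (0 : ℂ) (r * ‖g‖ * ‖g'‖)).ultrafilter_le_nhds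
      (l.map fun a : N => ⟪(a : G →L[ℂ] G) g, g'⟫_ℂ) (by
        rw [le_principal_iff]
        change ∀ᶠ a : N in (l : Filter N), _
        filter_upwards [hb g g'] with a ha
        simpa using ha)
    exact ⟨c, hc⟩
  choose c hc using hlim
  let B : G →ₗ⋆[ℂ] G →ₗ[ℂ] ℂ := LinearMap.mk₂'ₛₗ (starRingEnd ℂ) (RingHom.id ℂ) c
    (fun g₁ g₂ g' => tendsto_nhds_unique (hc _ _)
      (by simpa [inner_add_left] using (hc g₁ g').add (hc g₂ g')))
    (fun z g g' => tendsto_nhds_unique (hc _ _)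
      (by simpa [inner_smul_left, mul_comm] using (hc g g').const_mul (starRingEnd ℂ z)))
    (fun g g₁ g₂ => tendsto_nhds_unique (hc _ _)
      (by simpa [inner_add_right] using (hc g g₁).add (hc g g₂)))
    (fun z g g' => tendsto_nhds_unique (hc _ _)
      (by simpa [inner_smul_right] using (hc g g').const_mul z))
  have hB : ∀ g g', ‖B g g'‖ ≤ r * ‖g‖ * ‖g'‖ := fun g g' =>
    le_of_tendsto (hc g g').norm (hb g g')
  set T : G →L[ℂ] G := InnerProductSpace.continuousLinearMapOfBilin (B.mkContinuous₂ r hB) with hT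
  have hT1 : ∀ g g', ⟪T g, g'⟫_ℂ = c g g' := fun g g' =>
    InnerProductSpace.continuousLinearMapOfBilin_apply _ _ _
  have hT2 : ∀ g g', Tendsto (fun a : N => ⟪g, (a : G →L[ℂ] G) g'⟫_ℂ) l (𝓝 ⟪g, T g'⟫_ℂ) := by
    intro g g'
    have := (Complex.continuous_conj.tendsto _).comp (hc g' g)
    rw [← hT1] at this
    simpa [Function.comp_def] using this
  refine ⟨⟨T, ?_⟩, hT2⟩
  rw [← N.commutant_commutant, mem_commutant_iff]
  intro y hy
  ext g'
  refine ext_inner_left ℂ fun g => tendsto_nhds_unique ?_ (hT2 g (y g'))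
  have h1 := hT2 (ContinuousLinearMap.adjoint y g) g'
  rw [ContinuousLinearMap.adjoint_inner_left] at h1
  refine h1.congr fun a => ?_
  rw [ContinuousLinearMap.adjoint_inner_left]
  exact congrArg _ (DFunLike.congr_fun ((mem_commutant_iff N y).mp hy a a.2) g').symm

/-- The operator `x ↦ (T x_i)_i` on a finite Hilbert sum of copies of `H`. -/
def amplify {ι : Type*} [Fintype ι] (T : H →L[ℂ] H) :
    PiLp 2 (fun _ : ι => H) →L[ℂ] PiLp 2 (fun _ : ι => H) :=
  (PiLp.continuousLinearEquiv 2 ℂ fun _ : ι => H).symm ∘L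
    ContinuousLinearMap.pi fun i => T ∘L PiLp.proj 2 (fun _ : ι => H) i

omit [CompleteSpace H] in
theorem amplify_apply {ι : Type*} [Fintype ι] (T : H →L[ℂ] H) (x : PiLp 2 (fun _ : ι => H))
    (i : ι) : amplify T x i = T (x i) := rfl

/-- The finite-dimensional step of von Neumann's double commutant theorem, in dual form. -/
theorem sum_inner_eq_zero_of_mem_bicommutant {A : Type*} [CStarAlgebra A]
    (σ : A →⋆ₐ[ℂ] (H →L[ℂ] H)) {T : H →L[ℂ] H} (hT : T ∈ (commutantOf σ).commutant)
    {ι : Type*} [Fintype ι] (k h : ι → H) (hk : ∀ a, ∑ i, ⟪k i, σ a (h i)⟫_ℂ = 0) :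
    ∑ i, ⟪k i, T (h i)⟫_ℂ = 0 := by
  classical
  -- the orthogonal complement of the cyclic subspace generated by `h`
  obtain ⟨V, hVc, hV⟩ : ∃ V : Submodule ℂ (PiLp 2 (fun _ : ι => H)),
      IsClosed (V : Set (PiLp 2 (fun _ : ι => H))) ∧
      ∀ x, x ∈ V ↔ ∀ a, ∑ i, ⟪x i, σ a (h i)⟫_ℂ = 0 := by
    refine ⟨(Submodule.span ℂ (Set.range fun a => amplify (σ a) (WithLp.toLp 2 h)))ᗮ,
      Submodule.isClosed_orthogonal _, fun x => ?_⟩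
    have e : ∀ a, ⟪x, amplify (σ a) (WithLp.toLp 2 h)⟫_ℂ = ∑ i, ⟪x i, σ a (h i)⟫_ℂ :=
      fun a => PiLp.inner_apply _ _
    rw [Submodule.mem_orthogonal']
    refine ⟨fun hx a => (e a).symm.trans (hx _ (Submodule.subset_span ⟨a, rfl⟩)), fun hx u hu => ?_⟩
    induction hu using Submodule.span_induction with
    | mem _ hu => obtain ⟨a, rfl⟩ := hu; exact (e a).trans (hx a)
    | zero => exact inner_zero_right _
    | add _ _ _ _ h1 h2 => rw [inner_add_right, h1, h2, add_zero]
    | smul c _ _ h1 => rw [inner_smul_right, h1, mul_zero]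
  have hVcs : CompleteSpace V := hVc.completeSpace_coe
  have hVp : V.HasOrthogonalProjection := inferInstance
  have hadj : ∀ b (u v : PiLp 2 (fun _ : ι => H)),
      ⟪amplify (σ b) u, v⟫_ℂ = ⟪u, amplify (σ (star b)) v⟫_ℂ := by
    intro b u v
    simp only [PiLp.inner_apply, amplify_apply]
    refine Finset.sum_congr rfl fun i _ => ?_
    rw [map_star, ContinuousLinearMap.star_eq_adjoint, ContinuousLinearMap.adjoint_inner_right]
  have hinv : ∀ b, ∀ x ∈ V, amplify (σ b) x ∈ V := by
    intro b x hx
    rw [hV] at hx ⊢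
    intro a
    rw [← hx (star b * a)]
    refine Finset.sum_congr rfl fun i _ => ?_
    rw [amplify_apply, map_mul, map_star, ContinuousLinearMap.star_eq_adjoint,
      mul_apply_eq_comp, ContinuousLinearMap.adjoint_inner_right]
  let P := V.starProjection
  have hcomm : ∀ b x, P (amplify (σ b) x) = amplify (σ b) (P x) := by
    intro b x
    refine Submodule.eq_starProjection_of_mem_of_inner_eq_zero
      (hinv b _ (Submodule.starProjection_apply_mem V x)) fun w hw => ?_
    rw [← map_sub, hadj]
    exact Submodule.starProjection_inner_eq_zero x _ (hinv _ w hw)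
  -- the matrix entries of `P` lie in the commutant
  let s : ι → H →L[ℂ] PiLp 2 (fun _ : ι => H) := fun j =>
    (PiLp.continuousLinearEquiv 2 ℂ fun _ : ι => H).symm ∘L
      ContinuousLinearMap.single ℂ (fun _ : ι => H) j
  have hs : ∀ (A : H →L[ℂ] H) j v, amplify A (s j v) = s j (A v) := by
    intro A j v
    ext i
    rw [amplify_apply]
    change A ((Pi.single j v : ι → H) i) = (Pi.single j (A v) : ι → H) i
    by_cases hij : i = j
    · subst hij; simp
    · simp [hij]
  have hsum : ∀ x : PiLp 2 (fun _ : ι => H), ∑ j, s j (x j) = x := by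
    intro x
    ext i
    rw [WithLp.ofLp_sum, Finset.sum_apply]
    change ∑ j, (Pi.single j (x j) : ι → H) i = x i
    simp
  have hTP : ∀ x, P (amplify T x) = amplify T (P x) := by
    intro x
    ext i
    have hm : ∀ j, PiLp.proj 2 (fun _ : ι => H) i ∘L P ∘L s j ∈ commutantOf σ := by
      intro j
      rw [mem_commutantOf]
      intro a
      ext v
      change σ a ((P (s j v)) i) = (P (s j (σ a v))) i
      rw [← hs, hcomm, amplify_apply]
    have hc : ∀ j v, (P (s j (T v))) i = T ((P (s j v)) i) := fun j v =>
      DFunLike.congr_fun ((mem_commutant_iff _ T).mp hT _ (hm j)) v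
    have e1 : amplify T x = ∑ j, s j (T (x j)) := by
      conv_lhs => rw [← hsum x, map_sum]
      simp only [hs]
    rw [e1, amplify_apply]
    conv_rhs => rw [← hsum x]
    rw [map_sum, map_sum, WithLp.ofLp_sum, Finset.sum_apply, WithLp.ofLp_sum, Finset.sum_apply,
      map_sum]
    exact Finset.sum_congr rfl fun j _ => hc j _
  have hPh : P (WithLp.toLp 2 h) = 0 := by
    refine Submodule.eq_starProjection_of_mem_of_inner_eq_zero (zero_mem V) fun w hw => ?_
    have := (hV w).mp hw 1
    rw [sub_zero, ← inner_conj_symm]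
    rw [map_one] at this
    rw [PiLp.inner_apply]
    simpa using congrArg (starRingEnd ℂ) this
  have hkV : WithLp.toLp 2 k ∈ V := (hV _).mpr hk
  have h1 : ⟪WithLp.toLp 2 k, amplify T (WithLp.toLp 2 h)⟫_ℂ = 0 := by
    have h2 := Submodule.starProjection_inner_eq_zero (K := V) (amplify T (WithLp.toLp 2 h)) _ hkV
    have h3 : V.starProjection (amplify T (WithLp.toLp 2 h)) = 0 := by
      have := hTP (WithLp.toLp 2 h)
      rw [hPh, map_zero] at this
      exact this
    rw [h3, sub_zero] at h2
    rw [← inner_conj_symm, h2, map_zero]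
  rw [PiLp.inner_apply] at h1
  exact h1

/-- A vector that is orthogonal, for the real part of the inner product, to the orthogonal
complement of a real subspace belongs to the closure of that subspace. -/
theorem exists_norm_sub_lt_of_orthogonal {E : Type*} [AddCommGroup E] [Module ℝ E]
    (f : E →+ H) (hf : ∀ (r : ℝ) b, f (r • b) = (r : ℂ) • f b) (x : H)
    (h : ∀ k, (∀ b, (⟪k, f b⟫_ℂ).re = 0) → (⟪k, x⟫_ℂ).re = 0) {ε : ℝ} (hε : 0 < ε) :
    ∃ b, ‖f b - x‖ < ε := by
  let _ := InnerProductSpace.complexToReal (G := H)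
  let g : E →ₗ[ℝ] H := { f with map_smul' := hf }
  have hx : x ∈ (LinearMap.range g).topologicalClosure := by
    rw [← Submodule.orthogonal_orthogonal_eq_closure, Submodule.mem_orthogonal]
    intro k hk
    exact h k fun b => (Submodule.mem_orthogonal' _ k).mp hk _ ⟨b, rfl⟩
  obtain ⟨_, ⟨b, rfl⟩, hb⟩ := Metric.mem_closure_iff.mp hx ε hε
  exact ⟨b, by rwa [dist_comm, dist_eq_norm] at hb⟩

/-- Self-adjoint elements of the double commutant are strong limits of self-adjoint elements: the
strongly closed real subspaces of `B(H)` are the weakly closed ones. -/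
theorem exists_selfAdjoint_approx {A : Type*} [CStarAlgebra A]
    (σ : A →⋆ₐ[ℂ] (H →L[ℂ] H)) {T : H →L[ℂ] H} (hT : T ∈ (commutantOf σ).commutant)
    (hTs : IsSelfAdjoint T) {ι : Type*} [Fintype ι] (h : ι → H) {ε : ℝ} (hε : 0 < ε) :
    ∃ b : A, IsSelfAdjoint b ∧ ∀ i, ‖σ b (h i) - T (h i)‖ < ε := by
  let f : selfAdjoint A →+ PiLp 2 (fun _ : ι => H) :=
    { toFun := fun b => WithLp.toLp 2 fun i => σ b (h i)
      map_add' := fun b c => by ext i; simp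
      map_zero' := by ext i; simp }
  have hf : ∀ (r : ℝ) b, f (r • b) = (r : ℂ) • f b := fun r b => by
    ext i
    change σ ((r • b : selfAdjoint A) : A) (h i) = (r : ℂ) • σ (b : A) (h i)
    rw [selfAdjoint.val_smul, ← Complex.coe_smul, map_smul]
    rfl
  have hmem : ∀ k : PiLp 2 (fun _ : ι => H), (∀ b, (⟪k, f b⟫_ℂ).re = 0) →
      (⟪k, WithLp.toLp 2 (fun i => T (h i))⟫_ℂ).re = 0 := by
    intro k hk
    have h1 : ∀ a : A, IsSelfAdjoint a →
        ∑ i, ⟪k i, σ a (h i)⟫_ℂ + ∑ i, ⟪h i, σ a (k i)⟫_ℂ = 0 := by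
      intro a ha
      have h2 := hk ⟨a, ha⟩
      rw [PiLp.inner_apply] at h2
      have h3 : ∑ i, ⟪h i, σ a (k i)⟫_ℂ = starRingEnd ℂ (∑ i, ⟪k i, σ a (h i)⟫_ℂ) := by
        rw [map_sum]
        refine Finset.sum_congr rfl fun i _ => ?_
        rw [inner_conj_symm, ← ContinuousLinearMap.adjoint_inner_right,
          ← ContinuousLinearMap.star_eq_adjoint, ← map_star, ha.star_eq]
      rw [h3, Complex.add_conj]
      have h4 : (∑ i, ⟪k i, σ a (h i)⟫_ℂ).re = 0 := h2
      rw [h4]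
      simp
    have h2 : ∀ a : A, ∑ i, ⟪k i, σ a (h i)⟫_ℂ + ∑ i, ⟪h i, σ a (k i)⟫_ℂ = 0 := by
      intro a
      have e1 := h1 _ (realPart a).2
      have e2 := h1 _ (imaginaryPart a).2
      have e3 : ∀ (x y : ι → H), ∑ i, ⟪x i, σ a (y i)⟫_ℂ = ∑ i, ⟪x i, σ (realPart a) (y i)⟫_ℂ +
          Complex.I * ∑ i, ⟪x i, σ (imaginaryPart a) (y i)⟫_ℂ := by
        intro x y
        rw [Finset.mul_sum, ← Finset.sum_add_distrib]
        refine Finset.sum_congr rfl fun i _ => ?_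
        conv_lhs => rw [← realPart_add_I_smul_imaginaryPart a]
        rw [map_add, map_smul, add_apply, smul_apply, inner_add_right, inner_smul_right]
      rw [e3, e3]
      linear_combination e1 + Complex.I * e2
    have h3 := sum_inner_eq_zero_of_mem_bicommutant σ hT (ι := ι ⊕ ι) (Sum.elim k h) (Sum.elim h k)
      fun a => by simpa using h2 a
    have h4 : ∑ i, ⟪h i, T (k i)⟫_ℂ = starRingEnd ℂ (∑ i, ⟪k i, T (h i)⟫_ℂ) := by
      rw [map_sum]
      refine Finset.sum_congr rfl fun i _ => ?_
      rw [inner_conj_symm, ← ContinuousLinearMap.adjoint_inner_right,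
          ← ContinuousLinearMap.star_eq_adjoint, hTs.star_eq]
    simp only [Fintype.sum_sum_type, Sum.elim_inl, Sum.elim_inr] at h3
    rw [h4, Complex.add_conj] at h3
    rw [PiLp.inner_apply]
    change (∑ i, ⟪k i, T (h i)⟫_ℂ).re = 0
    have h5 : 2 * (∑ i, ⟪k i, T (h i)⟫_ℂ).re = 0 := by exact_mod_cast h3
    linarith
  obtain ⟨b, hb⟩ := exists_norm_sub_lt_of_orthogonal f hf _ hmem hε
  refine ⟨b, b.2, fun i => ?_⟩
  exact (PiLp.norm_apply_le (p := 2) (f b - WithLp.toLp 2 fun i => T (h i)) i).trans_lt hb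

theorem exists_resolvent {C : Type*} [CStarAlgebra C] {b : C} (hb : IsSelfAdjoint b) :
    ∃ c, c * (Complex.I • 1 - b) = 1 ∧ (Complex.I • 1 - b) * c = 1 := by
  have h : Complex.I ∉ spectrum ℂ b := fun hI => by
    have := hb.im_eq_zero_of_mem_spectrum hI
    simp at this
  obtain ⟨u, hu⟩ := spectrum.notMem_iff.mp h
  rw [Algebra.algebraMap_eq_smul_one] at hu
  exact ⟨↑u⁻¹, by rw [← hu, Units.inv_mul], by rw [← hu, Units.mul_inv]⟩

theorem norm_resolvent_le {b c : N} (hb : IsSelfAdjoint b)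
    (hc : (Complex.I • 1 - b) * c = 1) : ‖c‖ ≤ 1 := by
  change ‖(c : G →L[ℂ] G)‖ ≤ 1
  refine ContinuousLinearMap.opNorm_le_bound _ zero_le_one fun g => ?_
  set w := (c : G →L[ℂ] G) g with hw
  have h1 : Complex.I • w - (b : G →L[ℂ] G) w = g := by
    have : ((Complex.I • 1 - b) * c : N).1 g = (1 : N).1 g := by rw [hc]
    exact this
  have hbs : ContinuousLinearMap.adjoint (b : G →L[ℂ] G) = b := congrArg Subtype.val hb.star_eq
  have h2 : (⟪w, (b : G →L[ℂ] G) w⟫_ℂ).im = 0 := by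
    rw [← Complex.conj_eq_iff_im, inner_conj_symm, ← ContinuousLinearMap.adjoint_inner_right, hbs]
  have h3 : ‖w‖ ^ 2 = (⟪w, g⟫_ℂ).im := by
    rw [← h1, inner_sub_right, inner_smul_right, Complex.sub_im, h2, inner_self_eq_norm_sq_to_K]
    rw [Complex.mul_im]
    change ‖w‖ ^ 2 = Complex.I.re * ((‖w‖ : ℂ) ^ 2).im + Complex.I.im * ((‖w‖ : ℂ) ^ 2).re - 0
    rw [← Complex.ofReal_pow, Complex.ofReal_re, Complex.ofReal_im]
    simp
  have h4 : ‖w‖ ^ 2 ≤ ‖w‖ * ‖g‖ :=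
    h3.le.trans ((le_abs_self _).trans ((Complex.abs_im_le_norm _).trans (norm_inner_le_norm _ _)))
  rw [one_mul]
  rcases eq_or_lt_of_le (norm_nonneg w) with h0 | h0
  · rw [← h0]; exact norm_nonneg g
  · rw [sq] at h4
    exact le_of_mul_le_mul_left h4 h0

theorem nonneg_of_map_nonneg {A C : Type*} [CStarAlgebra A] [PartialOrder A] [StarOrderedRing A]
    [CStarAlgebra C] [PartialOrder C] [StarOrderedRing C] (σ : A →⋆ₐ[ℂ] C)
    (hσ : Function.Injective σ) {a : A} (ha : IsSelfAdjoint a) (h : 0 ≤ σ a) : 0 ≤ a := by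
  obtain ⟨c, d, hcd, hd⟩ := exists_negPart a ha
  refine hd (hσ ?_)
  have h1 : 0 ≤ σ (star c * a * c) := by
    rw [map_mul, map_mul, map_star]
    exact star_left_conjugate_nonneg h _
  rw [hcd, map_neg, map_mul, map_star, neg_nonneg] at h1
  rw [map_zero]
  exact CStarRing.star_mul_self_eq_zero_iff _ |>.mp (le_antisymm h1 (star_mul_self_nonneg _))

/-- An injective `⋆`-homomorphism reflects left invertibility: `x σ(a) = 1` bounds `a⋆ a` from
below. -/
theorem exists_left_inverse {A C : Type*} [CStarAlgebra A]
    [CStarAlgebra C] (σ : A →⋆ₐ[ℂ] C)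
    (hσ : Function.Injective σ) {a : A} {x : C} (hx : x * σ a = 1) : ∃ u, u * a = 1 := by
  let _ := CStarAlgebra.spectralOrder A
  let _ := CStarAlgebra.spectralOrderedRing A
  let _ := CStarAlgebra.spectralOrder C
  let _ := CStarAlgebra.spectralOrderedRing C
  -- `1 = σ(a)⋆ (x⋆ x) σ(a) ≤ ‖x‖² σ(a⋆ a)`
  have h1 : 0 ≤ σ (((‖star x * x‖ + 1 : ℝ) : ℂ) • (star a * a) - 1) := by
    have h2 : star x * x ≤ algebraMap ℝ C (‖star x * x‖ + 1) :=
      (IsSelfAdjoint.star_mul_self x).le_algebraMap_norm_self.trans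
        (algebraMap_mono C (by linarith))
    have h3 := star_left_conjugate_le_conjugate h2 (σ a)
    have h4 : star (σ a) * (star x * x) * σ a = 1 := by
      rw [mul_assoc, mul_assoc, hx, mul_one, ← star_mul, hx, star_one]
    rw [h4, Algebra.algebraMap_eq_smul_one] at h3
    rw [map_sub, map_smul, map_mul, map_star, map_one, sub_nonneg, Complex.coe_smul]
    simpa using h3
  have h2 : 0 ≤ ((‖star x * x‖ + 1 : ℝ) : ℂ) • (star a * a) - 1 := by
    refine nonneg_of_map_nonneg σ hσ ?_ h1
    refine IsSelfAdjoint.sub (IsSelfAdjoint.smul ?_ (IsSelfAdjoint.star_mul_self a)) (.one _)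
    exact Complex.conj_ofReal _
  have h3 : IsStrictlyPositive (((‖star x * x‖ + 1 : ℝ) : ℂ) • (star a * a)) := by
    have := IsStrictlyPositive.nonneg_add h2 (isStrictlyPositive_one (A := A))
    rwa [sub_add_cancel] at this
  obtain ⟨u, hu⟩ := h3.isUnit
  refine ⟨↑u⁻¹ * (((‖star x * x‖ + 1 : ℝ) : ℂ) • star a), ?_⟩
  rw [mul_assoc, smul_mul_assoc, ← hu, Units.inv_mul]

/-- Self-adjoint operators in the double commutant of the range of a faithful normal representation
lie in the range. The resolvents `(i - σ(b))⁻¹` approximate `(i - T)⁻¹` within the unit ball, which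
is weakly compact. -/
theorem exists_eq_of_isSelfAdjoint {σ : N →⋆ₐ[ℂ] (H →L[ℂ] H)} (hn : IsNormalMap N σ)
    (hσ : Function.Injective σ) {T : H →L[ℂ] H} (hT : T ∈ (commutantOf σ).commutant)
    (hTs : IsSelfAdjoint T) : ∃ a, σ a = T := by
  obtain ⟨ρ, hρ1, hρ2⟩ := exists_resolvent hTs
  have key : ∀ p : Finset H × ℕ, ∃ c : N, ‖c‖ ≤ 1 ∧
      ∀ h ∈ p.1, ‖σ c h - ρ h‖ ≤ 1 / ((p.2 : ℝ) + 1) := by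
    rintro ⟨F, n⟩
    obtain ⟨b, hb, hbT⟩ := exists_selfAdjoint_approx σ hT hTs (fun i : F => ρ i)
      (Nat.one_div_pos_of_nat (n := n) (α := ℝ))
    obtain ⟨c, hc1, hc2⟩ := exists_resolvent hb
    have hcn := norm_resolvent_le hb hc2
    refine ⟨c, hcn, fun h hh => ?_⟩
    have e1 : σ c * (Complex.I • 1 - σ b) = 1 := by
      rw [← map_one σ, ← map_smul, ← map_sub, ← map_mul, hc1]
    have e2 : σ c - ρ = σ c * (σ b - T) * ρ := by
      calc σ c - ρ = σ c * ((Complex.I • 1 - T) * ρ) - (σ c * (Complex.I • 1 - σ b)) * ρ := by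
            rw [hρ2, e1, mul_one, one_mul]
        _ = _ := by noncomm_ring
    have e3 : σ c h - ρ h = σ c ((σ b - T) (ρ h)) := by
      rw [← sub_apply, e2]; rfl
    rw [e3]
    calc _ ≤ ‖σ c‖ * ‖(σ b - T) (ρ h)‖ := ContinuousLinearMap.le_opNorm _ _
      _ ≤ 1 * (1 / ((n : ℝ) + 1)) := by
          gcongr
          · exact (NonUnitalStarAlgHom.norm_apply_le σ c).trans hcn
          · exact (hbT ⟨h, hh⟩).le
      _ = _ := one_mul _
  choose c hc1 hc2 using key
  classical
  have hne : (atTop : Filter (Finset H × ℕ)).NeBot := inferInstance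
  have hlim : ∀ h, Tendsto (fun p => σ (c p) h) atTop (𝓝 (ρ h)) := by
    intro h
    rw [tendsto_iff_norm_sub_tendsto_zero]
    have h1 : Tendsto (fun p : Finset H × ℕ => 1 / ((p.2 : ℝ) + 1)) atTop (𝓝 0) := by
      have : Tendsto (fun p : Finset H × ℕ => p.2) atTop atTop := by
        rw [← prod_atTop_atTop_eq]; exact tendsto_snd
      exact tendsto_one_div_add_atTop_nhds_zero_nat.comp this
    refine squeeze_zero' (Eventually.of_forall fun _ => norm_nonneg _) ?_ h1
    filter_upwards [eventually_ge_atTop (({h} : Finset H), 0)] with p hp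
    exact hc2 p h (hp.1 (Finset.mem_singleton_self h))
  let l : Ultrafilter N := @Ultrafilter.of _ (map c atTop) (hne.map c)
  have hl : (l : Filter N) ≤ map c atTop := @Ultrafilter.of_le _ _ (hne.map c)
  have hl1 : ∀ᶠ a in (l : Filter N), ‖a‖ ≤ 1 := hl (eventually_map.mpr (Eventually.of_forall hc1))
  obtain ⟨a, ha⟩ := exists_weak_limit l hl1
  have haρ : σ a = ρ := by
    ext k
    refine ext_inner_left ℂ fun h => ?_
    refine tendsto_nhds_unique (isNormalFunctional_iff_tendsto.mp (hn h k) l 1 a hl1 ha) ?_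
    have h1 : Tendsto (fun a => ⟪h, σ a k⟫_ℂ) (map c atTop) (𝓝 ⟪h, ρ k⟫_ℂ) := by
      rw [tendsto_map'_iff]
      exact (tendsto_const_nhds (x := h)).inner (hlim k)
    exact h1.mono_left hl
  obtain ⟨u, hu⟩ := exists_left_inverse σ hσ (a := a) (x := Complex.I • 1 - T) (by rw [haρ, hρ2])
  refine ⟨Complex.I • 1 - u, ?_⟩
  have hσu : σ u = Complex.I • 1 - T := by
    calc σ u = σ u * (ρ * (Complex.I • 1 - T)) := by rw [hρ1, mul_one]
      _ = σ (u * a) * (Complex.I • 1 - T) := by rw [map_mul, haρ, mul_assoc]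
      _ = _ := by rw [hu, map_one, one_mul]
  rw [map_sub, map_smul, map_one, hσu, sub_sub_cancel]

/-- The range of a faithful normal representation is a von Neumann algebra. -/
theorem exists_eq_of_mem_bicommutant {σ : N →⋆ₐ[ℂ] (H →L[ℂ] H)} (hn : IsNormalMap N σ)
    (hσ : Function.Injective σ) {T : H →L[ℂ] H} (hT : T ∈ (commutantOf σ).commutant) :
    ∃ a, σ a = T := by
  have hTs : star T ∈ (commutantOf σ).commutant := star_mem hT
  obtain ⟨a, ha⟩ := exists_eq_of_isSelfAdjoint hn hσ (T := T + star T) (add_mem hT hTs)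
    (IsSelfAdjoint.add_star_self T)
  obtain ⟨b, hb⟩ := exists_eq_of_isSelfAdjoint hn hσ (T := Complex.I • (T - star T))
    (SMulMemClass.smul_mem _ (sub_mem hT hTs)) (by
      rw [IsSelfAdjoint, star_smul, star_sub, star_star]
      simp [smul_sub, neg_add_eq_sub])
  refine ⟨(1 / 2 : ℂ) • (a - Complex.I • b), ?_⟩
  rw [map_smul, map_sub, map_smul, ha, hb, smul_smul, Complex.I_mul_I]
  module

end Range

/-! ### Total families in tensor products over normal representations -/

section Density

variable {G : Type*} [NormedAddCommGroup G] [InnerProductSpace ℂ G] [CompleteSpace G]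
  {N : VonNeumannAlgebra G}
variable {H : Type*} [NormedAddCommGroup H] [InnerProductSpace ℂ H] [CompleteSpace H]

theorem adjoint_intertwining {B K L : Type*} [CStarAlgebra B]
    [NormedAddCommGroup K] [InnerProductSpace ℂ K]
    [CompleteSpace K] [NormedAddCommGroup L] [InnerProductSpace ℂ L] [CompleteSpace L]
    {π : B →⋆ₐ[ℂ] (K →L[ℂ] K)} {π' : B →⋆ₐ[ℂ] (L →L[ℂ] L)} {T : K →L[ℂ] L}
    (hT : ∀ b v, T (π b v) = π' b (T v)) (b : B) (w : L) :
    ContinuousLinearMap.adjoint T (π' b w) = π b (ContinuousLinearMap.adjoint T w) := by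
  refine ext_inner_left ℂ fun v => ?_
  have h1 : π' b = ContinuousLinearMap.adjoint (π' (star b)) := by
    rw [← ContinuousLinearMap.star_eq_adjoint, ← map_star, star_star]
  have h2 : π b = ContinuousLinearMap.adjoint (π (star b)) := by
    rw [← ContinuousLinearMap.star_eq_adjoint, ← map_star, star_star]
  rw [ContinuousLinearMap.adjoint_inner_right, h1, ContinuousLinearMap.adjoint_inner_right, h2,
    ContinuousLinearMap.adjoint_inner_right, ContinuousLinearMap.adjoint_inner_right, hT]

theorem CPForm.adjoint_map_tmul {A B I : Type*} [CStarAlgebra A] [CStarAlgebra B] [PartialOrder B]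
    [StarOrderedRing B] (k : CPForm A B I) {K L : Type*}
    [NormedAddCommGroup K] [InnerProductSpace ℂ K]
    [CompleteSpace K] [NormedAddCommGroup L] [InnerProductSpace ℂ L] [CompleteSpace L]
    (π : B →⋆ₐ[ℂ] (K →L[ℂ] K)) (π' : B →⋆ₐ[ℂ] (L →L[ℂ] L)) (T : K →L[ℂ] L)
    (hT : ∀ b v, T (π b v) = π' b (T v)) (x : I) (w : L) :
    ContinuousLinearMap.adjoint (k.map π π' T hT) (k.tmul π' x w) =
      k.tmul π x (ContinuousLinearMap.adjoint T w) := by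
  refine k.eq_of_inner_tmul π fun y v => ?_
  rw [ContinuousLinearMap.adjoint_inner_right, k.map_tmul, k.inner_tmul, k.inner_tmul,
    ← adjoint_intertwining hT, ContinuousLinearMap.adjoint_inner_right]

theorem apply_mem_of_mem_commutantOf {A : Type*} [CStarAlgebra A] {σ : A →⋆ₐ[ℂ] (H →L[ℂ] H)}
    (b : commutantOf σ) (a : A) (v : H) :
    incl (commutantOf σ) b (σ a v) = σ a (incl (commutantOf σ) b v) :=
  (DFunLike.congr_fun (mem_commutantOf.mp b.2 a) v).symm

/-- The representation `b ↦ I ⊗ b` of `σ(A)'` on `E ⊗_σ H`. -/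
abbrev idTensorRep {A : Type*} [CStarAlgebra A] [PartialOrder A] [StarOrderedRing A]
    (E : CStarCorrespondence A) (σ : A →⋆ₐ[ℂ] (H →L[ℂ] H)) :
    commutantOf σ →⋆ₐ[ℂ] (E.cpForm.Tensor σ →L[ℂ] E.cpForm.Tensor σ) :=
  E.cpForm.rightRep σ (incl (commutantOf σ)) apply_mem_of_mem_commutantOf

theorem starProjection_apply_comm {K : Type*} [NormedAddCommGroup K] [InnerProductSpace ℂ K]
    [CompleteSpace K] {V : Submodule ℂ K} [V.HasOrthogonalProjection] {T : K →L[ℂ] K}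
    (h : ∀ x ∈ V, T x ∈ V) (h' : ∀ x ∈ V, ContinuousLinearMap.adjoint T x ∈ V) (x : K) :
    V.starProjection (T x) = T (V.starProjection x) := by
  refine Submodule.eq_starProjection_of_mem_of_inner_eq_zero
    (h _ (Submodule.starProjection_apply_mem V x)) fun w hw => ?_
  rw [← map_sub, ← ContinuousLinearMap.adjoint_inner_right]
  exact Submodule.starProjection_inner_eq_zero x _ (h' w hw)

/-- The operator `T ⊕ S` on the Hilbert sum `G ⊕ H`. -/
def sumOp (T : G →L[ℂ] G) (S : H →L[ℂ] H) : WithLp 2 (G × H) →L[ℂ] WithLp 2 (G × H) :=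
  (WithLp.prodContinuousLinearEquiv 2 ℂ G H).symm ∘L
    (T.prodMap S) ∘L (WithLp.prodContinuousLinearEquiv 2 ℂ G H)

omit [CompleteSpace G] [CompleteSpace H] in
theorem sumOp_ext {T : G →L[ℂ] G} {S : H →L[ℂ] H} {Q : WithLp 2 (G × H) →L[ℂ] WithLp 2 (G × H)}
    (h₁ : ∀ x, T x.fst = (Q x).fst) (h₂ : ∀ x, S x.snd = (Q x).snd) : sumOp T S = Q :=
  ContinuousLinearMap.ext fun x => WithLp.ofLp_injective 2 (Prod.ext (h₁ x) (h₂ x))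

theorem star_sumOp (T : G →L[ℂ] G) (S : H →L[ℂ] H) : sumOp (star T) (star S) = star (sumOp T S) := by
  refine ContinuousLinearMap.ext fun x => ext_inner_left ℂ fun y => ?_
  rw [ContinuousLinearMap.star_eq_adjoint (sumOp T S), ContinuousLinearMap.adjoint_inner_right]
  change ⟪y.fst, star T x.fst⟫_ℂ + ⟪y.snd, star S x.snd⟫_ℂ =
    ⟪T y.fst, x.fst⟫_ℂ + ⟪S y.snd, x.snd⟫_ℂ
  rw [ContinuousLinearMap.star_eq_adjoint, ContinuousLinearMap.star_eq_adjoint,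
    ContinuousLinearMap.adjoint_inner_right, ContinuousLinearMap.adjoint_inner_right]

/-- The direct sum of the identity representation of `N` and of `σ`. -/
def sumRep (σ : N →⋆ₐ[ℂ] (H →L[ℂ] H)) :
    N →⋆ₐ[ℂ] (WithLp 2 (G × H) →L[ℂ] WithLp 2 (G × H)) where
  toFun a := sumOp (incl N a) (σ a)
  map_one' := sumOp_ext (fun _ => by rw [map_one]; rfl) fun _ => by rw [map_one]; rfl
  map_mul' a b := sumOp_ext (fun _ => by rw [map_mul]; rfl) fun _ => by rw [map_mul]; rfl
  map_zero' := sumOp_ext (fun _ => by rw [map_zero]; rfl) fun _ => by rw [map_zero]; rfl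
  map_add' a b := sumOp_ext (fun _ => by rw [map_add]; rfl) fun _ => by rw [map_add]; rfl
  commutes' c := sumOp_ext (fun _ => by rw [AlgHomClass.commutes]; rfl)
    fun _ => by rw [AlgHomClass.commutes]; rfl
  map_star' a := by rw [map_star, map_star, star_sumOp]

/-- The inclusion of the first summand of a Hilbert sum. -/
def inlL (G H : Type*) [NormedAddCommGroup G] [InnerProductSpace ℂ G]
    [NormedAddCommGroup H] [InnerProductSpace ℂ H] : G →L[ℂ] WithLp 2 (G × H) :=
  (WithLp.prodContinuousLinearEquiv 2 ℂ G H).symm ∘L ContinuousLinearMap.inl ℂ G H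

/-- The inclusion of the second summand of a Hilbert sum. -/
def inrL (G H : Type*) [NormedAddCommGroup G] [InnerProductSpace ℂ G]
    [NormedAddCommGroup H] [InnerProductSpace ℂ H] : H →L[ℂ] WithLp 2 (G × H) :=
  (WithLp.prodContinuousLinearEquiv 2 ℂ G H).symm ∘L ContinuousLinearMap.inr ℂ G H

theorem sumRep_inlL (σ : N →⋆ₐ[ℂ] (H →L[ℂ] H)) (a : N) (g : G) :
    inlL G H (incl N a g) = sumRep σ a (inlL G H g) := by
  refine WithLp.ofLp_injective 2 (Prod.ext rfl ?_)
  exact (map_zero (σ a)).symm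

theorem sumRep_inrL (σ : N →⋆ₐ[ℂ] (H →L[ℂ] H)) (a : N) (h : H) :
    inrL G H (σ a h) = sumRep σ a (inrL G H h) := by
  refine WithLp.ofLp_injective 2 (Prod.ext ?_ rfl)
  exact (map_zero (incl N a)).symm

theorem isNormalMap_incl : IsNormalMap N (incl N) := fun g g' =>
  isNormalFunctional_iff_tendsto.mpr fun _ _ _ _ h => h g g'

theorem isNormalMap_sumRep {σ : N →⋆ₐ[ℂ] (H →L[ℂ] H)} (hσ : IsNormalMap N σ) :
    IsNormalMap N (sumRep σ) := fun x y =>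
  isNormalFunctional_iff_tendsto.mpr fun l r a₀ hl h =>
    (h x.fst y.fst).add (isNormalFunctional_iff_tendsto.mp (hσ x.snd y.snd) l r a₀ hl h)

theorem sumRep_injective (σ : N →⋆ₐ[ℂ] (H →L[ℂ] H)) : Function.Injective (sumRep σ) := by
  intro a b hab
  refine Subtype.ext (ContinuousLinearMap.ext fun g => ?_)
  have := DFunLike.congr_fun hab (inlL G H g)
  rw [← sumRep_inlL, ← sumRep_inlL] at this
  exact congrArg (fun x : WithLp 2 (G × H) => x.fst) this

section Abstract

variable {K : Type*} [NormedAddCommGroup K] [InnerProductSpace ℂ K] [CompleteSpace K]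

/-- The compression of an operator in the commutant of `I ⊗ π(N)'` by elementary tensors belongs to
`π(N)'' = π(N)`. -/
theorem exists_eq_compression (F : CStarCorrespondence N) {π : N →⋆ₐ[ℂ] (K →L[ℂ] K)}
    (hπ : IsNormalMap N π) (hπi : Function.Injective π)
    {P : F.cpForm.Tensor π →L[ℂ] F.cpForm.Tensor π}
    (hP : ∀ (c : commutantOf π) ξ, P (idTensorRep F π c ξ) = idTensorRep F π c (P ξ)) (z : F) :
    ∃ a, ∀ v w, ⟪F.cpForm.tmul π z w, P (F.cpForm.tmul π z v)⟫_ℂ = ⟪w, π a v⟫_ℂ := by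
  set C := ContinuousLinearMap.adjoint (F.cpForm.tmul π z) ∘L P ∘L F.cpForm.tmul π z with hC
  have hCi : ∀ v w, ⟪w, C v⟫_ℂ = ⟪F.cpForm.tmul π z w, P (F.cpForm.tmul π z v)⟫_ℂ := fun v w => by
    rw [hC, ContinuousLinearMap.comp_apply, ContinuousLinearMap.adjoint_inner_right]
    rfl
  have hCmem : C ∈ (commutantOf π).commutant := by
    rw [mem_commutant_iff]
    intro c hc
    have h1 : ∀ (c : commutantOf π) u, F.cpForm.tmul π z (incl _ c u) =
        idTensorRep F π c (F.cpForm.tmul π z u) := fun c u =>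
      (CPForm.rightRep_tmul F.cpForm π _ _ c z u).symm
    refine ContinuousLinearMap.ext fun v => ext_inner_left ℂ fun w => ?_
    change ⟪w, c (C v)⟫_ℂ = ⟪w, C (c v)⟫_ℂ
    have h2 : F.cpForm.tmul π z (c v) = _ := h1 ⟨c, hc⟩ v
    have h3 : F.cpForm.tmul π z (ContinuousLinearMap.adjoint c w) = _ := h1 (star ⟨c, hc⟩) w
    rw [← ContinuousLinearMap.adjoint_inner_left, hCi, hCi, h2, h3, hP, map_star,
      ContinuousLinearMap.star_eq_adjoint, ContinuousLinearMap.adjoint_inner_left]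
  obtain ⟨a, ha⟩ := exists_eq_of_mem_bicommutant hπ hπi hCmem
  exact ⟨a, fun v w => by rw [ha, hCi]⟩

/-- Let `π` be a faithful normal representation that contains the identity representation of `N`.
For the projection `P` onto the vectors of `F ⊗ K` orthogonal to the given elements and for `z ∈ F`,
the operator `v ↦ z⋆ P (z ⊗ v)` lies in the von Neumann algebra `π(N)` and vanishes on `G`, so it
is zero. -/
theorem isTotal_tmul_of_intertwining (F : CStarCorrespondence N) {π : N →⋆ₐ[ℂ] (K →L[ℂ] K)}
    (hπ : IsNormalMap N π) (hπi : Function.Injective π) (j : G →L[ℂ] K)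
    (hj : ∀ a g, j (incl N a g) = π a (j g)) (hji : Function.Injective j) {ι : Type*} (d : ι → F)
    (hd : IsTotal fun p : ι × G => F.cpForm.tmul (incl N) (d p.1) p.2) :
    IsTotal fun p : ι × K => F.cpForm.tmul π (d p.1) p.2 := by
  obtain ⟨U, hUc, hU⟩ : ∃ U : Submodule ℂ (F.cpForm.Tensor π),
      IsClosed (U : Set (F.cpForm.Tensor π)) ∧
      ∀ ξ, ξ ∈ U ↔ ∀ i v, ⟪F.cpForm.tmul π (d i) v, ξ⟫_ℂ = 0 := by
    refine ⟨(Submodule.span ℂ (Set.range fun p : ι × K =>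
      F.cpForm.tmul π (d p.1) p.2))ᗮ, Submodule.isClosed_orthogonal _, fun ξ => ?_⟩
    rw [Submodule.mem_orthogonal]
    refine ⟨fun h i v => h _ (Submodule.subset_span ⟨(i, v), rfl⟩), fun h u hu => ?_⟩
    induction hu using Submodule.span_induction with
    | mem _ hu => obtain ⟨p, rfl⟩ := hu; exact h p.1 p.2
    | zero => exact inner_zero_left _
    | add _ _ _ _ h1 h2 => rw [inner_add_left, h1, h2, add_zero]
    | smul c _ _ h1 => rw [inner_smul_left, h1, mul_zero]
  have hUcs : CompleteSpace U := hUc.completeSpace_coe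
  have hUp : U.HasOrthogonalProjection := inferInstance
  have hinv : ∀ c : commutantOf π, ∀ ξ ∈ U, idTensorRep F π c ξ ∈ U := by
    intro c ξ hξ
    rw [hU] at hξ ⊢
    intro i v
    have h1 : ⟪F.cpForm.tmul π (d i) v, idTensorRep F π c ξ⟫_ℂ =
        ⟪idTensorRep F π (star c) (F.cpForm.tmul π (d i) v), ξ⟫_ℂ := by
      rw [map_star, ContinuousLinearMap.star_eq_adjoint, ContinuousLinearMap.adjoint_inner_left]
    rw [h1, CPForm.rightRep_tmul]
    exact hξ i _
  have hG : ∀ z g, U.starProjection (F.cpForm.tmul π z (j g)) = 0 := by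
    intro z g
    refine Submodule.eq_starProjection_of_mem_of_inner_eq_zero (zero_mem U) fun u hu => ?_
    have e : ContinuousLinearMap.adjoint (F.cpForm.map (incl N) π j hj) u = 0 := by
      refine hd _ fun p => ?_
      rw [ContinuousLinearMap.adjoint_inner_right, CPForm.map_tmul]
      exact (hU u).mp hu _ _
    rw [sub_zero, ← F.cpForm.map_tmul (incl N) π j hj,
      ← ContinuousLinearMap.adjoint_inner_right, e, inner_zero_right]
  have hP : ∀ z v, U.starProjection (F.cpForm.tmul π z v) = 0 := by
    intro z v
    obtain ⟨a, ha⟩ := exists_eq_compression F hπ hπi (P := U.starProjection)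
      (fun c => starProjection_apply_comm (hinv c) (by
        rw [← ContinuousLinearMap.star_eq_adjoint, ← map_star]
        exact hinv (star c))) z
    have ha0 : a = 0 := by
      refine Subtype.ext (ContinuousLinearMap.ext fun g => hji ?_)
      refine ext_inner_left ℂ fun w => ?_
      have h1 := ha (j g) w
      rw [hG, inner_zero_right, ← hj] at h1
      change ⟪w, j (incl N a g)⟫_ℂ = ⟪w, j 0⟫_ℂ
      rw [← h1, map_zero, inner_zero_right]
    have h1 := ha v v
    rw [ha0, map_zero, zero_apply, inner_zero_right] at h1
    have h3 := Submodule.starProjection_inner_eq_zero (K := U) (F.cpForm.tmul π z v)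
      (U.starProjection (F.cpForm.tmul π z v)) (Submodule.starProjection_apply_mem U _)
    rw [inner_sub_left, h1, zero_sub, neg_eq_zero] at h3
    exact inner_self_eq_zero.mp h3
  intro ξ hξ
  have hξU : ξ ∈ U := (hU ξ).mpr fun i v => hξ (i, v)
  refine F.cpForm.isTotal_tmul π ξ fun p => ?_
  have h3 := Submodule.starProjection_inner_eq_zero (K := U) (F.cpForm.tmul π p.1 p.2) ξ hξU
  rwa [hP, sub_zero] at h3

/-- Totality passes to the tensor product over a subrepresentation. -/
theorem IsTotal.tmul_of_isometry (F : CStarCorrespondence N) {π : N →⋆ₐ[ℂ] (K →L[ℂ] K)}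
    {σ : N →⋆ₐ[ℂ] (H →L[ℂ] H)} (j : H →L[ℂ] K)
    (hj : ∀ a h, j (σ a h) = π a (j h)) (hji : ContinuousLinearMap.adjoint j ∘L j = 1)
    {ι : Type*} {d : ι → F} (hd : IsTotal fun p : ι × K => F.cpForm.tmul π (d p.1) p.2) :
    IsTotal fun p : ι × H => F.cpForm.tmul σ (d p.1) p.2 := by
  intro ξ hξ
  have h1 : F.cpForm.map σ π j hj ξ = 0 := hd _ fun p => by
    rw [← ContinuousLinearMap.adjoint_inner_left, CPForm.adjoint_map_tmul]
    exact hξ (p.1, _)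
  have hone : ∀ (a : N) (h : H), (1 : H →L[ℂ] H) (σ a h) = σ a ((1 : H →L[ℂ] H) h) :=
    fun _ _ => rfl
  have h2 := F.cpForm.inner_map_map σ π j j hj hj 1 hone hji ξ ξ
  have h3 : F.cpForm.map σ σ 1 hone = 1 := F.cpForm.ext_tmul σ fun x v => by
    rw [CPForm.map_tmul]; rfl
  rw [h1, inner_zero_left, h3] at h2
  exact inner_self_eq_zero.mp h2.symm

end Abstract

theorem adjoint_inrL_comp : ContinuousLinearMap.adjoint (inrL G H) ∘L inrL G H = 1 := by
  refine ContinuousLinearMap.ext fun h => ext_inner_left ℂ fun h' => ?_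
  rw [ContinuousLinearMap.comp_apply, ContinuousLinearMap.adjoint_inner_right]
  change ⟪(0 : G), (0 : G)⟫_ℂ + ⟪h', h⟫_ℂ = ⟪h', h⟫_ℂ
  rw [inner_zero_left, zero_add]

/-- Elements of a correspondence over `N ⊆ B(G)` that are total after tensoring with `G` are total
after tensoring with an arbitrary normal representation. -/
theorem isTotal_tmul_of_isNormalMap (F : CStarCorrespondence N) {σ : N →⋆ₐ[ℂ] (H →L[ℂ] H)}
    (hσ : IsNormalMap N σ) {ι : Type*} (d : ι → F)
    (hd : IsTotal fun p : ι × G => F.cpForm.tmul (incl N) (d p.1) p.2) :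
    IsTotal fun p : ι × H => F.cpForm.tmul σ (d p.1) p.2 :=
  (isTotal_tmul_of_intertwining F (isNormalMap_sumRep hσ) (sumRep_injective σ) (inlL G H)
    (sumRep_inlL σ) (fun _ _ h => congrArg (fun x : WithLp 2 (G × H) => x.fst) h) d hd
    ).tmul_of_isometry F (inrL G H) (sumRep_inrL σ) adjoint_inrL_comp

variable (X Y : CStarCorrespondence N)

theorem inner_tmul_tmul {A : Type*} [CStarAlgebra A] [PartialOrder A] [StarOrderedRing A]
    (X Y : CStarCorrespondence A) (σ : A →⋆ₐ[ℂ] (H →L[ℂ] H)) (x x' : X) (y y' : Y) (h h' : H) :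
    ⟪X.cpForm.tmul (Y.cpForm.leftRep σ) x (Y.cpForm.tmul σ y h),
      X.cpForm.tmul (Y.cpForm.leftRep σ) x' (Y.cpForm.tmul σ y' h')⟫_ℂ =
      ⟪h, σ (Y.inner y (Y.left (X.inner x x') y')) h'⟫_ℂ := by
  rw [CPForm.inner_tmul, CPForm.leftRep_tmul, CPForm.inner_tmul]
  rfl

variable {X Y}

/-- An element of the tensor product as an operator `G → X ⊗ Y ⊗ G`. -/
def tensorOp (z : tensor X Y) : G →L[ℂ] space₂ X Y :=
  (show intertwiners N.commutant (commutantAction₂ X Y) from z).1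

theorem tensorOp_injective {z z' : tensor X Y} (h : tensorOp z = tensorOp z') : z = z' :=
  Subtype.ext h

theorem tensor_inner_apply (z z' : tensor X Y) (g g' : G) :
    ⟪g, incl N ((tensor X Y).inner z z') g'⟫_ℂ = ⟪tensorOp z g, tensorOp z' g'⟫_ℂ := by
  change ⟪g, (ContinuousLinearMap.adjoint (tensorOp z) ∘L tensorOp z') g'⟫_ℂ = _
  rw [ContinuousLinearMap.comp_apply, ContinuousLinearMap.adjoint_inner_right]

theorem tensorOp_elem (x : X) (y : Y) (g : G) : tensorOp (elem x y) g =
    X.cpForm.tmul (Y.cpForm.leftRep (incl N)) x (Y.cpForm.tmul (incl N) y g) := rfl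

theorem inner_elem (x x' : X) (y y' : Y) :
    (tensor X Y).inner (elem x y) (elem x' y') = Y.inner y (Y.left (X.inner x x') y') := by
  refine Subtype.ext (ContinuousLinearMap.ext fun g' => ext_inner_left ℂ fun g => ?_)
  have h := tensor_inner_apply (elem x y) (elem x' y') g g'
  rw [tensorOp_elem, tensorOp_elem, inner_tmul_tmul] at h
  exact h

variable (X Y)

theorem isTotal_elem_apply : IsTotal fun p : (X × Y) × G =>
    X.cpForm.tmul (Y.cpForm.leftRep (incl N)) p.1.1 (Y.cpForm.tmul (incl N) p.1.2 p.2) :=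
  fun ξ h => X.cpForm.isTotal_tmul_of_isTotal _ (Y.cpForm.isTotal_tmul (incl N)) ξ
    fun p => h ((p.1, p.2.1), p.2.2)

theorem tensor_ext {z z' : tensor X Y}
    (h : ∀ x y, (tensor X Y).inner (elem x y) z = (tensor X Y).inner (elem x y) z') : z = z' := by
  refine tensorOp_injective (ContinuousLinearMap.ext fun g =>
    (isTotal_elem_apply X Y).eq_of_inner fun p => ?_)
  have h1 := tensor_inner_apply (elem p.1.1 p.1.2) z p.2 g
  rw [h, tensor_inner_apply] at h1
  exact h1.symm

theorem isTotal_elem_tmul {σ : N →⋆ₐ[ℂ] (H →L[ℂ] H)} (hσ : IsNormalMap N σ) :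
    IsTotal fun p : (X × Y) × H => (tensor X Y).cpForm.tmul σ (elem p.1.1 p.1.2) p.2 := by
  refine isTotal_tmul_of_isNormalMap (tensor X Y) hσ (fun p : X × Y => elem p.1 p.2) ?_
  -- `z ⊗ g ↦ z g` is an isometry that maps the given family onto a total one
  obtain ⟨T, hT, hT'⟩ := exists_isometry_of_gram ((tensor X Y).cpForm.isTotal_tmul (incl N))
    (fun p => tensorOp p.1 p.2) fun p q => by
      rw [CPForm.inner_tmul]
      exact (tensor_inner_apply p.1 q.1 p.2 q.2).symm
  intro ξ h
  have h1 : T ξ = 0 := isTotal_elem_apply X Y _ fun p => by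
    have h2 := hT (elem p.1.1 p.1.2, p.2)
    change ⟪tensorOp (elem p.1.1 p.1.2) p.2, T ξ⟫_ℂ = 0
    rw [← h2, ← ContinuousLinearMap.adjoint_inner_right, ← ContinuousLinearMap.comp_apply, hT']
    exact h p
  have h2 := DFunLike.congr_fun hT' ξ
  rw [ContinuousLinearMap.comp_apply, h1, map_zero] at h2
  exact h2.symm

end Density

/-! ### Positivity of Gram matrices of operators -/

section Gram

variable {H : Type*} [NormedAddCommGroup H] [InnerProductSpace ℂ H] [CompleteSpace H]
variable {K : Type*} [NormedAddCommGroup K] [InnerProductSpace ℂ K] [CompleteSpace K]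

/-- A matrix over a C⋆-algebra is positive if a faithful representation maps it to a sum of Gram
matrices `(T_i⋆ T_j)` of operators. -/
theorem cstarMatrix_nonneg_of_gram {C : Type*} [CStarAlgebra C] [PartialOrder C]
    [StarOrderedRing C] (ρ : C →⋆ₐ[ℂ] (H →L[ℂ] H)) (hρ : Function.Injective ρ) {n : ℕ}
    {κ : Type*} [Fintype κ] (T : κ → Fin n → H →L[ℂ] K) (g : CStarMatrix (Fin n) (Fin n) C)
    (h : ∀ i j, ρ (g i j) = ∑ l, ContinuousLinearMap.adjoint (T l i) ∘L T l j) : 0 ≤ g := by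
  have hg : IsSelfAdjoint g := by
    ext i j
    refine hρ ?_
    change ρ (star (g j i)) = ρ (g i j)
    rw [map_star, h, h, star_sum]
    refine Finset.sum_congr rfl fun l _ => ?_
    rw [ContinuousLinearMap.star_eq_adjoint, ContinuousLinearMap.adjoint_comp,
      ContinuousLinearMap.adjoint_adjoint]
  obtain ⟨c, d, hcd, hd⟩ := exists_negPart g hg
  refine hd ?_
  ext i k
  have h1 : (star c * g * c) k k = -(∑ l, star (d l k) * d l k) := by
    rw [hcd]
    change -((star d * d) k k) = _
    rw [CStarMatrix.mul_apply]
    rfl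
  have h2 : 0 ≤ (star c * g * c) k k := by
    refine nonneg_of_map_nonneg ρ hρ ?_ ?_
    · rw [h1]
      exact (isSelfAdjoint_sum _ fun l _ => IsSelfAdjoint.star_mul_self _).neg
    · have e : ρ ((star c * g * c) k k) = ∑ l, ContinuousLinearMap.adjoint
          (∑ i, T l i ∘L ρ (c i k)) ∘L (∑ i, T l i ∘L ρ (c i k)) := by
        rw [CStarCorrespondence.conj_apply]
        simp only [map_sum, map_mul, h, map_star, ContinuousLinearMap.adjoint_comp,
          ContinuousLinearMap.comp_finsetSum, ContinuousLinearMap.finsetSum_comp,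
          Finset.mul_sum, Finset.sum_mul, ← ContinuousLinearMap.star_eq_adjoint (ρ _)]
        rw [Finset.sum_comm]
        refine Eq.trans (Finset.sum_congr rfl fun i _ => Finset.sum_comm) ?_
        rw [Finset.sum_comm]
        rfl
      rw [e]
      refine Finset.sum_nonneg fun l _ => ?_
      rw [ContinuousLinearMap.nonneg_iff_isPositive]
      exact ContinuousLinearMap.isPositive_adjoint_comp_self _
  have h3 : ∀ l ∈ Finset.univ, 0 ≤ star (d l k) * d l k := fun l _ => star_mul_self_nonneg _
  have h4 : ∑ l, star (d l k) * d l k = 0 := by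
    rw [h1] at h2
    exact le_antisymm (neg_nonneg.mp h2) (Finset.sum_nonneg h3)
  have h5 := (Finset.sum_eq_zero_iff_of_nonneg h3).mp h4 i (Finset.mem_univ i)
  exact CStarRing.star_mul_self_eq_zero_iff _ |>.mp h5

end Gram

/-! ### The cp-semigroup of a representation -/

section Theta

variable {A : Type*} [CStarAlgebra A] [PartialOrder A] [StarOrderedRing A]
  {E : CStarCorrespondence A}
variable {H : Type*} [NormedAddCommGroup H] [InnerProductSpace ℂ H] [CompleteSpace H]
variable {σ : A →⋆ₐ[ℂ] (H →L[ℂ] H)} {T : E →ₗ[ℂ] (H →L[ℂ] H)}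

theorem incl_injective (M : VonNeumannAlgebra H) : Function.Injective (incl M) :=
  Subtype.val_injective

theorem IsCovariant.tilde_leftRep (hT : IsCovariant σ T) (a : A) (t : E.cpForm.Tensor σ) :
    hT.tilde (E.cpForm.leftRep σ a t) = σ a (hT.tilde t) := by
  have : hT.tilde ∘L E.cpForm.leftRep σ a = σ a ∘L hT.tilde :=
    E.cpForm.ext_tmul σ fun x v => by
      simp only [ContinuousLinearMap.comp_apply, CPForm.leftRep_tmul, hT.tilde_tmul]
      change T (E.left a x) v = _
      rw [hT.map_left]
      rfl
  exact DFunLike.congr_fun this t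

theorem IsCovariant.norm_tilde_le (hT : IsCovariant σ T) : ‖hT.tilde‖ ≤ 1 :=
  ContinuousLinearMap.opNorm_le_bound _ zero_le_one (E.cpForm.norm_lift_apply_le σ _ 1 hT.bound)

/-- The operator `T̃ (I ⊗ a) T̃⋆`, as an element of `σ(A)'`. -/
def IsCovariant.theta (hT : IsCovariant σ T) (a : commutantOf σ) : commutantOf σ :=
  ⟨hT.tilde ∘L idTensor E a ∘L ContinuousLinearMap.adjoint hT.tilde, by
    rw [mem_commutantOf]
    intro b
    refine ContinuousLinearMap.ext fun v => ?_
    change σ b (hT.tilde (idTensorRep E σ a (ContinuousLinearMap.adjoint hT.tilde v))) =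
      hT.tilde (idTensorRep E σ a (ContinuousLinearMap.adjoint hT.tilde (σ b v)))
    rw [adjoint_intertwining hT.tilde_leftRep, ← CPForm.leftRep_rightRep, hT.tilde_leftRep]⟩

theorem IsCovariant.coe_theta (hT : IsCovariant σ T) (a : commutantOf σ) :
    (hT.theta a : H →L[ℂ] H) =
      hT.tilde ∘L idTensorRep E σ a ∘L ContinuousLinearMap.adjoint hT.tilde := rfl

theorem IsCovariant.theta_star_mul (hT : IsCovariant σ T) (a b : commutantOf σ) :
    (hT.theta (star a * b) : H →L[ℂ] H) =
      ContinuousLinearMap.adjoint (idTensorRep E σ a ∘L ContinuousLinearMap.adjoint hT.tilde) ∘L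
        (idTensorRep E σ b ∘L ContinuousLinearMap.adjoint hT.tilde) := by
  rw [coe_theta, ContinuousLinearMap.adjoint_comp, ContinuousLinearMap.adjoint_adjoint, map_mul,
    map_star, ContinuousLinearMap.star_eq_adjoint]
  rfl

/-- `Θ(a) = T̃ (I ⊗ a) T̃⋆` as a completely positive map. -/
def IsCovariant.thetaCP (hT : IsCovariant σ T) : commutantOf σ →CP commutantOf σ where
  toFun := hT.theta
  map_add' a b := Subtype.ext (by
    change (hT.theta (a + b) : H →L[ℂ] H) = (hT.theta a : H →L[ℂ] H) + hT.theta b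
    simp only [coe_theta, map_add, ContinuousLinearMap.add_comp, ContinuousLinearMap.comp_add])
  map_smul' c a := Subtype.ext (by
    change (hT.theta (c • a) : H →L[ℂ] H) = c • (hT.theta a : H →L[ℂ] H)
    simp only [coe_theta, map_smul, ContinuousLinearMap.smul_comp, ContinuousLinearMap.comp_smul])
  map_cstarMatrix_nonneg' k M hM := by
    obtain ⟨c, rfl⟩ := exists_star_mul_self M hM
    refine cstarMatrix_nonneg_of_gram (incl _) (incl_injective _)
      (fun l i => idTensorRep E σ (c l i) ∘L ContinuousLinearMap.adjoint hT.tilde) _ fun i j => ?_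
    rw [CStarMatrix.map_apply, CStarMatrix.mul_apply, map_sum, map_sum]
    exact Finset.sum_congr rfl fun l _ => hT.theta_star_mul (c l i) (c l j)

theorem IsCovariant.norm_theta_le (hT : IsCovariant σ T) (a : commutantOf σ) :
    ‖hT.theta a‖ ≤ ‖a‖ := by
  change ‖(hT.theta a : H →L[ℂ] H)‖ ≤ ‖a‖
  rw [hT.coe_theta]
  have h1 : ‖idTensorRep E σ a‖ ≤ ‖a‖ := NonUnitalStarAlgHom.norm_apply_le _ a
  have h2 : ‖ContinuousLinearMap.adjoint hT.tilde‖ ≤ 1 := by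
    rw [LinearIsometryEquiv.norm_map]; exact hT.norm_tilde_le
  calc _ ≤ ‖hT.tilde‖ * (‖idTensorRep E σ a‖ * ‖ContinuousLinearMap.adjoint hT.tilde‖) :=
        (ContinuousLinearMap.opNorm_comp_le _ _).trans
          (by gcongr; exact ContinuousLinearMap.opNorm_comp_le _ _)
    _ ≤ 1 * (‖a‖ * 1) := by gcongr; exact hT.norm_tilde_le
    _ = ‖a‖ := by ring

/-- Amplification `b ↦ I ⊗ b` preserves weak convergence on bounded sets. -/
theorem CPForm.tendsto_inner_rightRep {B C I : Type*} [CStarAlgebra B] [CStarAlgebra C]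
    [PartialOrder C] [StarOrderedRing C] (k : CPForm B C I) {M : VonNeumannAlgebra H}
    (π : C →⋆ₐ[ℂ] (H →L[ℂ] H)) (hM : ∀ c b v, incl M c (π b v) = π b (incl M c v))
    {l : Filter M} {r : ℝ} (hl : ∀ᶠ a in l, ‖a‖ ≤ r) {a₀ : M}
    (h : ∀ g g', Tendsto (fun a : M => ⟪g, (a : H →L[ℂ] H) g'⟫_ℂ) l
      (𝓝 ⟪g, (a₀ : H →L[ℂ] H) g'⟫_ℂ)) (s t : k.Tensor π) :
    Tendsto (fun a => ⟪s, k.rightRep π (incl M) hM a t⟫_ℂ) l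
      (𝓝 ⟪s, k.rightRep π (incl M) hM a₀ t⟫_ℂ) := by
  refine tendsto_inner_of_total (C := r) (k.isTotal_tmul π) (k.isTotal_tmul π) _ _ ?_
    (fun p q => ?_) s t
  · filter_upwards [hl] with a ha
    exact (NonUnitalStarAlgHom.norm_apply_le _ a).trans ha
  · simp only [k.rightRep_tmul, k.inner_tmul, ← hM]
    have e : ∀ a : M, ⟪p.2, incl M a (π (k.form p.1 q.1) q.2)⟫_ℂ =
        ⟪p.2, (a : H →L[ℂ] H) (π (k.form p.1 q.1) q.2)⟫_ℂ := fun _ => rfl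
    simp only [e]
    exact h _ _

theorem IsCovariant.isNormalMap_theta (hT : IsCovariant σ T) :
    IsNormalMap (commutantOf σ) fun a => (hT.theta a : H →L[ℂ] H) := fun h k =>
  isNormalFunctional_iff_tendsto.mpr fun l r a₀ hl hw => by
    have h1 := CPForm.tendsto_inner_rightRep E.cpForm σ
      apply_mem_of_mem_commutantOf hl hw
      (ContinuousLinearMap.adjoint hT.tilde h) (ContinuousLinearMap.adjoint hT.tilde k)
    have e : ∀ a, ⟪h, (hT.theta a : H →L[ℂ] H) k⟫_ℂ =
        ⟪ContinuousLinearMap.adjoint hT.tilde h,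
          idTensorRep E σ a (ContinuousLinearMap.adjoint hT.tilde k)⟫_ℂ := fun a => by
      rw [ContinuousLinearMap.adjoint_inner_left]
      rfl
    simp only [e]
    exact h1

end Theta

section Semigroup

variable {G : Type*} [NormedAddCommGroup G] [InnerProductSpace ℂ G] [CompleteSpace G]
  {N : VonNeumannAlgebra G}
variable {H : Type*} [NormedAddCommGroup H] [InnerProductSpace ℂ H] [CompleteSpace H]
variable {σ : N →⋆ₐ[ℂ] (H →L[ℂ] H)}

/-- For the trivial correspondence, `T̃` is unitary and `Θ` is the identity. -/
theorem IsCovariant.theta_eq_self {E : CStarCorrespondence N} {T : E →ₗ[ℂ] (H →L[ℂ] H)}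
    (hT : IsCovariant σ T) (u : N → E) (hu : Function.Surjective u)
    (hin : ∀ a b, E.inner (u a) (u b) = star a * b) (hTu : ∀ a, T (u a) = σ a)
    (a : commutantOf σ) : hT.theta a = a := by
  have h1 : ∀ h, ContinuousLinearMap.adjoint hT.tilde h = E.cpForm.tmul σ (u 1) h := by
    intro h
    refine E.cpForm.eq_of_inner_tmul σ fun x v => ?_
    obtain ⟨b, rfl⟩ := hu x
    rw [ContinuousLinearMap.adjoint_inner_right, hT.tilde_tmul, hTu, CPForm.inner_tmul]
    change _ = ⟪v, σ (E.inner (u b) (u 1)) h⟫_ℂ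
    rw [hin, mul_one, map_star, ContinuousLinearMap.star_eq_adjoint,
      ContinuousLinearMap.adjoint_inner_right]
  refine Subtype.ext (ContinuousLinearMap.ext fun h => ?_)
  change hT.tilde (idTensorRep E σ a (ContinuousLinearMap.adjoint hT.tilde h)) = _
  rw [h1, CPForm.rightRep_tmul, hT.tilde_tmul, hTu, map_one]
  rfl

end Semigroup

section Composition

variable {A : Type*} [CStarAlgebra A] [PartialOrder A] [StarOrderedRing A]
  {X Y F Z : CStarCorrespondence A}
variable {H : Type*} [NormedAddCommGroup H] [InnerProductSpace ℂ H] [CompleteSpace H]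
variable {σ : A →⋆ₐ[ℂ] (H →L[ℂ] H)}

/-- The isometry `S ⊗ I` induced by the adjoint `S` of a coisometry `U`. -/
theorem exists_isometry_tensor (σ : A →⋆ₐ[ℂ] (H →L[ℂ] H)) {U : F → Z} {S : Z → F}
    (hS : ∀ x z, Z.inner (U x) z = F.inner x (S z)) (hUS : ∀ z, U (S z) = z) :
    ∃ i : Z.cpForm.Tensor σ →L[ℂ] F.cpForm.Tensor σ,
      (∀ z h, i (Z.cpForm.tmul σ z h) = F.cpForm.tmul σ (S z) h) ∧
      (∀ x h, ContinuousLinearMap.adjoint i (F.cpForm.tmul σ x h) = Z.cpForm.tmul σ (U x) h) ∧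
      ContinuousLinearMap.adjoint i ∘L i = 1 := by
  have hS' : ∀ x z, Z.inner z (U x) = F.inner (S z) x := fun x z => by
    rw [← Z.star_inner, hS, CStarCorrespondence.star_inner]
  obtain ⟨i, hi, hii⟩ := exists_isometry_of_gram (Z.cpForm.isTotal_tmul σ)
    (fun p => F.cpForm.tmul σ (S p.1) p.2) fun p q => by
      rw [CPForm.inner_tmul, CPForm.inner_tmul]
      change ⟪p.2, σ (F.inner (S p.1) (S q.1)) q.2⟫_ℂ = ⟪p.2, σ (Z.inner p.1 q.1) q.2⟫_ℂ
      rw [← hS, hUS]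
  refine ⟨i, fun z h => hi (z, h), fun x h => Z.cpForm.eq_of_inner_tmul σ fun z v => ?_, hii⟩
  have e := hi (z, v)
  simp only at e
  rw [ContinuousLinearMap.adjoint_inner_right, e, CPForm.inner_tmul, CPForm.inner_tmul]
  change ⟪v, σ (F.inner (S z) x) h⟫_ℂ = ⟪v, σ (Z.inner z (U x)) h⟫_ℂ
  rw [hS']

theorem isTotal_tmul_tmul (X Y : CStarCorrespondence A) (σ : A →⋆ₐ[ℂ] (H →L[ℂ] H)) :
    IsTotal fun p : (X × Y) × H =>
      X.cpForm.tmul (Y.cpForm.leftRep σ) p.1.1 (Y.cpForm.tmul σ p.1.2 p.2) :=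
  fun ξ h => X.cpForm.isTotal_tmul_of_isTotal _ (Y.cpForm.isTotal_tmul σ) ξ
    fun p => h ((p.1, p.2.1), p.2.2)

theorem idTensorRep_leftRep (Y : CStarCorrespondence A) (c : commutantOf σ) (b : A)
    (v : Y.cpForm.Tensor σ) : idTensorRep Y σ c (Y.cpForm.leftRep σ b v) =
      Y.cpForm.leftRep σ b (idTensorRep Y σ c v) :=
  (Y.cpForm.leftRep_rightRep σ (incl (commutantOf σ)) apply_mem_of_mem_commutantOf b c v).symm

/-- The representation `a ↦ I ⊗ I ⊗ a` of `σ(A)'` on `X ⊗ Y ⊗_σ H`. -/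
abbrev idTensorRep₂ (X Y : CStarCorrespondence A) (σ : A →⋆ₐ[ℂ] (H →L[ℂ] H)) :
    commutantOf σ →⋆ₐ[ℂ] (X.cpForm.Tensor (Y.cpForm.leftRep σ) →L[ℂ]
      X.cpForm.Tensor (Y.cpForm.leftRep σ)) :=
  X.cpForm.rightRep (Y.cpForm.leftRep σ) (idTensorRep Y σ) (idTensorRep_leftRep Y)

/-- `F ⊗ H` is identified with `X ⊗ Y ⊗ H` when `F` plays the role of `X ⊗ Y`. -/
theorem exists_unitary_tensor {e : X → Y → F}
    (he : ∀ x x' y y', F.inner (e x y) (e x' y') = Y.inner y (Y.left (X.inner x x') y'))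
    (htot : IsTotal fun p : (X × Y) × H => F.cpForm.tmul σ (e p.1.1 p.1.2) p.2) :
    ∃ j : X.cpForm.Tensor (Y.cpForm.leftRep σ) →L[ℂ] F.cpForm.Tensor σ,
      (∀ x y h, j (X.cpForm.tmul (Y.cpForm.leftRep σ) x (Y.cpForm.tmul σ y h)) =
        F.cpForm.tmul σ (e x y) h) ∧ j ∘L ContinuousLinearMap.adjoint j = 1 ∧
      ∀ a : commutantOf σ, idTensorRep F σ a ∘L j = j ∘L idTensorRep₂ X Y σ a := by
  obtain ⟨j, hj, hjj⟩ := exists_isometry_of_gram (isTotal_tmul_tmul X Y σ)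
    (fun p => F.cpForm.tmul σ (e p.1.1 p.1.2) p.2) fun p q => by
      rw [inner_tmul_tmul, CPForm.inner_tmul]
      change ⟪p.2, σ (F.inner (e p.1.1 p.1.2) (e q.1.1 q.1.2)) q.2⟫_ℂ = _
      rw [he]
  have hj' : ∀ x y h, j (X.cpForm.tmul (Y.cpForm.leftRep σ) x (Y.cpForm.tmul σ y h)) =
      F.cpForm.tmul σ (e x y) h := fun x y h => hj ((x, y), h)
  refine ⟨j, hj', comp_adjoint_eq_one hjj htot hj, fun a => (isTotal_tmul_tmul X Y σ).ext
    fun p => ?_⟩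
  simp only [ContinuousLinearMap.comp_apply]
  rw [hj', CPForm.rightRep_tmul, CPForm.rightRep_tmul, CPForm.rightRep_tmul, hj']

/-- If `Z` is a coisometric image of `X ⊗ Y`, the adjoint of the multiplication embeds `Z ⊗ H` into
`X ⊗ Y ⊗ H`, compatibly with the actions of `σ(A)'`. -/
theorem exists_isometry_tensor₂ {e : X → Y → F}
    (he : ∀ x x' y y', F.inner (e x y) (e x' y') = Y.inner y (Y.left (X.inner x x') y'))
    (htot : IsTotal fun p : (X × Y) × H => F.cpForm.tmul σ (e p.1.1 p.1.2) p.2)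
    {U : F → Z} {S : Z → F} (hS : ∀ x z, Z.inner (U x) z = F.inner x (S z))
    (hUS : ∀ z, U (S z) = z) :
    ∃ k : X.cpForm.Tensor (Y.cpForm.leftRep σ) →L[ℂ] Z.cpForm.Tensor σ,
      (∀ x y h, k (X.cpForm.tmul (Y.cpForm.leftRep σ) x (Y.cpForm.tmul σ y h)) =
        Z.cpForm.tmul σ (U (e x y)) h) ∧ k ∘L ContinuousLinearMap.adjoint k = 1 ∧
      ∀ a : commutantOf σ, idTensorRep Z σ a ∘L k = k ∘L idTensorRep₂ X Y σ a := by
  obtain ⟨i, hi, hi', hii⟩ := exists_isometry_tensor σ hS hUS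
  obtain ⟨j, hj, hjj, -⟩ := exists_unitary_tensor he htot
  have hk : ∀ x y h, (ContinuousLinearMap.adjoint i ∘L j)
      (X.cpForm.tmul (Y.cpForm.leftRep σ) x (Y.cpForm.tmul σ y h)) =
        Z.cpForm.tmul σ (U (e x y)) h := fun x y h => by
    rw [ContinuousLinearMap.comp_apply, hj, hi']
  refine ⟨ContinuousLinearMap.adjoint i ∘L j, hk, ?_, fun a => (isTotal_tmul_tmul X Y σ).ext
    fun p => ?_⟩
  · rw [ContinuousLinearMap.adjoint_comp, ContinuousLinearMap.adjoint_adjoint,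
      ContinuousLinearMap.comp_assoc, ← ContinuousLinearMap.comp_assoc _ _ i, hjj]
    exact hii
  · simp only [ContinuousLinearMap.comp_apply] at hk ⊢
    rw [hk, CPForm.rightRep_tmul, CPForm.rightRep_tmul, CPForm.rightRep_tmul, hk]

/-- `(I ⊗ T̃) (I ⊗ I ⊗ a) (I ⊗ T̃)⋆ = I ⊗ Θ(a)`. -/
theorem IsCovariant.map_tilde_idTensorRep₂ (X : CStarCorrespondence A)
    {T : Y →ₗ[ℂ] (H →L[ℂ] H)} (hT : IsCovariant σ T) (a : commutantOf σ) :
    X.cpForm.map (Y.cpForm.leftRep σ) σ hT.tilde hT.tilde_leftRep ∘L idTensorRep₂ X Y σ a ∘L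
      ContinuousLinearMap.adjoint
        (X.cpForm.map (Y.cpForm.leftRep σ) σ hT.tilde hT.tilde_leftRep) =
      idTensorRep X σ (hT.theta a) := by
  refine X.cpForm.ext_tmul σ fun x h => ?_
  simp only [ContinuousLinearMap.comp_apply]
  rw [CPForm.adjoint_map_tmul, CPForm.rightRep_tmul, CPForm.map_tmul, CPForm.rightRep_tmul]
  rfl

/-- `Θ_Z = Θ_X ∘ Θ_Y` if `Z` is a coisometric image of `X ⊗ Y` and the representations multiply. -/
theorem IsCovariant.theta_theta {TX : X →ₗ[ℂ] (H →L[ℂ] H)} {TY : Y →ₗ[ℂ] (H →L[ℂ] H)}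
    {TZ : Z →ₗ[ℂ] (H →L[ℂ] H)}
    (hX : IsCovariant σ TX) (hY : IsCovariant σ TY) (hZ : IsCovariant σ TZ) {e : X → Y → F}
    (he : ∀ x x' y y', F.inner (e x y) (e x' y') = Y.inner y (Y.left (X.inner x x') y'))
    (htot : IsTotal fun p : (X × Y) × H => F.cpForm.tmul σ (e p.1.1 p.1.2) p.2)
    {U : F → Z} {S : Z → F} (hS : ∀ x z, Z.inner (U x) z = F.inner x (S z))
    (hUS : ∀ z, U (S z) = z) (hT : ∀ x y, TZ (U (e x y)) = TX x * TY y) (a : commutantOf σ) :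
    hZ.theta a = hX.theta (hY.theta a) := by
  obtain ⟨k, hk, hkk, hka⟩ := exists_isometry_tensor₂ he htot hS hUS
  have hm : hZ.tilde ∘L k =
      hX.tilde ∘L X.cpForm.map (Y.cpForm.leftRep σ) σ hY.tilde hY.tilde_leftRep := by
    refine (isTotal_tmul_tmul X Y σ).ext fun p => ?_
    rw [ContinuousLinearMap.comp_apply, ContinuousLinearMap.comp_apply, hk, CPForm.map_tmul,
      hZ.tilde_tmul, hT, hX.tilde_tmul, hY.tilde_tmul]
    rfl
  refine Subtype.ext ?_
  rw [coe_theta, coe_theta, ← hY.map_tilde_idTensorRep₂ X a]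
  calc hZ.tilde ∘L idTensorRep Z σ a ∘L ContinuousLinearMap.adjoint hZ.tilde
      = hZ.tilde ∘L (idTensorRep Z σ a ∘L (k ∘L ContinuousLinearMap.adjoint k)) ∘L
          ContinuousLinearMap.adjoint hZ.tilde := by rw [hkk]; rfl
    _ = (hZ.tilde ∘L k) ∘L idTensorRep₂ X Y σ a ∘L ContinuousLinearMap.adjoint (hZ.tilde ∘L k) := by
        rw [← ContinuousLinearMap.comp_assoc _ k, hka, ContinuousLinearMap.adjoint_comp]
        rfl
    _ = _ := by
        rw [hm, ContinuousLinearMap.adjoint_comp]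
        rfl

end Composition

section Semigroup

variable {G : Type*} [NormedAddCommGroup G] [InnerProductSpace ℂ G] [CompleteSpace G]
  {N : VonNeumannAlgebra G}
variable {H : Type*} [NormedAddCommGroup H] [InnerProductSpace ℂ H] [CompleteSpace H]
variable {σ : N →⋆ₐ[ℂ] (H →L[ℂ] H)}

/-- The cp-semigroup of a representation of a subproduct system. -/
def thetaSemigroup {S : Type*} [AddMonoid S] {X : CorrespondenceSystem S N}
    (hX : X.IsSubproductSystem) {R : ∀ s, X.fiber s →ₗ[ℂ] (H →L[ℂ] H)}
    (hR : X.IsRepresentation σ R) : CPSemigroup S (commutantOf σ) where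
  map s := (hR.covariant s).thetaCP
  norm_map_le s := (hR.covariant s).norm_theta_le
  normal s := (hR.covariant s).isNormalMap_theta
  map_zero := (hR.covariant 0).theta_eq_self X.unit hX.unit_bijective.2 hX.unit_inner hR.map_unit
  map_add s t a := by
    obtain ⟨U, ⟨-, V, hV, hUV⟩, hUm⟩ := hX.coisometric s t
    exact IsCovariant.theta_theta (hR.covariant s) (hR.covariant t) (hR.covariant (s + t))
      (fun _ _ _ _ => inner_elem _ _ _ _) (isTotal_elem_tmul _ _ hR.normal) (U := U) (S := V) hV hUV
      (fun x y => by rw [hUm, hR.map_mul]) a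

end Semigroup

/-! ### Arveson–Stinespring correspondences -/

section Single

theorem CPForm.map_leftRep {A B I : Type*} [CStarAlgebra A] [CStarAlgebra B] [PartialOrder B]
    [StarOrderedRing B] (k : CPForm A B I) {K L : Type*}
    [NormedAddCommGroup K] [InnerProductSpace ℂ K] [CompleteSpace K]
    [NormedAddCommGroup L] [InnerProductSpace ℂ L] [CompleteSpace L]
    (π : B →⋆ₐ[ℂ] (K →L[ℂ] K)) (π' : B →⋆ₐ[ℂ] (L →L[ℂ] L)) (T : K →L[ℂ] L)
    (hT : ∀ b v, T (π b v) = π' b (T v)) (a : A) (t : k.Tensor π) :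
    k.map π π' T hT (k.leftRep π a t) = k.leftRep π' a (k.map π π' T hT t) := by
  have : k.map π π' T hT ∘L k.leftRep π a = k.leftRep π' a ∘L k.map π π' T hT :=
    k.ext_tmul π fun x v => by
      simp only [ContinuousLinearMap.comp_apply, k.leftRep_tmul, k.map_tmul]
  exact DFunLike.congr_fun this t

variable {H : Type*} [NormedAddCommGroup H] [InnerProductSpace ℂ H] [CompleteSpace H]
  {M : VonNeumannAlgebra H} {Θ : M →CP M}

/-- An element of the Arveson–Stinespring correspondence as an operator `H → M ⊗_Θ H`. -/
def stinespringOp (x : arvesonStinespringCorrespondence Θ) : H →L[ℂ] StinespringSpace Θ :=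
  (show intertwiners M (stinespringRep Θ) from x).1

theorem stinespringOp_injective {x y : arvesonStinespringCorrespondence Θ}
    (h : stinespringOp x = stinespringOp y) : x = y := Subtype.ext h

theorem stinespringOp_incl (x : arvesonStinespringCorrespondence Θ) (a : M) (h : H) :
    stinespringOp x (incl M a h) = stinespringRep Θ a (stinespringOp x h) :=
  (show intertwiners M (stinespringRep Θ) from x).2 a h

/-- A linear family of intertwiners as a linear map into the Arveson–Stinespring correspondence. -/
theorem exists_linearMap_stinespringOp {V : Type*} [AddCommGroup V] [Module ℂ V]
    (f : V →ₗ[ℂ] H →L[ℂ] StinespringSpace Θ)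
    (hf : ∀ w (a : M) (h : H), f w (incl M a h) = stinespringRep Θ a (f w h)) :
    ∃ F : V →ₗ[ℂ] arvesonStinespringCorrespondence Θ, ∀ w, stinespringOp (F w) = f w :=
  ⟨{toFun := fun w => (⟨f w, hf w⟩ : intertwiners M (stinespringRep Θ))
    map_add' := fun v w => stinespringOp_injective (map_add f v w)
    map_smul' := fun c w => stinespringOp_injective (map_smul f c w) }, fun _ => rfl⟩

/-- The embedding of the Arveson–Stinespring correspondence into the operators `H → M ⊗_Θ H`. -/
def stinespringOpLinear (Θ : M →CP M) :
    arvesonStinespringCorrespondence Θ →ₗ[ℂ] H →L[ℂ] StinespringSpace Θ where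
  toFun := stinespringOp
  map_add' _ _ := rfl
  map_smul' _ _ := rfl

theorem stinespringOp_left (b : M.commutant) (x : arvesonStinespringCorrespondence Θ) :
    stinespringOp ((arvesonStinespringCorrespondence Θ).left b x) =
      stinespringCommutantRep Θ b ∘L stinespringOp x := rfl

theorem stinespringOp_right (x : arvesonStinespringCorrespondence Θ) (b : M.commutant) :
    stinespringOp ((arvesonStinespringCorrespondence Θ).right x b) =
      stinespringOp x ∘L incl M.commutant b := rfl

theorem incl_inner_stinespring (x y : arvesonStinespringCorrespondence Θ) :
    incl M.commutant ((arvesonStinespringCorrespondence Θ).inner x y) =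
      ContinuousLinearMap.adjoint (stinespringOp x) ∘L stinespringOp y := rfl

theorem inner_stinespringOp (x y : arvesonStinespringCorrespondence Θ) (h h' : H) :
    ⟪stinespringOp x h, stinespringOp y h'⟫_ℂ =
      ⟪h, incl M.commutant ((arvesonStinespringCorrespondence Θ).inner x y) h'⟫_ℂ := by
  rw [incl_inner_stinespring, ContinuousLinearMap.comp_apply,
    ContinuousLinearMap.adjoint_inner_right]

theorem stinespringRep_vector (a : M) (h : H) :
    stinespringRep Θ a (stinespringVector Θ h) = (stinespringForm Θ).tmul (incl M) a h := by
  unfold stinespringVector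
  rw [CPForm.leftRep_tmul]
  change (stinespringForm Θ).tmul (incl M) (a * 1) h = _
  rw [mul_one]

/-- The compression `x ↦ w⋆ x`, `w h = I ⊗ h`, of intertwiners to `H`. -/
def stinespringCompression (Θ : M →CP M) (x : arvesonStinespringCorrespondence Θ) : H →L[ℂ] H :=
  ContinuousLinearMap.adjoint (stinespringVector Θ) ∘L stinespringOp x

theorem inner_tmul_stinespringOp (a : M) (w v : H) (x : arvesonStinespringCorrespondence Θ) :
    ⟪(stinespringForm Θ).tmul (incl M) a w, stinespringOp x v⟫_ℂ =
      ⟪w, stinespringCompression Θ x (incl M (star a) v)⟫_ℂ := by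
  unfold stinespringCompression
  rw [ContinuousLinearMap.comp_apply, ContinuousLinearMap.adjoint_inner_right, stinespringOp_incl,
    map_star, ContinuousLinearMap.star_eq_adjoint, ContinuousLinearMap.adjoint_inner_right,
    stinespringRep_vector]

/-- An intertwiner is determined by its compression to `H`, because the vectors `I ⊗ h` generate
`M ⊗_Θ H` under the action of `M`. -/
theorem stinespringCompression_injective : Function.Injective (stinespringCompression Θ) := by
  intro x y hxy
  refine stinespringOp_injective (ContinuousLinearMap.ext fun v =>
    (stinespringForm Θ).eq_of_inner_tmul (incl M) fun a w => ?_)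
  rw [inner_tmul_stinespringOp, inner_tmul_stinespringOp, hxy]

theorem stinespringCompression_left (b : M.commutant) (x : arvesonStinespringCorrespondence Θ) :
    stinespringCompression Θ ((arvesonStinespringCorrespondence Θ).left b x) =
      incl M.commutant b * stinespringCompression Θ x := by
  have h : ∀ b h, stinespringVector Θ (incl M.commutant b h) =
      stinespringCommutantRep Θ b (stinespringVector Θ h) := fun b h =>
    ((stinespringForm Θ).rightRep_tmul (incl M) (incl M.commutant) commutant_comm b 1 h).symm
  refine ContinuousLinearMap.ext fun v => ?_
  exact adjoint_intertwining h b (stinespringOp x v)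

theorem stinespringCompression_right (x : arvesonStinespringCorrespondence Θ) (b : M.commutant) :
    stinespringCompression Θ ((arvesonStinespringCorrespondence Θ).right x b) =
      stinespringCompression Θ x * incl M.commutant b := rfl

theorem isNormal_stinespring_left (x y : arvesonStinespringCorrespondence Θ) (g g' : H) :
    IsNormalFunctional M.commutant fun b => ⟪g, ((arvesonStinespringCorrespondence Θ).inner x
      ((arvesonStinespringCorrespondence Θ).left b y) : H →L[ℂ] H) g'⟫_ℂ := by
  refine isNormalFunctional_iff_tendsto.mpr fun l r a₀ hl hw => ?_
  have h1 := CPForm.tendsto_inner_rightRep (stinespringForm Θ) (incl M) commutant_comm hl hw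
    (stinespringOp x g) (stinespringOp y g')
  have e : ∀ b, ⟪g, ((arvesonStinespringCorrespondence Θ).inner x
      ((arvesonStinespringCorrespondence Θ).left b y) : H →L[ℂ] H) g'⟫_ℂ =
      ⟪stinespringOp x g, stinespringCommutantRep Θ b (stinespringOp y g')⟫_ℂ := fun b =>
    (inner_stinespringOp x ((arvesonStinespringCorrespondence Θ).left b y) g g').symm
  simp only [e]
  exact h1

theorem norm_stinespringVector_le (h : ∀ a, ‖Θ a‖ ≤ ‖a‖) : ‖stinespringVector Θ‖ ≤ 1 := by
  have h1 : ContinuousLinearMap.adjoint (stinespringVector Θ) ∘L stinespringVector Θ =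
      (Θ 1 : H →L[ℂ] H) := by
    refine ContinuousLinearMap.ext fun v => ext_inner_left ℂ fun w => ?_
    rw [ContinuousLinearMap.comp_apply, ContinuousLinearMap.adjoint_inner_right]
    unfold stinespringVector
    rw [CPForm.inner_tmul]
    change ⟪w, incl M (Θ (star 1 * 1)) v⟫_ℂ = _
    rw [star_one, one_mul]
    rfl
  have h2 : ‖stinespringVector Θ‖ * ‖stinespringVector Θ‖ ≤ 1 := by
    rw [← ContinuousLinearMap.norm_adjoint_comp_self, h1]
    refine (h 1).trans ?_
    exact ContinuousLinearMap.norm_id_le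
  nlinarith [norm_nonneg (stinespringVector Θ)]

/-- The compression by the contraction `w` is completely contractive: the matrix
`(∑ k, x_ki⋆ (1 - w w⋆) x_kj)` is a sum of Gram matrices. -/
theorem norm_compression_sq_le (h : ∀ a, ‖Θ a‖ ≤ ‖a‖) {n : ℕ}
    (x : Fin n → Fin n → arvesonStinespringCorrespondence Θ) :
    ‖(CStarMatrix.ofMatrix fun i j => stinespringCompression Θ (x i j) :
        CStarMatrix (Fin n) (Fin n) (H →L[ℂ] H))‖ ^ 2 ≤
      ‖(CStarMatrix.ofMatrix fun i j =>
          ∑ k, (arvesonStinespringCorrespondence Θ).inner (x k i) (x k j) :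
        CStarMatrix (Fin n) (Fin n) M.commutant)‖ := by
  set w := stinespringVector Θ with hw
  have hww : 0 ≤ 1 - w ∘L ContinuousLinearMap.adjoint w := by
    have hn : 0 ≤ w ∘L ContinuousLinearMap.adjoint w := by
      rw [ContinuousLinearMap.nonneg_iff_isPositive]
      exact ContinuousLinearMap.isPositive_self_comp_adjoint w
    rw [sub_nonneg, ← CStarAlgebra.norm_le_one_iff_of_nonneg _ hn]
    refine (ContinuousLinearMap.opNorm_comp_le _ _).trans ?_
    rw [LinearIsometryEquiv.norm_map]
    exact mul_le_one₀ (norm_stinespringVector_le h) (norm_nonneg _) (norm_stinespringVector_le h)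
  obtain ⟨d, hd⟩ := exists_star_mul_self _ hww
  set P : CStarMatrix (Fin n) (Fin n) (H →L[ℂ] H) :=
    CStarMatrix.ofMatrix fun i j => stinespringCompression Θ (x i j)
  set Q : CStarMatrix (Fin n) (Fin n) M.commutant := CStarMatrix.ofMatrix fun i j =>
    ∑ k, (arvesonStinespringCorrespondence Θ).inner (x k i) (x k j)
  have hQ : ‖CStarMatrix.mapₙₐ (incl M.commutant : M.commutant →⋆ₙₐ[ℂ] (H →L[ℂ] H)) Q‖ ≤ ‖Q‖ :=
    NonUnitalStarAlgHom.norm_apply_le _ Q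
  have hPQ : star P * P ≤
      CStarMatrix.mapₙₐ (incl M.commutant : M.commutant →⋆ₙₐ[ℂ] (H →L[ℂ] H)) Q := by
    rw [← sub_nonneg]
    refine cstarMatrix_nonneg_of_gram (StarAlgHom.id ℂ (H →L[ℂ] H)) (fun _ _ h => h)
      (fun l i => d ∘L stinespringOp (x l i)) _ fun i j => ?_
    have e1 : (star P * P) i j = ∑ l, ContinuousLinearMap.adjoint (stinespringOp (x l i)) ∘L
        (w ∘L ContinuousLinearMap.adjoint w) ∘L stinespringOp (x l j) := by
      rw [CStarMatrix.mul_apply]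
      refine Finset.sum_congr rfl fun l _ => ?_
      change ContinuousLinearMap.adjoint (ContinuousLinearMap.adjoint w ∘L stinespringOp (x l i)) ∘L
        (ContinuousLinearMap.adjoint w ∘L stinespringOp (x l j)) = _
      rw [ContinuousLinearMap.adjoint_comp, ContinuousLinearMap.adjoint_adjoint]
      rfl
    have e2 : CStarMatrix.mapₙₐ (incl M.commutant : M.commutant →⋆ₙₐ[ℂ] (H →L[ℂ] H)) Q i j =
        ∑ l, ContinuousLinearMap.adjoint (stinespringOp (x l i)) ∘L stinespringOp (x l j) :=
      map_sum (incl M.commutant)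
        (fun l => (arvesonStinespringCorrespondence Θ).inner (x l i) (x l j)) Finset.univ
    change CStarMatrix.mapₙₐ (incl M.commutant : M.commutant →⋆ₙₐ[ℂ] (H →L[ℂ] H)) Q i j -
      (star P * P) i j = _
    rw [e1, e2, ← Finset.sum_sub_distrib]
    refine Finset.sum_congr rfl fun l _ => ?_
    have e3 : ContinuousLinearMap.adjoint d ∘L d = 1 - w ∘L ContinuousLinearMap.adjoint w := hd.symm
    have e4 : ContinuousLinearMap.adjoint (d ∘L stinespringOp (x l i)) ∘L
        (d ∘L stinespringOp (x l j)) = ContinuousLinearMap.adjoint (stinespringOp (x l i)) ∘L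
          (ContinuousLinearMap.adjoint d ∘L d) ∘L stinespringOp (x l j) := by
      rw [ContinuousLinearMap.adjoint_comp]
      rfl
    rw [e4, e3, ContinuousLinearMap.sub_comp, ContinuousLinearMap.comp_sub]
    rfl
  rw [sq, ← CStarRing.norm_star_mul_self]
  exact (CStarAlgebra.norm_le_norm_of_nonneg_of_le (star_mul_self_nonneg P) hPQ).trans hQ

end Single

section Product

variable {H : Type*} [NormedAddCommGroup H] [InnerProductSpace ℂ H] [CompleteSpace H]
  {M : VonNeumannAlgebra H} {Θ₁ Θ₂ Θ : M →CP M}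

/-- The operator `I ⊗ x : M ⊗_{Θ₂} H → M ⊗_{Θ₂} M ⊗_{Θ₁} H`. -/
def stinespringMap (Θ₂ : M →CP M) (x : arvesonStinespringCorrespondence Θ₁) :
    StinespringSpace Θ₂ →L[ℂ] StinespringSpace₂ Θ₁ Θ₂ :=
  (stinespringForm Θ₂).map (incl M) (stinespringRep Θ₁) (stinespringOp x) (stinespringOp_incl x)

theorem stinespringMap_tmul (x : arvesonStinespringCorrespondence Θ₁) (a : M) (h : H) :
    stinespringMap Θ₂ x ((stinespringForm Θ₂).tmul (incl M) a h) =
      (stinespringForm Θ₂).tmul (stinespringRep Θ₁) a (stinespringOp x h) :=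
  CPForm.map_tmul _ _ _ _ _ a h

theorem stinespringMap_leftRep (x : arvesonStinespringCorrespondence Θ₁) (a : M)
    (t : StinespringSpace Θ₂) : stinespringMap Θ₂ x (stinespringRep Θ₂ a t) =
      (stinespringForm Θ₂).leftRep (stinespringRep Θ₁) a (stinespringMap Θ₂ x t) :=
  CPForm.map_leftRep _ _ _ _ _ a t

/-- `(I ⊗ x)⋆ (I ⊗ x') = I ⊗ ⟨x, x'⟩`. -/
theorem inner_stinespringMap (x x' : arvesonStinespringCorrespondence Θ₁)
    (s t : StinespringSpace Θ₂) : ⟪stinespringMap Θ₂ x s, stinespringMap Θ₂ x' t⟫_ℂ =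
      ⟪s, stinespringCommutantRep Θ₂ ((arvesonStinespringCorrespondence Θ₁).inner x x') t⟫_ℂ :=
  CPForm.inner_map_map _ _ _ _ _ (stinespringOp_incl x) (stinespringOp_incl x') _
    (commutant_comm ((arvesonStinespringCorrespondence Θ₁).inner x x')) rfl s t

/-- The product `x y = Γ⋆ (I ⊗ x) y`. -/
def stinespringMul (hΘ : ∀ a, Θ a = Θ₁ (Θ₂ a)) (x : arvesonStinespringCorrespondence Θ₁)
    (y : arvesonStinespringCorrespondence Θ₂) : arvesonStinespringCorrespondence Θ :=
  arvesonStinespringMul hΘ x y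

theorem stinespringOp_mul (hΘ : ∀ a, Θ a = Θ₁ (Θ₂ a)) (x : arvesonStinespringCorrespondence Θ₁)
    (y : arvesonStinespringCorrespondence Θ₂) (h : H) :
    stinespringOp (stinespringMul hΘ x y) h =
      ContinuousLinearMap.adjoint (gammaMap Θ₁ Θ₂ Θ hΘ) (stinespringMap Θ₂ x (stinespringOp y h)) :=
  rfl

theorem adjoint_stinespringMap_tmul (x : arvesonStinespringCorrespondence Θ₁) (a : M)
    (ξ : StinespringSpace Θ₁) : ContinuousLinearMap.adjoint (stinespringMap Θ₂ x)
      ((stinespringForm Θ₂).tmul (stinespringRep Θ₁) a ξ) =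
        (stinespringForm Θ₂).tmul (incl M) a (ContinuousLinearMap.adjoint (stinespringOp x) ξ) :=
  CPForm.adjoint_map_tmul _ _ _ _ _ a ξ

theorem inner_stinespringCompression (x : arvesonStinespringCorrespondence Θ) (w v : H) :
    ⟪w, stinespringCompression Θ x v⟫_ℂ = ⟪stinespringVector Θ w, stinespringOp x v⟫_ℂ :=
  ContinuousLinearMap.adjoint_inner_right (stinespringVector Θ) w (stinespringOp x v)

/-- The compression to `H` is multiplicative. -/
theorem stinespringCompression_mul (hΘ : ∀ a, Θ a = Θ₁ (Θ₂ a))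
    (x : arvesonStinespringCorrespondence Θ₁) (y : arvesonStinespringCorrespondence Θ₂) :
    stinespringCompression Θ (stinespringMul hΘ x y) =
      stinespringCompression Θ₁ x * stinespringCompression Θ₂ y := by
  refine ContinuousLinearMap.ext fun v => ext_inner_left ℂ fun w => ?_
  have h1 : gammaMap Θ₁ Θ₂ Θ hΘ (stinespringVector Θ w) =
      (stinespringForm Θ₂).tmul (stinespringRep Θ₁) 1 (stinespringVector Θ₁ w) :=
    gammaMap_tmul Θ₁ Θ₂ Θ hΘ 1 w
  have h2 : ⟪w, stinespringCompression Θ₁ x (stinespringCompression Θ₂ y v)⟫_ℂ =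
      ⟪stinespringVector Θ₂ (ContinuousLinearMap.adjoint (stinespringOp x)
        (stinespringVector Θ₁ w)), stinespringOp y v⟫_ℂ := by
    rw [inner_stinespringCompression, ← ContinuousLinearMap.adjoint_inner_left,
      inner_stinespringCompression]
  rw [inner_stinespringCompression, stinespringOp_mul, ContinuousLinearMap.adjoint_inner_right,
    h1, ← ContinuousLinearMap.adjoint_inner_left, adjoint_stinespringMap_tmul]
  exact h2.symm

theorem adjoint_gammaMap_comp (hΘ : ∀ a, Θ a = Θ₁ (Θ₂ a)) :
    ContinuousLinearMap.adjoint (gammaMap Θ₁ Θ₂ Θ hΘ) ∘L gammaMap Θ₁ Θ₂ Θ hΘ = 1 := by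
  refine (stinespringForm Θ).ext_tmul (incl M) fun a v =>
    (stinespringForm Θ).eq_of_inner_tmul (incl M) fun b w => ?_
  rw [ContinuousLinearMap.comp_apply, ContinuousLinearMap.adjoint_inner_right, gammaMap_tmul,
    gammaMap_tmul, inner_stinespring₂ Θ₁ Θ₂ Θ hΘ, ← CPForm.inner_tmul]
  rfl

/-- The action `b (a ⊗ c ⊗ h) = a ⊗ c ⊗ b h` of the commutant. -/
abbrev stinespringCommutantRep₂ (Θ₁ Θ₂ : M →CP M) :
    M.commutant →⋆ₐ[ℂ] (StinespringSpace₂ Θ₁ Θ₂ →L[ℂ] StinespringSpace₂ Θ₁ Θ₂) :=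
  (stinespringForm Θ₂).rightRep (stinespringRep Θ₁) (stinespringCommutantRep Θ₁) fun c b v =>
    ((stinespringForm Θ₁).leftRep_rightRep (incl M) (incl M.commutant) commutant_comm b c v).symm

theorem gammaMap_commutantRep (hΘ : ∀ a, Θ a = Θ₁ (Θ₂ a)) (b : M.commutant)
    (t : StinespringSpace Θ) : gammaMap Θ₁ Θ₂ Θ hΘ (stinespringCommutantRep Θ b t) =
      stinespringCommutantRep₂ Θ₁ Θ₂ b (gammaMap Θ₁ Θ₂ Θ hΘ t) := by
  have : gammaMap Θ₁ Θ₂ Θ hΘ ∘L stinespringCommutantRep Θ b =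
      stinespringCommutantRep₂ Θ₁ Θ₂ b ∘L gammaMap Θ₁ Θ₂ Θ hΘ := by
    refine (stinespringForm Θ).ext_tmul (incl M) fun a v => ?_
    simp only [ContinuousLinearMap.comp_apply]
    rw [CPForm.rightRep_tmul, gammaMap_tmul, gammaMap_tmul, CPForm.rightRep_tmul]
    congr 1
    exact ((stinespringForm Θ₁).rightRep_tmul (incl M) (incl M.commutant) commutant_comm b 1 v).symm
  exact DFunLike.congr_fun this t

theorem stinespringMap_left (x : arvesonStinespringCorrespondence Θ₁) (b : M.commutant)
    (t : StinespringSpace Θ₂) :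
    stinespringMap Θ₂ ((arvesonStinespringCorrespondence Θ₁).left b x) t =
      stinespringCommutantRep₂ Θ₁ Θ₂ b (stinespringMap Θ₂ x t) := by
  have : stinespringMap Θ₂ ((arvesonStinespringCorrespondence Θ₁).left b x) =
      stinespringCommutantRep₂ Θ₁ Θ₂ b ∘L stinespringMap Θ₂ x := by
    refine (stinespringForm Θ₂).ext_tmul (incl M) fun a v => ?_
    rw [ContinuousLinearMap.comp_apply, stinespringMap_tmul, stinespringMap_tmul,
      CPForm.rightRep_tmul]
    rfl
  exact DFunLike.congr_fun this t

/-- The spatial form `x ⊗ y ⊗ h ↦ (I ⊗ x) y h` of the tensor product of two Arveson–Stinespring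
correspondences. It is unitary if the vectors `x h` and `y h` are total. -/
theorem exists_unitary_stinespring₂ (h₁ : IsTotal fun p : arvesonStinespringCorrespondence Θ₁ × H =>
      stinespringOp p.1 p.2)
    (h₂ : IsTotal fun p : arvesonStinespringCorrespondence Θ₂ × H => stinespringOp p.1 p.2) :
    ∃ u : space₂ (arvesonStinespringCorrespondence Θ₁) (arvesonStinespringCorrespondence Θ₂) →L[ℂ]
        StinespringSpace₂ Θ₁ Θ₂,
      (∀ x y h, u ((arvesonStinespringCorrespondence Θ₁).cpForm.tmul _ x
        ((arvesonStinespringCorrespondence Θ₂).cpForm.tmul (incl M.commutant) y h)) =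
          stinespringMap Θ₂ x (stinespringOp y h)) ∧
      u ∘L ContinuousLinearMap.adjoint u = 1 := by
  have htot : IsTotal fun p : (arvesonStinespringCorrespondence Θ₁ ×
      arvesonStinespringCorrespondence Θ₂) × H =>
        stinespringMap Θ₂ p.1.1 (stinespringOp p.1.2 p.2) := by
    intro ξ hξ
    refine (stinespringForm Θ₂).isTotal_tmul_of_isTotal (stinespringRep Θ₁) h₁ ξ fun p => ?_
    have h3 : ContinuousLinearMap.adjoint (stinespringMap Θ₂ p.2.1) ξ = 0 := h₂ _ fun q => by
      rw [ContinuousLinearMap.adjoint_inner_right]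
      exact hξ ((p.2.1, q.1), q.2)
    have h4 := stinespringMap_tmul (Θ₂ := Θ₂) p.2.1 p.1 p.2.2
    change ⟪(stinespringForm Θ₂).tmul (stinespringRep Θ₁) p.1 (stinespringOp p.2.1 p.2.2), ξ⟫_ℂ = 0
    rw [← h4, ← ContinuousLinearMap.adjoint_inner_right, h3, inner_zero_right]
  obtain ⟨u, hu, huu⟩ := exists_isometry_of_gram
    (isTotal_tmul_tmul (arvesonStinespringCorrespondence Θ₁) (arvesonStinespringCorrespondence Θ₂)
      (incl M.commutant)) (fun p => stinespringMap Θ₂ p.1.1 (stinespringOp p.1.2 p.2)) fun p q => by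
      rw [inner_tmul_tmul, inner_stinespringMap, ← inner_stinespringOp]
      rfl
  exact ⟨u, fun x y h => hu ((x, y), h), comp_adjoint_eq_one huu htot hu⟩

end Product

/-! ### The Arveson–Stinespring subproduct system -/

section Spatial

variable {H : Type*} [NormedAddCommGroup H] [InnerProductSpace ℂ H] [CompleteSpace H]
  {K : Type*} [NormedAddCommGroup K] [InnerProductSpace ℂ K] [CompleteSpace K]
  {L : Type*} [NormedAddCommGroup L] [InnerProductSpace ℂ L] [CompleteSpace L]

theorem adjoint_apply_of_adjoint {T : K →L[ℂ] L} {A A' : K →L[ℂ] K} {B B' : L →L[ℂ] L}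
    (hA : ContinuousLinearMap.adjoint A = A') (hB : ContinuousLinearMap.adjoint B = B')
    (h : ∀ ξ, T (A' ξ) = B' (T ξ)) (t : L) :
    ContinuousLinearMap.adjoint T (B t) = A (ContinuousLinearMap.adjoint T t) := by
  refine ext_inner_left ℂ fun ξ => ?_
  rw [ContinuousLinearMap.adjoint_inner_right, ← ContinuousLinearMap.adjoint_inner_left, hB, ← h,
    ← hA, ← ContinuousLinearMap.adjoint_inner_right, ContinuousLinearMap.adjoint_inner_left]

/-- If two correspondences over `N ⊆ B(H)` are realized by operators `H → K` and `H → L`, a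
coisometry `D : K → L` that maps the operators of the first to those of the second, and whose
adjoint maps them back, induces a coisometric correspondence map. -/
theorem isCoisometric_of_spatial {N : VonNeumannAlgebra H} {F Z : CStarCorrespondence N}
    {opF : F → H →L[ℂ] K} {opZ : Z → H →L[ℂ] L} (hZi : Function.Injective opZ)
    (hF : ∀ x y, incl N (F.inner x y) = ContinuousLinearMap.adjoint (opF x) ∘L opF y)
    (hZ : ∀ x y, incl N (Z.inner x y) = ContinuousLinearMap.adjoint (opZ x) ∘L opZ y)
    {lF : N → K →L[ℂ] K} {lZ : N → L →L[ℂ] L}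
    (hFl : ∀ b x, opF (F.left b x) = lF b ∘L opF x) (hZl : ∀ b x, opZ (Z.left b x) = lZ b ∘L opZ x)
    (hFr : ∀ x b, opF (F.right x b) = opF x ∘L incl N b)
    (hZr : ∀ x b, opZ (Z.right x b) = opZ x ∘L incl N b)
    {U : F →ₗ[ℂ] Z} {V : Z →ₗ[ℂ] F} {D : K →L[ℂ] L} (hU : ∀ z, opZ (U z) = D ∘L opF z)
    (hV : ∀ w, opF (V w) = ContinuousLinearMap.adjoint D ∘L opZ w)
    (hD : D ∘L ContinuousLinearMap.adjoint D = 1) (hDl : ∀ b ξ, D (lF b ξ) = lZ b (D ξ)) :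
    IsCoisometric (.refl ℂ N) U := by
  refine ⟨⟨fun b z => hZi ?_, fun z b => hZi ?_⟩, V, fun z w => incl_injective _ ?_,
    fun w => hZi ?_⟩
  · refine Eq.trans ?_ (hZl b (U z)).symm
    rw [hU, hU, hFl]
    exact ContinuousLinearMap.ext fun h => hDl b _
  · refine Eq.trans ?_ (hZr (U z) b).symm
    rw [hU, hU, hFr]
    rfl
  · refine Eq.trans ?_ (hF z (V w)).symm
    rw [hZ, hU, hV, ContinuousLinearMap.adjoint_comp]
    rfl
  · rw [hU, hV, ← ContinuousLinearMap.comp_assoc, hD]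
    rfl

end Spatial

section Coisometric

variable {G : Type*} [NormedAddCommGroup G] [InnerProductSpace ℂ G] [CompleteSpace G]
  {N : VonNeumannAlgebra G} {X Y : CStarCorrespondence N}

theorem tensorOp_incl (z : tensor X Y) (n : N.commutant) (g : G) :
    tensorOp z (incl N.commutant n g) = commutantAction₂ X Y n (tensorOp z g) :=
  (show intertwiners N.commutant (commutantAction₂ X Y) from z).2 n g

/-- A linear family of intertwiners as a linear map into the tensor product. -/
theorem exists_linearMap_tensorOp {V : Type*} [AddCommGroup V] [Module ℂ V]
    (f : V →ₗ[ℂ] G →L[ℂ] space₂ X Y)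
    (hf : ∀ w (n : N.commutant) (g : G),
      f w (incl N.commutant n g) = commutantAction₂ X Y n (f w g)) :
    ∃ F : V →ₗ[ℂ] tensor X Y, ∀ w, tensorOp (F w) = f w :=
  ⟨{toFun := fun w => (⟨f w, hf w⟩ : intertwiners N.commutant (commutantAction₂ X Y))
    map_add' := fun v w => tensorOp_injective (map_add f v w)
    map_smul' := fun c w => tensorOp_injective (map_smul f c w) }, fun _ => rfl⟩

/-- The embedding of the tensor product into the operators `G → X ⊗ Y ⊗ G`. -/
def tensorOpLinear (X Y : CStarCorrespondence N) : tensor X Y →ₗ[ℂ] G →L[ℂ] space₂ X Y where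
  toFun := tensorOp
  map_add' _ _ := rfl
  map_smul' _ _ := rfl

theorem tensorOp_left (a : N) (z : tensor X Y) : tensorOp ((tensor X Y).left a z) =
    X.cpForm.leftRep (Y.cpForm.leftRep (incl N)) a ∘L tensorOp z := rfl

theorem tensorOp_right (z : tensor X Y) (a : N) :
    tensorOp ((tensor X Y).right z a) = tensorOp z ∘L incl N a := rfl

theorem incl_inner_tensor (z z' : tensor X Y) : incl N ((tensor X Y).inner z z') =
    ContinuousLinearMap.adjoint (tensorOp z) ∘L tensorOp z' := rfl

theorem commutantAction₂_tmul (n : N.commutant) (x : X) (y : Y) (g : G) :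
    commutantAction₂ X Y n (X.cpForm.tmul (Y.cpForm.leftRep (incl N)) x
      (Y.cpForm.tmul (incl N) y g)) = X.cpForm.tmul (Y.cpForm.leftRep (incl N)) x
        (Y.cpForm.tmul (incl N) y (incl N.commutant n g)) := by
  rw [← tensorOp_elem, ← tensorOp_incl, tensorOp_elem]

end Coisometric

section Multiplication

variable {H : Type*} [NormedAddCommGroup H] [InnerProductSpace ℂ H] [CompleteSpace H]
  {M : VonNeumannAlgebra H} {Θ₁ Θ₂ Θ : M →CP M}

theorem exists_eq_incl_bicommutant (n : M.commutant.commutant) :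
    ∃ a : M, incl M a = incl M.commutant.commutant n := by
  have h : ∀ T : H →L[ℂ] H, T ∈ M.commutant.commutant → T ∈ M := fun T hT => by
    rwa [M.commutant_commutant] at hT
  exact ⟨⟨n.1, h _ n.2⟩, rfl⟩

theorem exists_incl_bicommutant_eq (a : M) :
    ∃ n : M.commutant.commutant, incl M.commutant.commutant n = incl M a :=
  ⟨⟨a.1, by rw [M.commutant_commutant]; exact a.2⟩, rfl⟩

/-- Postcomposition with an operator. -/
def postcomp {K L : Type*} [NormedAddCommGroup K] [NormedSpace ℂ K] [NormedAddCommGroup L]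
    [NormedSpace ℂ L] (T : K →L[ℂ] L) : (H →L[ℂ] K) →ₗ[ℂ] (H →L[ℂ] L) where
  toFun x := T ∘L x
  map_add' x y := ContinuousLinearMap.comp_add T x y
  map_smul' c x := ContinuousLinearMap.comp_smul T c x

section Abstract

variable {X Y : CStarCorrespondence M.commutant}
  {u : space₂ X Y →L[ℂ] StinespringSpace₂ Θ₁ Θ₂}
  (huc : ∀ (a : M) (n : M.commutant.commutant), incl M.commutant.commutant n = incl M a → ∀ ξ,
    u (commutantAction₂ X Y n ξ) = (stinespringForm Θ₂).leftRep (stinespringRep Θ₁) a (u ξ))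

include huc

theorem gammaMap_tensorOp_incl (hΘ : ∀ a, Θ a = Θ₁ (Θ₂ a)) (z : tensor X Y) (a : M) (h : H) :
    (ContinuousLinearMap.adjoint (gammaMap Θ₁ Θ₂ Θ hΘ) ∘L u ∘L tensorOp z) (incl M a h) =
      stinespringRep Θ a
        ((ContinuousLinearMap.adjoint (gammaMap Θ₁ Θ₂ Θ hΘ) ∘L u ∘L tensorOp z) h) := by
  obtain ⟨n, hn⟩ := exists_incl_bicommutant_eq a
  simp only [ContinuousLinearMap.comp_apply]
  rw [← hn, tensorOp_incl, huc a n hn]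
  exact adjoint_intertwining (gammaMap_leftRep Θ₁ Θ₂ Θ hΘ) a _

theorem adjoint_stinespring₂_leftRep (a : M) (n : M.commutant.commutant)
    (han : incl M.commutant.commutant n = incl M a) (t : StinespringSpace₂ Θ₁ Θ₂) :
    ContinuousLinearMap.adjoint u ((stinespringForm Θ₂).leftRep (stinespringRep Θ₁) a t) =
      commutantAction₂ X Y n (ContinuousLinearMap.adjoint u t) :=
  adjoint_apply_of_adjoint (A := commutantAction₂ X Y n) (A' := commutantAction₂ X Y (star n))
    (B := (stinespringForm Θ₂).leftRep (stinespringRep Θ₁) a)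
    (B' := (stinespringForm Θ₂).leftRep (stinespringRep Θ₁) (star a))
    (map_star (commutantAction₂ X Y) n).symm
    (map_star ((stinespringForm Θ₂).leftRep (stinespringRep Θ₁)) a).symm
    (huc (star a) (star n) (by rw [map_star, map_star, han])) t

theorem adjoint_gammaMap_stinespringOp_incl (hΘ : ∀ a, Θ a = Θ₁ (Θ₂ a))
    (w : arvesonStinespringCorrespondence Θ) (n : M.commutant.commutant) (h : H) :
    ((ContinuousLinearMap.adjoint u ∘L gammaMap Θ₁ Θ₂ Θ hΘ) ∘L stinespringOp w)
        (incl M.commutant.commutant n h) = commutantAction₂ X Y n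
      (((ContinuousLinearMap.adjoint u ∘L gammaMap Θ₁ Θ₂ Θ hΘ) ∘L stinespringOp w) h) := by
  obtain ⟨a, ha⟩ := exists_eq_incl_bicommutant n
  have h1 : stinespringOp w (incl M.commutant.commutant n h) =
      stinespringRep Θ a (stinespringOp w h) := by rw [← ha, stinespringOp_incl]
  have h2 := gammaMap_leftRep Θ₁ Θ₂ Θ hΘ a (stinespringOp w h)
  have h3 := adjoint_stinespring₂_leftRep huc a n ha.symm (gammaMap Θ₁ Θ₂ Θ hΘ (stinespringOp w h))
  exact (congrArg (fun v => ContinuousLinearMap.adjoint u (gammaMap Θ₁ Θ₂ Θ hΘ v)) h1).trans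
    ((congrArg (ContinuousLinearMap.adjoint u) h2).trans h3)

/-- If `u` is a unitary from `X ⊗ Y ⊗ H` onto `M ⊗_{Θ₂} M ⊗_{Θ₁} H` that respects all actions, then
`z ↦ Γ⋆ u z` is a coisometry from `X ⊗ Y` onto the correspondence of `Θ₁ ∘ Θ₂`. -/
theorem exists_isCoisometric_gammaMap (hΘ : ∀ a, Θ a = Θ₁ (Θ₂ a))
    (hul : ∀ b ξ, u (X.cpForm.leftRep (Y.cpForm.leftRep (incl M.commutant)) b ξ) =
      stinespringCommutantRep₂ Θ₁ Θ₂ b (u ξ)) (huu : u ∘L ContinuousLinearMap.adjoint u = 1) :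
    ∃ U : tensor X Y →ₗ[ℂ] arvesonStinespringCorrespondence Θ,
      IsCoisometric (.refl ℂ M.commutant) U ∧ ∀ z, stinespringOp (U z) =
        ContinuousLinearMap.adjoint (gammaMap Θ₁ Θ₂ Θ hΘ) ∘L u ∘L tensorOp z := by
  obtain ⟨U, hU⟩ := exists_linearMap_stinespringOp (Θ := Θ)
    (postcomp (ContinuousLinearMap.adjoint (gammaMap Θ₁ Θ₂ Θ hΘ) ∘L u) ∘ₗ tensorOpLinear X Y)
    (gammaMap_tensorOp_incl huc hΘ)
  obtain ⟨V, hV⟩ := exists_linearMap_tensorOp (X := X) (Y := Y)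
    (postcomp (ContinuousLinearMap.adjoint u ∘L gammaMap Θ₁ Θ₂ Θ hΘ) ∘ₗ stinespringOpLinear Θ)
    (adjoint_gammaMap_stinespringOp_incl huc hΘ)
  have hD : ContinuousLinearMap.adjoint (ContinuousLinearMap.adjoint (gammaMap Θ₁ Θ₂ Θ hΘ) ∘L u) =
      ContinuousLinearMap.adjoint u ∘L gammaMap Θ₁ Θ₂ Θ hΘ := by
    rw [ContinuousLinearMap.adjoint_comp, ContinuousLinearMap.adjoint_adjoint]
  refine ⟨U, isCoisometric_of_spatial (H := H) (K := space₂ X Y) (L := StinespringSpace Θ)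
    (N := M.commutant) (F := tensor X Y) (Z := arvesonStinespringCorrespondence Θ)
    (opF := tensorOp) (opZ := stinespringOp)
    (lF := X.cpForm.leftRep (Y.cpForm.leftRep (incl M.commutant)))
    (lZ := stinespringCommutantRep Θ)
    (D := ContinuousLinearMap.adjoint (gammaMap Θ₁ Θ₂ Θ hΘ) ∘L u) (V := V)
    (fun _ _ h => stinespringOp_injective h) incl_inner_tensor
    incl_inner_stinespring tensorOp_left stinespringOp_left tensorOp_right stinespringOp_right
    hU (fun w => ?_) ?_ fun b ξ => ?_, hU⟩
  · rw [hD]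
    exact hV w
  · rw [hD]
    calc _ = ContinuousLinearMap.adjoint (gammaMap Θ₁ Θ₂ Θ hΘ) ∘L
          (u ∘L ContinuousLinearMap.adjoint u) ∘L gammaMap Θ₁ Θ₂ Θ hΘ := rfl
      _ = 1 := by rw [huu, ← adjoint_gammaMap_comp hΘ]; rfl
  · exact (congrArg (ContinuousLinearMap.adjoint (gammaMap Θ₁ Θ₂ Θ hΘ)) (hul b ξ)).trans
      (adjoint_intertwining (gammaMap_commutantRep hΘ) b (u ξ))

end Abstract

section Concrete

variable {u : space₂ (arvesonStinespringCorrespondence Θ₁) (arvesonStinespringCorrespondence Θ₂)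
  →L[ℂ] StinespringSpace₂ Θ₁ Θ₂}
  (hu : ∀ x y h, u ((arvesonStinespringCorrespondence Θ₁).cpForm.tmul
    ((arvesonStinespringCorrespondence Θ₂).cpForm.leftRep (incl M.commutant)) x
    ((arvesonStinespringCorrespondence Θ₂).cpForm.tmul (incl M.commutant) y h)) =
      stinespringMap Θ₂ x (stinespringOp y h))

include hu

theorem stinespring₂_commutantAction₂ (a : M) (n : M.commutant.commutant)
    (han : incl M.commutant.commutant n = incl M a)
    (ξ : space₂ (arvesonStinespringCorrespondence Θ₁) (arvesonStinespringCorrespondence Θ₂)) :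
    u (commutantAction₂ (arvesonStinespringCorrespondence Θ₁) (arvesonStinespringCorrespondence Θ₂)
      n ξ) = (stinespringForm Θ₂).leftRep (stinespringRep Θ₁) a (u ξ) := by
  have : u ∘L commutantAction₂ (arvesonStinespringCorrespondence Θ₁)
      (arvesonStinespringCorrespondence Θ₂) n =
      (stinespringForm Θ₂).leftRep (stinespringRep Θ₁) a ∘L u := by
    refine (isTotal_tmul_tmul (arvesonStinespringCorrespondence Θ₁)
      (arvesonStinespringCorrespondence Θ₂) (incl M.commutant)).ext fun p => ?_
    rw [ContinuousLinearMap.comp_apply, ContinuousLinearMap.comp_apply, commutantAction₂_tmul,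
      hu, hu, han, stinespringOp_incl, stinespringMap_leftRep]
  exact DFunLike.congr_fun this ξ

theorem stinespring₂_leftRep (b : M.commutant)
    (ξ : space₂ (arvesonStinespringCorrespondence Θ₁) (arvesonStinespringCorrespondence Θ₂)) :
    u ((arvesonStinespringCorrespondence Θ₁).cpForm.leftRep
      ((arvesonStinespringCorrespondence Θ₂).cpForm.leftRep (incl M.commutant)) b ξ) =
        stinespringCommutantRep₂ Θ₁ Θ₂ b (u ξ) := by
  have : u ∘L (arvesonStinespringCorrespondence Θ₁).cpForm.leftRep
      ((arvesonStinespringCorrespondence Θ₂).cpForm.leftRep (incl M.commutant)) b =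
        stinespringCommutantRep₂ Θ₁ Θ₂ b ∘L u := by
    refine (isTotal_tmul_tmul (arvesonStinespringCorrespondence Θ₁)
      (arvesonStinespringCorrespondence Θ₂) (incl M.commutant)).ext fun p => ?_
    rw [ContinuousLinearMap.comp_apply, ContinuousLinearMap.comp_apply, CPForm.leftRep_tmul, hu,
      hu]
    exact stinespringMap_left p.1.1 b (stinespringOp p.1.2 p.2)
  exact DFunLike.congr_fun this ξ

end Concrete

/-- The multiplication of two Arveson–Stinespring correspondences is induced by a coisometry. -/
theorem exists_coisometric_stinespringMul (hΘ : ∀ a, Θ a = Θ₁ (Θ₂ a))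
    (h₁ : IsTotal fun p : arvesonStinespringCorrespondence Θ₁ × H => stinespringOp p.1 p.2)
    (h₂ : IsTotal fun p : arvesonStinespringCorrespondence Θ₂ × H => stinespringOp p.1 p.2) :
    ∃ U : tensor (arvesonStinespringCorrespondence Θ₁) (arvesonStinespringCorrespondence Θ₂) →ₗ[ℂ]
      arvesonStinespringCorrespondence Θ, IsCoisometric (.refl ℂ M.commutant) U ∧
        ∀ x y, U (elem x y) = stinespringMul hΘ x y := by
  obtain ⟨u, hu, huu⟩ := exists_unitary_stinespring₂ h₁ h₂
  obtain ⟨U, hUc, hU⟩ := exists_isCoisometric_gammaMap (stinespring₂_commutantAction₂ hu) hΘ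
    (stinespring₂_leftRep hu) huu
  refine ⟨U, hUc, fun x y => stinespringOp_injective (ContinuousLinearMap.ext fun h => ?_)⟩
  rw [hU, stinespringOp_mul, ContinuousLinearMap.comp_apply, ContinuousLinearMap.comp_apply,
    tensorOp_elem, hu]

end Multiplication

section Unit

variable {H : Type*} [NormedAddCommGroup H] [InnerProductSpace ℂ H] [CompleteSpace H]
  {M : VonNeumannAlgebra H}
variable {S : Type*} [AddMonoid S] (Θ : CPSemigroup S M)

theorem CPSemigroup.identityRep_injective (s : S) : Function.Injective (Θ.identityRep s) :=
  stinespringCompression_injective (Θ := Θ.map s)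

theorem CPSemigroup.identityRep_mul {s t : S} (x : Θ.arvesonStinespring.fiber s)
    (y : Θ.arvesonStinespring.fiber t) :
    Θ.identityRep (s + t) (Θ.arvesonStinespring.mul x y) =
      Θ.identityRep s x * Θ.identityRep t y :=
  stinespringCompression_mul (Θ.map_add s t) x y

theorem CPSemigroup.identityRep_left {s : S} (b : M.commutant)
    (x : Θ.arvesonStinespring.fiber s) :
    Θ.identityRep s ((Θ.arvesonStinespring.fiber s).left b x) =
      incl M.commutant b * Θ.identityRep s x :=
  stinespringCompression_left (Θ := Θ.map s) b x

theorem CPSemigroup.identityRep_right {s : S} (x : Θ.arvesonStinespring.fiber s)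
    (b : M.commutant) : Θ.identityRep s ((Θ.arvesonStinespring.fiber s).right x b) =
      Θ.identityRep s x * incl M.commutant b :=
  stinespringCompression_right (Θ := Θ.map s) x b

theorem CPSemigroup.identityRep_transport {s t : S} (h : s = t)
    (x : Θ.arvesonStinespring.fiber s) :
    Θ.identityRep t (Θ.arvesonStinespring.transport h x) = Θ.identityRep s x := by
  subst h
  rfl

theorem CPSemigroup.adjoint_stinespringVector_zero :
    ContinuousLinearMap.adjoint (stinespringVector (Θ.map 0)) ∘L stinespringVector (Θ.map 0) =
      1 := by
  refine ContinuousLinearMap.ext fun v => ext_inner_left ℂ fun w => ?_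
  rw [ContinuousLinearMap.comp_apply, ContinuousLinearMap.adjoint_inner_right]
  unfold stinespringVector
  rw [CPForm.inner_tmul]
  change ⟪w, incl M (Θ.map 0 (star 1 * 1)) v⟫_ℂ = _
  rw [Θ.map_zero, star_one, one_mul, map_one]

theorem CPSemigroup.stinespringOp_unit (b : M.commutant) :
    stinespringOp (Θ := Θ.map 0) (Θ.arvesonStinespring.unit b) =
      stinespringVector (Θ.map 0) ∘L incl M.commutant b := rfl

theorem CPSemigroup.identityRep_unit (b : M.commutant) :
    Θ.identityRep 0 (Θ.arvesonStinespring.unit b) = incl M.commutant b := by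
  change (ContinuousLinearMap.adjoint (stinespringVector (Θ.map 0)) ∘L
    stinespringVector (Θ.map 0)) ∘L incl M.commutant b = _
  rw [adjoint_stinespringVector_zero]
  rfl

/-- The identity representation is a representation. -/
theorem CPSemigroup.isRepresentation_identityRep :
    Θ.arvesonStinespring.IsRepresentation (incl M.commutant) Θ.identityRep where
  normal := isNormalMap_incl
  map_unit := Θ.identityRep_unit
  covariant s :=
    { completelyContractive := fun _ x => norm_compression_sq_le (Θ.norm_map_le s) x
      map_right := Θ.identityRep_right
      map_left := Θ.identityRep_left }
  map_mul := Θ.identityRep_mul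

theorem CPSemigroup.unit_surjective : Function.Surjective Θ.arvesonStinespring.unit := by
  intro x
  have h1 : Θ.identityRep 0 x ∈ M.commutant := by
    refine adjoint_comp_mem M (stinespringRep (Θ.map 0)) (fun a h => ?_)
      (show intertwiners M (stinespringRep (Θ.map 0)) from x).2
    have h2 := stinespringOp_incl (Θ := Θ.map 0) (Θ.arvesonStinespring.unit 1) a h
    rw [stinespringOp_unit, map_one] at h2
    exact h2
  refine ⟨⟨_, h1⟩, Θ.identityRep_injective 0 ?_⟩
  rw [identityRep_unit]
  rfl

theorem CPSemigroup.isSubproductSystem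
    (hsd : ∀ s, (arvesonStinespringCorrespondence (Θ.map s)).IsSelfDual)
    (htot : ∀ s, IsTotal fun p : arvesonStinespringCorrespondence (Θ.map s) × H =>
      stinespringOp p.1 p.2) : Θ.arvesonStinespring.IsSubproductSystem where
  isWStar s := ⟨hsd s, isNormal_stinespring_left (Θ := Θ.map s)⟩
  unit_bijective := by
    refine ⟨fun a b hab => incl_injective _ ?_, Θ.unit_surjective⟩
    rw [← Θ.identityRep_unit, hab, Θ.identityRep_unit]
  unit_add a b := Θ.identityRep_injective 0 (by
    rw [_root_.map_add, Θ.identityRep_unit, Θ.identityRep_unit, Θ.identityRep_unit, _root_.map_add])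
  unit_smul c a := Θ.identityRep_injective 0 (by
    rw [map_smul, Θ.identityRep_unit, Θ.identityRep_unit, map_smul])
  unit_inner a b := incl_injective _ (by
    refine (incl_inner_stinespring (Θ := Θ.map 0) _ _).trans ?_
    rw [stinespringOp_unit, stinespringOp_unit, ContinuousLinearMap.adjoint_comp, map_mul, map_star,
      ContinuousLinearMap.star_eq_adjoint, ContinuousLinearMap.comp_assoc,
      ← ContinuousLinearMap.comp_assoc _ (stinespringVector (Θ.map 0)),
      adjoint_stinespringVector_zero]
    rfl)
  unit_left a b := Θ.identityRep_injective 0 (by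
    rw [Θ.identityRep_left, Θ.identityRep_unit, Θ.identityRep_unit, map_mul])
  unit_right a b := Θ.identityRep_injective 0 (by
    rw [Θ.identityRep_right, Θ.identityRep_unit, Θ.identityRep_unit, map_mul])
  coisometric s t := exists_coisometric_stinespringMul (Θ.map_add s t) (htot s) (htot t)
  unit_mul a x := Θ.identityRep_injective _ (by
    rw [Θ.identityRep_transport, Θ.identityRep_mul, Θ.identityRep_unit, Θ.identityRep_left])
  mul_unit x a := Θ.identityRep_injective _ (by
    rw [Θ.identityRep_transport, Θ.identityRep_mul, Θ.identityRep_unit, Θ.identityRep_right])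
  mul_assoc x y z := Θ.identityRep_injective _ (by
    rw [Θ.identityRep_transport, Θ.identityRep_mul, Θ.identityRep_mul, Θ.identityRep_mul, Θ.identityRep_mul,
      _root_.mul_assoc])

end Unit

/-! ### Adjoints of maps of self-dual modules -/

section Adjoint

variable {A B : Type*} [CStarAlgebra A] [PartialOrder A] [StarOrderedRing A]
  [CStarAlgebra B] [PartialOrder B] [StarOrderedRing B]

theorem CStarCorrespondence.ext_inner (E : CStarCorrespondence A) {x y : E}
    (h : ∀ z, E.inner z x = E.inner z y) : x = y := by
  have h1 : E.inner (x - y) (x - y) = 0 := by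
    have h2 := E.inner_add (x - y) (x - y) y
    rwa [sub_add_cancel, h, right_eq_add] at h2
  have h3 := E.norm_sq (x - y)
  rw [h1, norm_zero] at h3
  exact sub_eq_zero.mp (norm_eq_zero.mp (pow_eq_zero_iff two_ne_zero |>.mp h3))

/-- A bounded module map on a self-dual module has an adjoint. -/
theorem CStarCorrespondence.IsSelfDual.exists_isAdjoint {E : CStarCorrespondence A}
    {F : CStarCorrespondence B} (hE : E.IsSelfDual) (α : A ≃⋆ₐ[ℂ] B) (W : E →ₗ[ℂ] F)
    (hr : ∀ x a, W (E.right x a) = F.right (W x) (α a))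
    (hb : ∀ x y, ‖F.inner y (W x)‖ ≤ ‖y‖ * ‖x‖) : ∃ V : F →ₗ[ℂ] E, IsAdjoint α W V := by
  have h1 : ∀ y, ∃ u, ∀ x, α.symm (F.inner y (W x)) = E.inner u x := by
    intro y
    let f : E →ₗ[ℂ] A :=
      { toFun := fun x => α.symm (F.inner y (W x))
        map_add' := fun x x' => by rw [map_add, F.inner_add, map_add]
        map_smul' := fun c x => by rw [map_smul, F.inner_smul, map_smul, RingHom.id_apply] }
    refine hE (f.mkContinuous ‖y‖ fun x => ?_) fun x a => ?_
    · exact (NonUnitalStarAlgHom.norm_apply_le α.symm _).trans (hb x y)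
    · change α.symm (F.inner y (W (E.right x a))) = α.symm (F.inner y (W x)) * a
      rw [hr, F.inner_right, map_mul, StarAlgEquiv.symm_apply_apply]
  choose u hu using h1
  have hu' : ∀ x y, E.inner x (u y) = α.symm (F.inner (W x) y) := fun x y => by
    rw [← E.star_inner, ← hu, ← map_star, F.star_inner]
  refine ⟨{ toFun := u
            map_add' := fun y y' => E.ext_inner fun x => by
              rw [hu', F.inner_add, map_add, E.inner_add, hu', hu']
            map_smul' := fun c y => E.ext_inner fun x => by
              rw [hu', F.inner_smul, map_smul, RingHom.id_apply, E.inner_smul, hu'] },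
    fun x y => ?_⟩
  change _ = α (E.inner x (u y))
  rw [hu', StarAlgEquiv.apply_symm_apply]

/-- A coisometric image of a self-dual module is self-dual. -/
theorem CStarCorrespondence.IsSelfDual.of_coisometry {E : CStarCorrespondence A}
    {F : CStarCorrespondence B} (hE : E.IsSelfDual) (α : A ≃⋆ₐ[ℂ] B) {W : E →ₗ[ℂ] F}
    {V : F →ₗ[ℂ] E} (hr : ∀ x a, W (E.right x a) = F.right (W x) (α a))
    (hb : ∀ x, ‖W x‖ ≤ ‖x‖) (hWV : IsAdjoint α W V) (h1 : ∀ y, W (V y) = y) :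
    F.IsSelfDual := by
  intro f hf
  let g : E →ₗ[ℂ] A :=
    { toFun := fun x => α.symm (f (W x))
      map_add' := fun x x' => by rw [map_add, map_add, map_add]
      map_smul' := fun c x => by rw [map_smul, map_smul, map_smul, RingHom.id_apply] }
  obtain ⟨u, hu⟩ := hE (g.mkContinuous ‖f‖ fun x => by
    refine (NonUnitalStarAlgHom.norm_apply_le α.symm _).trans ((f.le_opNorm _).trans ?_)
    gcongr
    exact hb x) fun x a => by
      change α.symm (f (W (E.right x a))) = α.symm (f (W x)) * a
      rw [hr, hf, map_mul, StarAlgEquiv.symm_apply_apply]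
  refine ⟨W u, fun y => ?_⟩
  have h2 : α.symm (f (W (V y))) = E.inner u (V y) := hu (V y)
  rw [h1] at h2
  rw [hWV, ← h2, StarAlgEquiv.apply_symm_apply]

/-- For a coisometry `W` with adjoint `V`, the projection onto the kernel of `W` is `1 - V W`. -/
theorem exists_isProjection_ker {E : CStarCorrespondence A} {F : CStarCorrespondence B}
    {α : A ≃⋆ₐ[ℂ] B} {W : E →ₗ[ℂ] F} {V : F →ₗ[ℂ] E} (hWV : IsAdjoint α W V)
    (h1 : ∀ y, W (V y) = y) : ∃ q : E →ₗ[ℂ] E, IsProjection q ∧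
      LinearMap.range q = LinearMap.ker W ∧ ∀ x, V (W x) = x - q x := by
  have hs : ∀ x y, E.inner (V (W x)) y = E.inner x (V (W y)) := fun x y => by
    have h2 : ∀ x y, E.inner x (V (W y)) = α.symm (F.inner (W x) (W y)) := fun x y => by
      rw [hWV, StarAlgEquiv.symm_apply_apply]
    rw [← E.star_inner, h2, h2, ← map_star, F.star_inner]
  have hsub : ∀ x y z, E.inner x (y - z) = E.inner x y - E.inner x z := fun x y z => by
    rw [eq_sub_iff_add_eq, ← E.inner_add, sub_add_cancel]
  refine ⟨LinearMap.id - V ∘ₗ W, ⟨fun x y => ?_, fun x => ?_⟩, ?_, fun x => ?_⟩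
  · change E.inner (x - V (W x)) y = E.inner x (y - V (W y))
    rw [← E.star_inner, hsub, hsub, star_sub, E.star_inner, E.star_inner, hs]
  · change (x - V (W x)) - V (W (x - V (W x))) = x - V (W x)
    rw [map_sub, h1, sub_self, map_zero, sub_zero]
  · ext x
    constructor
    · rintro ⟨y, rfl⟩
      change W (y - V (W y)) = 0
      rw [map_sub, h1, sub_self]
    · intro hx
      refine ⟨x, ?_⟩
      change x - V (W x) = x
      rw [LinearMap.mem_ker.mp hx, map_zero, sub_zero]
  · change _ = x - (x - V (W x))
    rw [sub_sub_cancel]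

end Adjoint

/-! ### The morphism onto the Arveson–Stinespring system -/

section Morphism

variable {A : Type*} [CStarAlgebra A] [PartialOrder A] [StarOrderedRing A]
  {E : CStarCorrespondence A}
variable {H : Type*} [NormedAddCommGroup H] [InnerProductSpace ℂ H] [CompleteSpace H]
variable {σ : A →⋆ₐ[ℂ] (H →L[ℂ] H)} {T : E →ₗ[ℂ] (H →L[ℂ] H)}

/-- `x ↦ (h ↦ x ⊗ h)` as a linear map. -/
def tmulLinear (E : CStarCorrespondence A) (σ : A →⋆ₐ[ℂ] (H →L[ℂ] H)) :
    E →ₗ[ℂ] H →L[ℂ] E.cpForm.Tensor σ where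
  toFun x := E.cpForm.tmul σ x
  map_add' x y := ContinuousLinearMap.ext fun h => E.cpForm.eq_of_inner_tmul σ fun z v => by
    rw [add_apply, inner_add_right, CPForm.inner_tmul, CPForm.inner_tmul, CPForm.inner_tmul,
      ← inner_add_right, ← add_apply, ← map_add]
    exact congrArg (fun a => ⟪v, σ a h⟫_ℂ) (E.inner_add z x y)
  map_smul' c x := ContinuousLinearMap.ext fun h => E.cpForm.eq_of_inner_tmul σ fun z v => by
    rw [RingHom.id_apply, smul_apply, inner_smul_right, CPForm.inner_tmul, CPForm.inner_tmul,
      ← inner_smul_right, ← smul_apply, ← map_smul]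
    exact congrArg (fun a => ⟪v, σ a h⟫_ℂ) (E.inner_smul c z x)

theorem norm_tmul_le (E : CStarCorrespondence A) (σ : A →⋆ₐ[ℂ] (H →L[ℂ] H)) (x : E) :
    ‖E.cpForm.tmul σ x‖ ≤ ‖x‖ := by
  refine ContinuousLinearMap.opNorm_le_bound _ (norm_nonneg _) fun h => ?_
  refine (sq_le_sq₀ (norm_nonneg _) (by positivity)).mp ?_
  have h1 := inner_self_eq_norm_sq_to_K (𝕜 := ℂ) (E.cpForm.tmul σ x h)
  rw [CPForm.inner_tmul] at h1
  have h2 : ‖E.cpForm.tmul σ x h‖ ^ 2 = ‖⟪h, σ (E.inner x x) h⟫_ℂ‖ := by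
    change ⟪h, σ (E.inner x x) h⟫_ℂ = _ at h1
    rw [h1, norm_pow, RCLike.norm_ofReal, abs_norm]
  rw [h2, mul_pow, E.norm_sq]
  calc ‖⟪h, σ (E.inner x x) h⟫_ℂ‖ ≤ ‖h‖ * ‖σ (E.inner x x) h‖ := norm_inner_le_norm _ _
    _ ≤ ‖h‖ * (‖E.inner x x‖ * ‖h‖) := by
        gcongr
        refine (ContinuousLinearMap.le_opNorm _ _).trans ?_
        gcongr
        exact NonUnitalStarAlgHom.norm_apply_le σ _
    _ = ‖E.inner x x‖ * ‖h‖ ^ 2 := by ring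

/-- The isometry `M ⊗_Θ H → E ⊗_σ H`, `a ⊗ h ↦ (I ⊗ a) T̃⋆ h`. -/
theorem IsCovariant.exists_isometry_stinespring (hT : IsCovariant σ T) :
    ∃ v : StinespringSpace hT.thetaCP →L[ℂ] E.cpForm.Tensor σ,
      ContinuousLinearMap.adjoint v ∘L v = 1 ∧
      (∀ a t, v (stinespringRep hT.thetaCP a t) = idTensorRep E σ a (v t)) ∧
      ContinuousLinearMap.adjoint (stinespringVector hT.thetaCP) ∘L ContinuousLinearMap.adjoint v =
        hT.tilde := by
  obtain ⟨v, hv, hvv⟩ := exists_isometry_of_gram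
    ((stinespringForm hT.thetaCP).isTotal_tmul (incl (commutantOf σ)))
    (fun p => idTensorRep E σ p.1 (ContinuousLinearMap.adjoint hT.tilde p.2)) fun p q => by
      rw [CPForm.inner_tmul]
      change _ = ⟪p.2, (hT.theta (star p.1 * q.1) : H →L[ℂ] H) q.2⟫_ℂ
      rw [hT.theta_star_mul, ContinuousLinearMap.comp_apply,
        ContinuousLinearMap.adjoint_inner_right]
      rfl
  have hv' : ∀ a h, v ((stinespringForm hT.thetaCP).tmul (incl (commutantOf σ)) a h) =
      idTensorRep E σ a (ContinuousLinearMap.adjoint hT.tilde h) := fun a h => hv (a, h)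
  refine ⟨v, hvv, fun a t => ?_, ?_⟩
  · have : v ∘L stinespringRep hT.thetaCP a = idTensorRep E σ a ∘L v := by
      refine (stinespringForm hT.thetaCP).ext_tmul (incl (commutantOf σ)) fun b h => ?_
      rw [ContinuousLinearMap.comp_apply, ContinuousLinearMap.comp_apply, CPForm.leftRep_tmul,
        hv', hv']
      change idTensorRep E σ (a * b) _ = _
      rw [map_mul]
      rfl
    exact DFunLike.congr_fun this t
  · have h1 : v ∘L stinespringVector hT.thetaCP = ContinuousLinearMap.adjoint hT.tilde := by
      refine ContinuousLinearMap.ext fun h => (hv' 1 h).trans ?_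
      rw [map_one]
      rfl
    rw [← ContinuousLinearMap.adjoint_comp, h1, ContinuousLinearMap.adjoint_adjoint]

/-- The map `W x = v⋆ (x ⊗ ·)` onto the Arveson–Stinespring correspondence of `Θ`, whose
compression to `H` is `T`. -/
theorem IsCovariant.exists_stinespring_map (hT : IsCovariant σ T)
    {v : StinespringSpace hT.thetaCP →L[ℂ] E.cpForm.Tensor σ}
    (hva : ∀ a t, v (stinespringRep hT.thetaCP a t) = idTensorRep E σ a (v t))
    (hvt : ContinuousLinearMap.adjoint (stinespringVector hT.thetaCP) ∘L
      ContinuousLinearMap.adjoint v = hT.tilde) :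
    ∃ W : E →ₗ[ℂ] arvesonStinespringCorrespondence hT.thetaCP,
      (∀ x, stinespringOp (W x) = ContinuousLinearMap.adjoint v ∘L E.cpForm.tmul σ x) ∧
      ∀ x, stinespringCompression hT.thetaCP (W x) = T x := by
  obtain ⟨W, hW⟩ := exists_linearMap_stinespringOp (Θ := hT.thetaCP)
    (postcomp (ContinuousLinearMap.adjoint v) ∘ₗ tmulLinear E σ) fun x a h => by
      refine Eq.trans ?_ (adjoint_intertwining hva a (E.cpForm.tmul σ x h))
      rw [CPForm.rightRep_tmul]
      rfl
  refine ⟨W, hW, fun x => ContinuousLinearMap.ext fun h => ?_⟩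
  have h1 := DFunLike.congr_fun (hW x) h
  have h2 := DFunLike.congr_fun hvt (E.cpForm.tmul σ x h)
  rw [hT.tilde_tmul] at h2
  exact (congrArg (ContinuousLinearMap.adjoint (stinespringVector hT.thetaCP)) h1).trans h2

/-- `W` is coisometric, with an adjoint that exists because `E` is self-dual. -/
theorem IsCovariant.exists_coisometry_stinespring (hT : IsCovariant σ T) (hE : E.IsSelfDual)
    (α : A ≃⋆ₐ[ℂ] (commutantOf σ).commutant)
    (hα : ∀ a, incl (commutantOf σ).commutant (α a) = σ a) :
    ∃ (W : E →ₗ[ℂ] arvesonStinespringCorrespondence hT.thetaCP)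
      (V : arvesonStinespringCorrespondence hT.thetaCP →ₗ[ℂ] E),
      (∀ x, stinespringCompression hT.thetaCP (W x) = T x) ∧ IsCorrespondenceMap α W ∧
      IsAdjoint α W V ∧ (∀ y, W (V y) = y) ∧ (∀ x, ‖W x‖ ≤ ‖x‖) ∧
      IsTotal fun p : arvesonStinespringCorrespondence hT.thetaCP × H =>
        stinespringOp p.1 p.2 := by
  obtain ⟨v, hvv, hva, hvt⟩ := hT.exists_isometry_stinespring
  obtain ⟨W, hW, hWT⟩ := hT.exists_stinespring_map hva hvt
  have hWm : IsCorrespondenceMap α W :=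
    { map_left := fun a x => stinespringCompression_injective (by
        rw [hWT, stinespringCompression_left, hWT, hα, hT.map_left])
      map_right := fun x a => stinespringCompression_injective (by
        rw [hWT, stinespringCompression_right, hWT, hα, hT.map_right]) }
  have hv1 : ‖ContinuousLinearMap.adjoint v‖ ≤ 1 := by
    have h1 : ‖v‖ * ‖v‖ ≤ 1 := by
      rw [← ContinuousLinearMap.norm_adjoint_comp_self, hvv]
      exact ContinuousLinearMap.norm_id_le
    rw [LinearIsometryEquiv.norm_map]
    nlinarith [norm_nonneg v]
  have hWn : ∀ x, ‖W x‖ ≤ ‖x‖ := fun x => by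
    change ‖stinespringOp (W x)‖ ≤ ‖x‖
    rw [hW]
    refine (ContinuousLinearMap.opNorm_comp_le _ _).trans ?_
    calc _ ≤ 1 * ‖x‖ := by gcongr; exact norm_tmul_le E σ x
      _ = ‖x‖ := one_mul _
  obtain ⟨V, hV⟩ := hE.exists_isAdjoint α W hWm.map_right fun x y => by
    change ‖ContinuousLinearMap.adjoint (stinespringOp y) ∘L stinespringOp (W x)‖ ≤
      ‖stinespringOp y‖ * ‖x‖
    refine (ContinuousLinearMap.opNorm_comp_le _ _).trans ?_
    rw [LinearIsometryEquiv.norm_map]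
    gcongr
    exact hWn x
  refine ⟨W, V, hWT, hWm, hV, fun y => stinespringOp_injective
    (ContinuousLinearMap.ext fun g => ?_), hWn, fun ξ hξ => ?_⟩
  · -- `V y ⊗ g = v (y g)`, by the definition of the adjoint
    have h1 : E.cpForm.tmul σ (V y) g = v (stinespringOp y g) := by
      refine E.cpForm.eq_of_inner_tmul σ fun x h => ?_
      refine Eq.trans ?_ (ContinuousLinearMap.adjoint_inner_left v (stinespringOp y g)
        (E.cpForm.tmul σ x h))
      rw [CPForm.inner_tmul]
      change ⟪h, σ (E.inner x (V y)) g⟫_ℂ =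
        ⟪(ContinuousLinearMap.adjoint v ∘L E.cpForm.tmul σ x) h, stinespringOp y g⟫_ℂ
      rw [← hW, inner_stinespringOp, hV, hα]
    have h2 := DFunLike.congr_fun hvv (stinespringOp y g)
    rw [hW, ContinuousLinearMap.comp_apply, h1]
    exact h2
  · have h1 : v ξ = 0 := E.cpForm.isTotal_tmul σ _ fun p => by
      have h2 := hξ (W p.1, p.2)
      rw [← ContinuousLinearMap.adjoint_inner_left]
      change ⟪(ContinuousLinearMap.adjoint v ∘L E.cpForm.tmul σ p.1) p.2, ξ⟫_ℂ = 0
      rw [← hW]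
      exact h2
    have h2 := DFunLike.congr_fun hvv ξ
    rw [ContinuousLinearMap.comp_apply, h1, map_zero] at h2
    exact h2.symm

end Morphism

section Bicommutant

variable {G : Type*} [NormedAddCommGroup G] [InnerProductSpace ℂ G] [CompleteSpace G]
  {N : VonNeumannAlgebra G}
variable {H : Type*} [NormedAddCommGroup H] [InnerProductSpace ℂ H] [CompleteSpace H]
variable {σ : N →⋆ₐ[ℂ] (H →L[ℂ] H)}

/-- A faithful normal representation identifies `N` with the bicommutant of its image. -/
theorem exists_equiv_bicommutant (hn : IsNormalMap N σ) (hσ : Function.Injective σ) :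
    ∃ α : N ≃⋆ₐ[ℂ] (commutantOf σ).commutant,
      ∀ a, incl (commutantOf σ).commutant (α a) = σ a := by
  have hmem : ∀ a, σ a ∈ (commutantOf σ).commutant := fun a => by
    rw [mem_commutant_iff]
    exact fun b hb => (mem_commutantOf.mp hb a).symm
  let f : N →⋆ₐ[ℂ] (commutantOf σ).commutant :=
    { toFun := fun a => ⟨σ a, hmem a⟩
      map_one' := Subtype.ext (map_one σ)
      map_mul' := fun a b => Subtype.ext (map_mul σ a b)
      map_zero' := Subtype.ext (map_zero σ)
      map_add' := fun a b => Subtype.ext (map_add σ a b)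
      commutes' := fun c => Subtype.ext (AlgHomClass.commutes σ c)
      map_star' := fun a => Subtype.ext (map_star σ a) }
  refine ⟨StarAlgEquiv.ofBijective f ⟨fun a b hab => hσ (congrArg Subtype.val hab), fun b => ?_⟩,
    fun a => rfl⟩
  obtain ⟨a, ha⟩ := exists_eq_of_mem_bicommutant hn hσ b.2
  exact ⟨a, Subtype.ext ha⟩

/-- If `X` has an isometric representation that is faithful on `N`, the multiplication of `X` is
isometric. -/
theorem CorrespondenceSystem.IsSubproductSystem.isProductSystem {S : Type*} [AddMonoid S]
    {X : CorrespondenceSystem S N} (hX : X.IsSubproductSystem)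
    {R : ∀ s, X.fiber s →ₗ[ℂ] (H →L[ℂ] H)} (hR : X.IsRepresentation σ R)
    (hσ : Function.Injective σ) (hi : ∀ s, IsIsometric σ (R s)) : X.IsProductSystem := by
  refine ⟨hX, fun s t => ?_⟩
  obtain ⟨U, ⟨hUm, V, hV, hUV⟩, hU⟩ := hX.coisometric s t
  refine ⟨U, ⟨hUm, V, hV, hUV, ?_⟩, hU⟩
  have hV' : ∀ x y, (X.fiber (s + t)).inner (U x) y =
    (tensor (X.fiber s) (X.fiber t)).inner x (V y) := hV
  have hmul : ∀ x x' y y', (X.fiber (s + t)).inner (X.mul x y) (X.mul x' y') =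
      (X.fiber t).inner y ((X.fiber t).left ((X.fiber s).inner x x') y') := fun x x' y y' => by
    refine hσ ?_
    rw [← hi, ← hi, hR.map_mul, hR.map_mul, (hR.covariant t).map_left, ← hi, star_mul]
    simp only [_root_.mul_assoc]
  have h1 : ∀ x y, V (U (elem x y)) = elem x y := fun x y =>
    tensor_ext _ _ fun x' y' => by rw [← hV', hU, hU, hmul, inner_elem]
  intro z
  refine tensor_ext _ _ fun x y => ?_
  rw [← hV', ← CStarCorrespondence.star_inner, hV', h1, CStarCorrespondence.star_inner]

end Bicommutant

end Subproduct

end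

open Subproduct in
theorem mainTheorem6 {S : Type*} [AddMonoid S]
    {G : Type*} [NormedAddCommGroup G] [InnerProductSpace ℂ G] [CompleteSpace G]
    {H : Type*} [NormedAddCommGroup H] [InnerProductSpace ℂ H] [CompleteSpace H]
    (N : VonNeumannAlgebra G)
    (X : Subproduct.CorrespondenceSystem S N) (hX : X.IsSubproductSystem)
    (σ : N →⋆ₐ[ℂ] (H →L[ℂ] H)) (R : ∀ s, X.fiber s →ₗ[ℂ] (H →L[ℂ] H))
    (hR : X.IsRepresentation σ R) (hσ : Function.Injective σ) :
    ∃ Θ : Subproduct.CPSemigroup S (Subproduct.commutantOf σ),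
      (∀ s (a : Subproduct.commutantOf σ), (Θ.map s a : H →L[ℂ] H) =
        (hR.covariant s).tilde ∘L Subproduct.idTensor (X.fiber s) a ∘L
          ContinuousLinearMap.adjoint (hR.covariant s).tilde) ∧
      Θ.arvesonStinespring.IsSubproductSystem ∧
      Θ.arvesonStinespring.IsRepresentation (Subproduct.incl (Subproduct.commutantOf σ).commutant)
        Θ.identityRep ∧
      ∃ (α : N ≃⋆ₐ[ℂ] (Subproduct.commutantOf σ).commutant)
        (W : ∀ s, X.fiber s →ₗ[ℂ] Θ.arvesonStinespring.fiber s),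
        Subproduct.CorrespondenceSystem.IsMorphism (X := X) (Y := Θ.arvesonStinespring) α W ∧
        (∀ s x, R s x = Θ.identityRep s (W s x)) ∧
        (∀ s, ∃ (V : Θ.arvesonStinespring.fiber s →ₗ[ℂ] X.fiber s)
          (q : X.fiber s →ₗ[ℂ] X.fiber s),
          Subproduct.IsAdjoint α (W s) V ∧ Subproduct.IsProjection q ∧
          LinearMap.range q = LinearMap.ker (R s) ∧ ∀ x, V (W s x) = x - q x) ∧
        (Subproduct.CorrespondenceSystem.IsIsomorphism (X := X) (Y := Θ.arvesonStinespring) α W ↔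
          ∀ s, Function.Injective (R s)) ∧
        ((∀ s, Subproduct.IsIsometric σ (R s)) → X.IsProductSystem) := by
  obtain ⟨α, hα⟩ := exists_equiv_bicommutant hR.normal hσ
  have key : ∀ s, ∃ (W : X.fiber s →ₗ[ℂ] (thetaSemigroup hX hR).arvesonStinespring.fiber s)
      (V : (thetaSemigroup hX hR).arvesonStinespring.fiber s →ₗ[ℂ] X.fiber s),
      (∀ x, (thetaSemigroup hX hR).identityRep s (W x) = R s x) ∧ IsCorrespondenceMap α W ∧
      IsAdjoint α W V ∧ (∀ y, W (V y) = y) ∧ (∀ x, ‖W x‖ ≤ ‖x‖) ∧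
      IsTotal fun p : arvesonStinespringCorrespondence ((thetaSemigroup hX hR).map s) × H =>
        stinespringOp p.1 p.2 := fun s =>
    (hR.covariant s).exists_coisometry_stinespring (hX.isWStar s).1 α hα
  choose W V hWR hWm hWV hWV1 hWn htot using key
  have hΘ : ∀ s (a : commutantOf σ), ((thetaSemigroup hX hR).map s a : H →L[ℂ] H) =
      (hR.covariant s).tilde ∘L idTensor (X.fiber s) a ∘L
        ContinuousLinearMap.adjoint (hR.covariant s).tilde := fun _ _ => rfl
  generalize thetaSemigroup hX hR = Θ at W V hWR hWm hWV hWV1 hWn htot hΘ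
  have hker : ∀ s, LinearMap.ker (W s) = LinearMap.ker (R s) := fun s => by
    ext x
    rw [LinearMap.mem_ker, LinearMap.mem_ker, ← hWR]
    exact (map_eq_zero_iff _ (Θ.identityRep_injective s)).symm
  have hmor : CorrespondenceSystem.IsMorphism (X := X) (Y := Θ.arvesonStinespring) α W :=
    { -- both identities are checked in `B(H)`, where `W` becomes `R`
      map_unit := fun a => Θ.identityRep_injective 0 (by
        rw [hWR, hR.map_unit, Θ.identityRep_unit, hα])
      coisometric := fun s _ => ⟨hWm s, V s, hWV s, hWV1 s⟩
      map_mul := fun {s t} x y => Θ.identityRep_injective (s + t) (by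
        rw [hWR, hR.map_mul, Θ.identityRep_mul, hWR, hWR]) }
  refine ⟨Θ, hΘ, Θ.isSubproductSystem (fun s => (hX.isWStar s).1.of_coisometry α
    (hWm s).map_right (hWn s) (hWV s) (hWV1 s)) htot, Θ.isRepresentation_identityRep, α, W, hmor,
    fun s x => (hWR s x).symm, fun s => ?_, ⟨fun h s => ?_, fun h => ⟨hmor, fun s _ => ?_⟩⟩,
    hX.isProductSystem hR hσ⟩
  · obtain ⟨q, hq, hqr, hqV⟩ := exists_isProjection_ker (hWV s) (hWV1 s)
    exact ⟨V s, q, hWV s, hq, hqr.trans (hker s), hqV⟩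
  · by_cases hs : s = 0
    · -- `X(0) = N`, and `R_0 = σ` is faithful
      subst hs
      intro x y hxy
      obtain ⟨a, rfl⟩ := hX.unit_bijective.2 x
      obtain ⟨b, rfl⟩ := hX.unit_bijective.2 y
      rw [hR.map_unit, hR.map_unit] at hxy
      rw [hσ hxy]
    · obtain ⟨-, V', -, -, hV'⟩ := h.unitary s hs
      intro x y hxy
      rw [← hWR, ← hWR] at hxy
      rw [← hV' x, Θ.identityRep_injective s hxy, hV']
  · refine ⟨hWm s, V s, hWV s, hWV1 s, fun x => h s ?_⟩
    rw [← hWR, hWV1, hWR]
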